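/- **Theorem (Mitchell's theorem 1 for Lie groups).** Let $G$ be a connected real (finite-dimensional, Hausdorff, smooth) Lie group with Lie algebra $\mathfrak g$, and let $D\subset\mathfrak g$ be a linear subspace which generates $\mathfrak g$: with $V^0=0$, $V^1=D$, $V^{i+1}=V^i+[D,V^i]$, one has $V^m=\mathfrak g$ for some $m$. Fix an inner product on $D$, with norm $\|\cdot\|$. Let $d_G$ be the Carnot–Carathéodory distance on $G$, $$d_G(x,y)=\inf\Big\{\int_a^b\|c^{-1}\dot c\|\,dt\;:\;c:[a,b]\to G\text{ absolutely continuous},\ c(a)=x,\ c(b)=y,\ c^{-1}\dot c\in D\text{ a.e.}\Big\}.$$ Let $\mathfrak g=\bigoplus_j W_j$ be any direct sum decomposition with $V^i=\bigoplus_{j\le i}W_j$ for all $i$ (so $W_1=D$), and let $x_j$ denote the $W_j$-component of $x$. The nilpotentisation of $(\mathfrak g,D)$ is $\mathfrak g$ with the nilpotent Lie bracket $[x,y]_n=\sum_{j,k}\,([x_j,y_k])_{j+k}$ and with the group operation $x\stackrel{\mathfrak n}{\cdot}y=x+y+\tfrac12[x,y]_n+\cdots$ given by the Baker–Campbell–Hausdorff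 formula for $[\cdot,\cdot]_n$. Let $d_N$ be the Carnot–Carathéodory distance on $\mathfrak g$ defined in the same way from the distribution and the norm obtained from $D$ and $\|\cdot\|$ by the left translations of $\stackrel{\mathfrak n}{\cdot}$. Say that pointed metric spaces $(X_\lambda,x_\lambda,d_\lambda)$ converge in the Gromov–Hausdorff sense to $(Y,y,d_Y)$ as $\lambda\to\infty$ if for all $r,\varepsilon>0$ and all sufficiently large $\lambda$ there is a map $f:B(x_\lambda,r)\to Y$ with $f(x_\lambda)=y$, with distortion $\sup_{p,q}|d_Y(f(p),f(q))-d_\lambda(p,q)|<\varepsilon$, and with $B(y,r)$ contained in the $\varepsilon$-neighbourhood of $f(B(x_\lambda,r))$. Then $d_G$ and $d_N$ are (finite) distances, and: 1. for every $x\in G$, the pointed spaces $(G,x,\lambda d_G)$ converge to $(\mathfrak g,0,d_N)$ as $\lambda\to\infty$; 2. $\exp_G$ is injective on some neighbourhood of $0$ in $\mathfrak g$, and for every neighbourhood $U$ of $0$ on which $\exp_G$ is injective, with $d_G$ transported to $U$ by $d_G(X,Y):=d_G(\exp_G X,\exp_G Y)$, the pointed spaces $(U,0,\lambda d_G)$ converge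 to $(\mathfrak g,0,d_N)$ as $\lambda\to\infty$. -/

import Mathlib

open Set Filter MeasureTheory Module
open scoped Manifold ContDiff Topology ENNReal Nat

/-! ### Distances and pointed Gromov–Hausdorff convergence -/

/-- `d` is a (finite) distance on `X`. -/
structure IsDistance {X : Type*} (d : X → X → ℝ≥0∞) : Prop where
  ne_top : ∀ x y, d x y ≠ ⊤
  eq_zero_iff : ∀ x y, d x y = 0 ↔ x = y
  symm : ∀ x y, d x y = d y x
  triangle : ∀ x y z, d x z ≤ d x y + d y z

/-- Gromov–Hausdorff convergence of the pointed spaces `(X i, x i, d i)` to `(Y, y, dY)` along the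
filter `l`: for all `r, ε > 0`, eventually there is a map `f` from the ball `B(x i, r)` to `Y` with
`f (x i) = y`, with distortion `< ε`, and such that `B(y, r)` lies in the `ε`-neighbourhood of the
image of `B(x i, r)`. (The map is written as a map on all of `X i`, of which only the values on the
ball matter.) -/
def TendstoPointedGH {ι : Type*} (l : Filter ι) {X : ι → Type*} (x : ∀ i, X i)
    (d : ∀ i, X i → X i → ℝ≥0∞) {Y : Type*} (y : Y) (dY : Y → Y → ℝ≥0∞) : Prop :=
  ∀ r : ℝ, 0 < r → ∀ ε : ℝ, 0 < ε → ∀ᶠ i in l, ∃ f : X i → Y,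
    f (x i) = y ∧
    (∃ η : ℝ, η < ε ∧ ∀ p q : X i,
      d i (x i) p < ENNReal.ofReal r → d i (x i) q < ENNReal.ofReal r →
        dY (f p) (f q) ≤ d i p q + ENNReal.ofReal η ∧
        d i p q ≤ dY (f p) (f q) + ENNReal.ofReal η) ∧
    ∀ z : Y, dY y z < ENNReal.ofReal r →
      ∃ p : X i, d i (x i) p < ENNReal.ofReal r ∧ dY (f p) z < ENNReal.ofReal ε

/-! ### Carnot–Carathéodory distances -/

section CC

variable {E : Type*} [NormedAddCommGroup E] [NormedSpace ℝ E] {H : Type*} [TopologicalSpace H]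
  (I : ModelWithCorners ℝ E H) {M : Type*} [TopologicalSpace M] [ChartedSpace H M] {F : Type*}

/-- Let the distribution on `M` be parametrised by `X p : F → T_p M`. The curve `c : [a, b] → M` is
horizontal with velocity coordinates `u` if it is absolutely continuous (`f ∘ c` is absolutely
continuous for every smooth real function `f`) and `ċ(t) = X_{c(t)} (u(t))` for almost every `t`. -/
structure IsHorizontalCurve (X : ∀ p : M, F → TangentSpace I p)
    (c : ℝ → M) (u : ℝ → F) (a b : ℝ) : Prop where
  continuousOn : ContinuousOn c (Icc a b)
  absolutelyContinuous : ∀ f : M → ℝ, ContMDiff I 𝓘(ℝ, ℝ) ∞ f →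
    AbsolutelyContinuousOnInterval (f ∘ c) a b
  hasMFDerivAt : ∀ᵐ t ∂(volume.restrict (Ioo a b)),
    HasMFDerivAt 𝓘(ℝ, ℝ) I c t ((1 : ℝ →L[ℝ] ℝ).smulRight (X (c t) (u t)))

/-- The Carnot–Carathéodory distance: the infimum of the lengths `∫ N (u t) dt` of the horizontal
curves from `p` to `q`, where `N` is the norm on the fibre `F` of the distribution
(`⊤` if there is no such curve). -/
noncomputable def ccEDist (X : ∀ p : M, F → TangentSpace I p) (N : F → ℝ) (p q : M) : ℝ≥0∞ :=
  ⨅ (c : ℝ → M) (u : ℝ → F) (a : ℝ) (b : ℝ) (_ : a ≤ b) (_ : IsHorizontalCurve I X c u a b)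
    (_ : c a = p) (_ : c b = q), ∫⁻ t in Icc a b, ENNReal.ofReal (N (u t))

end CC

/-! ### Nilpotentisation of a Lie algebra with respect to a generating subspace -/

section Nilpotentisation

variable {L : Type*} [LieRing L] [LieAlgebra ℝ L]

/-- The filtration `V⁰ = 0`, `V¹ = D`, `Vⁱ⁺¹ = Vⁱ + [D, Vⁱ]`. -/
def bracketFiltration (D : Submodule ℝ L) : ℕ → Submodule ℝ L
  | 0 => ⊥
  | 1 => D
  | i + 2 => bracketFiltration D (i + 1) ⊔
      Submodule.span ℝ {z | ∃ x ∈ D, ∃ y ∈ bracketFiltration D (i + 1), z = ⁅x, y⁆}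

/-- `D` is bracket generating: `Vᵐ` is the whole algebra for some `m`. -/
def IsBracketGenerating (D : Submodule ℝ L) : Prop := ∃ m, bracketFiltration D m = ⊤

/-- A direct sum decomposition `L = ⨁ Wⱼ` with `Vⁱ = ⨁_{j ≤ i} Wⱼ` for all `i`
(so `W₀ = 0` and `W₁ = D`). -/
structure AdaptedGrading (D : Submodule ℝ L) where
  W : ℕ → Submodule ℝ L
  isInternal : DirectSum.IsInternal W
  filtration : ∀ i, (⨆ j ≤ i, W j) = bracketFiltration D i

theorem AdaptedGrading.bijective {D : Submodule ℝ L} (𝒲 : AdaptedGrading D) :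
    Function.Bijective (DirectSum.coeLinearMap 𝒲.W) := 𝒲.isInternal

/-- The projection of `L` on the summand `Wᵢ`, as an endomorphism of `L`. -/
noncomputable def AdaptedGrading.proj {D : Submodule ℝ L} (𝒲 : AdaptedGrading D) (i : ℕ) :
    L →ₗ[ℝ] L :=
  (𝒲.W i).subtype ∘ₗ DirectSum.component ℝ ℕ (fun j => 𝒲.W j) i ∘ₗ
    (LinearEquiv.ofBijective (DirectSum.coeLinearMap 𝒲.W) 𝒲.bijective).symm.toLinearMap

/-- The nilpotent bracket `[x, y]ₙ = ∑_{j,k} [xⱼ, y_k]_{j+k}` on `L`, where `z_s` is the `W_s`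
component of `z` (components of degree larger than `dim L` vanish). For `x ∈ Wⱼ`, `y ∈ W_k` this is
the bracket of the classes of `x` and `y` in the graded algebra `⨁ Vⁱ/Vⁱ⁻¹ ≅ ⨁ Wᵢ`. -/
noncomputable def AdaptedGrading.nilBracket {D : Submodule ℝ L} (𝒲 : AdaptedGrading D) :
    L →ₗ[ℝ] L →ₗ[ℝ] L :=
  ∑ j ∈ Finset.range (finrank ℝ L + 1), ∑ k ∈ Finset.range (finrank ℝ L + 1),
    ((LieAlgebra.ad ℝ L : L →ₗ[ℝ] L →ₗ[ℝ] L).compl₁₂ (𝒲.proj j) (𝒲.proj k)).compr₂ (𝒲.proj (j + k))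

end Nilpotentisation

/-! ### The simply connected group of a nilpotent Lie algebra, in exponential coordinates -/

section BCH

variable {V : Type*} [NormedAddCommGroup V] [NormedSpace ℝ V]

/-- `exp T` for a nilpotent endomorphism `T` of a finite dimensional space. -/
noncomputable def nilExp (T : Module.End ℝ V) : Module.End ℝ V :=
  ∑ k ∈ Finset.range (finrank ℝ V + 1), ((k ! : ℝ)⁻¹) • T ^ k

/-- `ψ(P) = P log P / (P - 1) = P ∑ₖ (-1)ᵏ (P - 1)ᵏ / (k + 1)` for a unipotent endomorphism `P`
of a finite dimensional space. -/
noncomputable def bchKernel (P : Module.End ℝ V) : Module.End ℝ V :=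
  P * ∑ k ∈ Finset.range (finrank ℝ V + 1), ((-1 : ℝ) ^ k / (k + 1)) • (P - 1) ^ k

/-- The group operation `x · y = log (exp x exp y)` on a nilpotent Lie algebra with bracket `br`,
by the Baker–Campbell–Hausdorff formula
`x · y = x + ∫₀¹ ψ(exp(ad x) exp(t ad y)) y dt = x + y + [x, y] / 2 + ⋯`. -/
noncomputable def bchMul (br : V →ₗ[ℝ] V →ₗ[ℝ] V) (x y : V) : V :=
  x + ∫ t in (0 : ℝ)..1, bchKernel (nilExp (br x) * nilExp (t • br y)) y

end BCH

/-! ### The distances on a Lie group and on the nilpotentisation of its Lie algebra -/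

section LieGroup

variable {E : Type*} [NormedAddCommGroup E] [NormedSpace ℝ E]
  {G : Type*} [TopologicalSpace G] [ChartedSpace E G] [Group G]

/-- A smooth real Lie group has the regularity which Mathlib asks for in the construction of the
Lie bracket on `GroupLieAlgebra`. -/
instance lieGroup_minSmoothness [h : LieGroup 𝓘(ℝ, E) ∞ G] :
    LieGroup 𝓘(ℝ, E) (minSmoothness ℝ 3) G :=
  LieGroup.of_le (m := minSmoothness ℝ 3) (n := ∞) (by
    rw [minSmoothness_of_isRCLikeNormedField]; exact ENat.LEInfty.out)

open Classical in
/-- The exponential map of a Lie group: `exp X = γ(1)`, where `γ` is the integral curve with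
`γ(0) = 1` of the left-invariant vector field with value `X` at `1`. -/
noncomputable def lieExp (X : GroupLieAlgebra 𝓘(ℝ, E) G) : G :=
  if h : ∃ γ : ℝ → G, IsMIntegralCurve (I := 𝓘(ℝ, E)) γ (mulInvariantVectorField X) ∧ γ 0 = 1
  then h.choose 1 else 1

/-- The norm of an inner product. -/
noncomputable def formNorm {F : Type*} [AddCommGroup F] [Module ℝ F]
    (B : LinearMap.BilinForm ℝ F) (u : F) : ℝ := √(B u u)

/-- The Carnot–Carathéodory distance on `G` of the left-invariant distribution and the
left-invariant metric given by `D` and the inner product `B` on `D`. -/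
noncomputable def distG (D : Submodule ℝ (GroupLieAlgebra 𝓘(ℝ, E) G))
    (B : LinearMap.BilinForm ℝ D) (x y : G) : ℝ≥0∞ :=
  ccEDist 𝓘(ℝ, E) (fun (g : G) (u : D) => mulInvariantVectorField u.1 g) (formNorm B) x y

variable [LieGroup 𝓘(ℝ, E) ∞ G] [CompleteSpace E]

variable (E G) in
/-- The Lie algebra of `G` is, as a topological vector space, the model space `E`
(`GroupLieAlgebra` unfolds to `E`). -/
def lieAlgebraEquivModel : GroupLieAlgebra 𝓘(ℝ, E) G ≃L[ℝ] E :=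
  ContinuousLinearEquiv.refl ℝ E

/-- The nilpotent bracket of an adapted grading, seen on the model space `E`. -/
noncomputable def modelNilBracket {D : Submodule ℝ (GroupLieAlgebra 𝓘(ℝ, E) G)}
    (𝒲 : AdaptedGrading D) : E →ₗ[ℝ] E →ₗ[ℝ] E :=
  (𝒲.nilBracket.compl₁₂ (lieAlgebraEquivModel E G).symm.toLinearMap
    (lieAlgebraEquivModel E G).symm.toLinearMap).compr₂ (lieAlgebraEquivModel E G).toLinearMap

/-- The Carnot–Carathéodory distance on the Lie algebra with the nilpotent group operation `·ₙ`, of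
the distribution and the metric given by `D` and `B`, extended by the left translations
`y ↦ x ·ₙ y`. -/
noncomputable def distN {D : Submodule ℝ (GroupLieAlgebra 𝓘(ℝ, E) G)} (𝒲 : AdaptedGrading D)
    (B : LinearMap.BilinForm ℝ D) (x y : GroupLieAlgebra 𝓘(ℝ, E) G) : ℝ≥0∞ :=
  ccEDist 𝓘(ℝ, E)
    (fun (p : E) (u : D) => fderiv ℝ (bchMul (modelNilBracket 𝒲) p) 0 (lieAlgebraEquivModel E G u.1))
    (formNorm B) (lieAlgebraEquivModel E G x) (lieAlgebraEquivModel E G y)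

end LieGroup

/-! In exponential coordinates the left-invariant frame of `G` is `ψ(ad p)⁻¹` with `ψ(T) = (1 - exp
(-T)) / T`, so it depends on the Lie bracket alone. Let `δ_s` be the dilation which multiplies `W_j`
by `s ^ j`. Pulling the bracket back by `δ_s` gives `[x, y]_s = ∑ s ^ (j + k - l) [x_j, y_k]_l`.
Because the bracket respects the filtration, only `l ≤ j + k` occurs; hence the family is polynomial
in `s`, and at `s = 0` it is the nilpotent bracket. Since `δ_s` acts on `D = W₁` as multiplication
by `s`, the rescaled distance `d_s(p, q) = s⁻¹ d_G(exp δ_s p, exp δ_s q)` is, for bounded `p, q` and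
small `s`, computed by control curves of the frame of `[·,·]_s` with the original controls and the
original norm. With `s = 1/λ` the theorem says that these distances converge as the brackets do.

The convergence is uniform on bounded sets (`FrameFamily.dist_le_add`). An almost minimal curve of
one system is imitated by a curve of the other with nearly the same control, and Grönwall's
inequality bounds the distance between the end points (`IsControlCurve.exists_close`). The remaining
gap is closed by a Chow theorem uniform in `s` (`FrameFamily.equicontinuous`).

The uniform Chow theorem uses conjugations. Conjugating the flow of the left-invariant field `v` by
the flow of a control `a` gives the flow of `exp (ad a) v` (`FrameOn.attainable_conj`). The vectors
`exp (ad a₁) ⋯ exp (ad a_m) u` span the nilpotent algebra, and since dilations are automorphisms of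
the limit bracket, a basis of such vectors can be chosen with arbitrarily short letters
(`FilteredBracket.exists_basis_conjWord`). The vectors of the same words depend continuously on `s`,
so one choice serves all small `s`, and a quantitative inverse function theorem with constants
independent of `s` shows that nearby points are joined cheaply (`exists_dist_le_of_attainable`).

Two identifications link this to the statement. On the side of `G`, the derivative of the
exponential map comes from the first variation of flow lines (`FrameOn.norm_variation_le`), and
short horizontal curves lift to the exponential chart (`IsExpChart.exists_lift`). On the nilpotent
side, differentiating the Baker–Campbell–Hausdorff product at `0` gives the same expression `ψ(ad
p)⁻¹` (`hasFDerivAt_bchMul`). The Gromov–Hausdorff approximation is then `g ↦ δ_{1/s} (log g)`,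
preceded by a left translation for a general base point (`HorizontalNorm.exists_approximation`). -/

/-! ### Ordinary differential equations -/

section ODE

open Metric

variable {V : Type*} [NormedAddCommGroup V] [NormedSpace ℝ V]
  {F : Type*} [NormedAddCommGroup F] [NormedSpace ℝ F]

/-- The radial retraction of a normed space on the closed ball of radius `R`. -/
noncomputable def radialRetraction (R : ℝ) (x : V) : V := (R / max R ‖x‖) • x

theorem radialRetraction_of_norm_le {R : ℝ} (hR : 0 < R) {x : V} (hx : ‖x‖ ≤ R) :
    radialRetraction R x = x := by
  rw [radialRetraction, max_eq_left hx, div_self hR.ne', one_smul]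

theorem norm_radialRetraction_le {R : ℝ} (hR : 0 < R) (x : V) : ‖radialRetraction R x‖ ≤ R := by
  have hM : 0 < max R ‖x‖ := lt_max_of_lt_left hR
  rw [radialRetraction, norm_smul, Real.norm_of_nonneg (by positivity), div_mul_eq_mul_div,
    div_le_iff₀ hM]
  exact mul_le_mul_of_nonneg_left (le_max_right _ _) hR.le

/-- The difference splits into a move of the point at a fixed scaling factor and a change of the
factor at a fixed point. Each part contributes at most `‖x - y‖`, whatever the norm. -/
theorem norm_radialRetraction_sub_le {R : ℝ} (hR : 0 < R) (x y : V) :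
    ‖radialRetraction R x - radialRetraction R y‖ ≤ 2 * ‖x - y‖ := by
  have hMx : 0 < max R ‖x‖ := lt_max_of_lt_left hR
  have hMy : 0 < max R ‖y‖ := lt_max_of_lt_left hR
  have e : radialRetraction R x - radialRetraction R y =
      (R / max R ‖x‖) • (x - y) + (R / max R ‖x‖ - R / max R ‖y‖) • y := by
    simp only [radialRetraction]; module
  have h1 : ‖(R / max R ‖x‖) • (x - y)‖ ≤ ‖x - y‖ := by
    rw [norm_smul, Real.norm_of_nonneg (by positivity)]
    exact mul_le_of_le_one_left (norm_nonneg _) ((div_le_one hMx).2 (le_max_left _ _))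
  have h2 : ‖(R / max R ‖x‖ - R / max R ‖y‖) • y‖ ≤ ‖x - y‖ := by
    have e2 : R / max R ‖x‖ - R / max R ‖y‖ =
        R / max R ‖x‖ * ((max R ‖y‖ - max R ‖x‖) / max R ‖y‖) := by
      field_simp
    have h3 : |max R ‖y‖ - max R ‖x‖| ≤ ‖x - y‖ := by
      rw [abs_sub_comm]
      refine (abs_max_sub_max_le_max _ _ _ _).trans ?_
      simp only [sub_self, abs_zero]
      exact max_le (norm_nonneg _) (abs_norm_sub_norm_le _ _)
    have h4 : R / max R ‖x‖ ≤ 1 := (div_le_one hMx).2 (le_max_left _ _)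
    rw [norm_smul, e2, norm_mul, Real.norm_of_nonneg (by positivity : 0 ≤ R / max R ‖x‖),
      norm_div, Real.norm_of_nonneg hMy.le, Real.norm_eq_abs]
    calc R / max R ‖x‖ * (|max R ‖y‖ - max R ‖x‖| / max R ‖y‖) * ‖y‖
        ≤ 1 * (‖x - y‖ / max R ‖y‖) * max R ‖y‖ := by gcongr; exact le_max_right _ _
      _ = ‖x - y‖ := by field_simp
  rw [e]
  linarith [norm_add_le ((R / max R ‖x‖) • (x - y)) ((R / max R ‖x‖ - R / max R ‖y‖) • y)]

/-- Global solutions of the control system `y' = A(y) w(t)` with `A` bounded and Lipschitz. -/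
theorem exists_controlled_curve [CompleteSpace V] {A : V → F →L[ℝ] V} {K C : ℝ} (hC : 0 ≤ C)
    (hK : ∀ x, ‖A x‖ ≤ K) (hA : ∀ x y, ‖A x - A y‖ ≤ C * ‖x - y‖) {w : ℝ → F} (hw : Continuous w)
    {a b : ℝ} (hab : a ≤ b) (p : V) :
    ∃ y : ℝ → V, y a = p ∧
      ∀ t ∈ Icc a b, HasDerivWithinAt y (A (y t) (w t)) (Icc a b) t := by
  have hK0 : 0 ≤ K := (norm_nonneg _).trans (hK 0)
  obtain ⟨M, hM⟩ := isCompact_Icc.exists_bound_of_continuousOn (s := Icc a b) hw.continuousOn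
  have hM0 : 0 ≤ M := (norm_nonneg _).trans (hM a (left_mem_Icc.2 hab))
  have hPL : IsPicardLindelof (fun t x => A x (w t)) (⟨a, left_mem_Icc.2 hab⟩ : Icc a b) p
      (K * M * (b - a)).toNNReal 0 (K * M).toNNReal (C * M).toNNReal := by
    have hba : 0 ≤ b - a := sub_nonneg.2 hab
    refine ⟨fun t ht => LipschitzOnWith.of_dist_le_mul fun x _ y _ => ?_, fun x _ => ?_,
      fun t ht x _ => ?_, ?_⟩
    · rw [dist_eq_norm, dist_eq_norm, Real.coe_toNNReal _ (by positivity),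
        ← sub_apply]
      refine (ContinuousLinearMap.le_opNorm _ _).trans ?_
      calc ‖A x - A y‖ * ‖w t‖ ≤ C * ‖x - y‖ * M := by gcongr; exacts [hA x y, hM t ht]
        _ = C * M * ‖x - y‖ := by ring
    · exact ((A x).continuous.comp hw).continuousOn
    · rw [Real.coe_toNNReal _ (by positivity)]
      refine (ContinuousLinearMap.le_opNorm _ _).trans ?_
      gcongr
      exacts [hK x, hM t ht]
    · rw [Real.coe_toNNReal _ (by positivity), Real.coe_toNNReal _ (by positivity)]
      simp [hba]
  exact hPL.exists_eq_forall_mem_Icc_hasDerivWithinAt₀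

/-- Grönwall's inequality on `[0, 1]`. -/
theorem norm_le_of_norm_hasDerivWithinAt_le {f f' : ℝ → V} {δ K ε : ℝ} (hK : 0 ≤ K) (hε : 0 ≤ ε)
    (hf : ∀ t ∈ Icc (0 : ℝ) 1, HasDerivWithinAt f (f' t) (Icc 0 1) t) (h0 : ‖f 0‖ ≤ δ)
    (hf' : ∀ t ∈ Icc (0 : ℝ) 1, ‖f' t‖ ≤ K * ‖f t‖ + ε) {t : ℝ} (ht : t ∈ Icc (0 : ℝ) 1) :
    ‖f t‖ ≤ (δ + ε) * Real.exp K := by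
  have hδ : 0 ≤ δ := (norm_nonneg _).trans h0
  have hc : ContinuousOn f (Icc 0 1) := fun s hs => (hf s hs).continuousWithinAt
  have key : ∀ s ∈ Icc (0 : ℝ) 1, ‖f s‖ ≤ gronwallBound δ K ε (s - 0) :=
    norm_le_gronwallBound_of_norm_deriv_right_le hc
      (fun s hs => (hf s (Ico_subset_Icc_self hs)).mono_of_mem_nhdsWithin
        (Icc_mem_nhdsGE_of_mem hs)) h0 (fun s hs => hf' s (Ico_subset_Icc_self hs))
  refine (key t ht).trans ((gronwallBound_mono hδ hε hK (by linarith [ht.2] : t - 0 ≤ 1)).trans ?_)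
  rcases hK.eq_or_lt with rfl | hK'
  · simp [gronwallBound_K0]
  · rw [gronwallBound_of_K_ne_0 hK'.ne']
    have h1 : Real.exp K - 1 ≤ K * Real.exp K := by
      have := Real.add_one_le_exp (-K)
      have h2 : Real.exp (-K) * Real.exp K = 1 := by rw [← Real.exp_add]; simp
      nlinarith [Real.exp_pos K]
    have h3 : ε / K * (Real.exp K - 1) ≤ ε / K * (K * Real.exp K) := by gcongr
    have h4 : ε / K * (K * Real.exp K) = ε * Real.exp K := by field_simp
    simp only [mul_one]
    linarith

/-- `y : [0, 1] → V` solves `y' = A(y) w`. -/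
def IsFlowLine (A : V → F →L[ℝ] V) (w : F) (y : ℝ → V) : Prop :=
  ∀ t ∈ Icc (0 : ℝ) 1, HasDerivWithinAt y (A (y t) w) (Icc 0 1) t

/-- `A` is bounded and Lipschitz, with constant `K`, on the ball of radius `R`. -/
structure BoundedLip (A : V → F →L[ℝ] V) (R K : ℝ) : Prop where
  nonneg : 0 ≤ K
  bound : ∀ x, ‖x‖ ≤ R → ‖A x‖ ≤ K
  lip : ∀ x y, ‖x‖ ≤ R → ‖y‖ ≤ R → ‖A x - A y‖ ≤ K * ‖x - y‖

/-- Composition with the radial retraction makes the frame globally bounded and Lipschitz. The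
solution obeys the original equation wherever it stays in the ball. -/
theorem BoundedLip.exists_curve [CompleteSpace V] {A : V → F →L[ℝ] V} {R K : ℝ} (hR : 0 < R)
    (hA : BoundedLip A R K) {w : ℝ → F} (hw : Continuous w) {a b : ℝ} (hab : a ≤ b) (p : V) :
    ∃ y : ℝ → V, y a = p ∧ ∀ t ∈ Icc a b,
      HasDerivWithinAt y (A (radialRetraction R (y t)) (w t)) (Icc a b) t := by
  refine exists_controlled_curve (A := fun x => A (radialRetraction R x)) (K := K) (C := K * 2)
    (by have := hA.nonneg; positivity)
    (fun x => hA.bound _ (norm_radialRetraction_le hR x)) (fun x y => ?_) hw hab p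
  refine (hA.lip _ _ (norm_radialRetraction_le hR x) (norm_radialRetraction_le hR y)).trans ?_
  rw [mul_assoc]
  exact mul_le_mul_of_nonneg_left (norm_radialRetraction_sub_le hR x y) hA.nonneg

/-- The speed is at most `K * ‖w‖`, so in unit time the curve cannot leave the ball and the
retraction never acts. -/
theorem BoundedLip.exists_flowLine [CompleteSpace V] {A : V → F →L[ℝ] V} {R K : ℝ} (hR : 0 < R)
    (hA : BoundedLip A R K) {w : F} {p : V} (hp : ‖p‖ + K * ‖w‖ ≤ R) :
    ∃ y : ℝ → V, y 0 = p ∧ IsFlowLine A w y ∧ ∀ t ∈ Icc (0 : ℝ) 1, ‖y t - p‖ ≤ K * ‖w‖ := by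
  obtain ⟨y, hy0, hy⟩ := hA.exists_curve hR (w := fun _ => w) continuous_const zero_le_one p
  have hb : ∀ t ∈ Icc (0 : ℝ) 1, ‖y t - p‖ ≤ K * ‖w‖ := by
    intro t ht
    have h1 := (convex_Icc (0 : ℝ) 1).norm_image_sub_le_of_norm_hasDerivWithin_le
      (C := K * ‖w‖) hy (fun s _ => (ContinuousLinearMap.le_opNorm _ _).trans
        (by gcongr; exact hA.bound _ (norm_radialRetraction_le hR _)))
      (left_mem_Icc.2 zero_le_one) ht
    rw [hy0] at h1
    refine h1.trans (mul_le_of_le_one_right (by have := hA.nonneg; positivity) ?_)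
    simpa [abs_of_nonneg ht.1] using ht.2
  refine ⟨y, hy0, fun t ht => ?_, hb⟩
  have h2 : ‖y t‖ ≤ R := by
    have := norm_le_norm_add_norm_sub' (y t) p
    linarith [hb t ht]
  simpa only [radialRetraction_of_norm_le hR h2] using hy t ht

/-- Two flow lines in the ball stay close. -/
theorem BoundedLip.norm_flowLine_sub_le {A : V → F →L[ℝ] V} {R K : ℝ} (hA : BoundedLip A R K)
    {w w' : F} {y y' : ℝ → V} (hy : IsFlowLine A w y) (hy' : IsFlowLine A w' y')
    (hyR : ∀ t ∈ Icc (0 : ℝ) 1, ‖y t‖ ≤ R) (hyR' : ∀ t ∈ Icc (0 : ℝ) 1, ‖y' t‖ ≤ R)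
    {t : ℝ} (ht : t ∈ Icc (0 : ℝ) 1) :
    ‖y t - y' t‖ ≤ (‖y 0 - y' 0‖ + K * ‖w - w'‖) * Real.exp (K * ‖w'‖) := by
  have hK := hA.nonneg
  refine norm_le_of_norm_hasDerivWithinAt_le (f := fun t => y t - y' t)
    (f' := fun t => A (y t) w - A (y' t) w') (by positivity) (by positivity)
    (fun s hs => (hy s hs).sub (hy' s hs)) le_rfl (fun s hs => ?_) ht
  have e : A (y s) w - A (y' s) w' = (A (y s) - A (y' s)) w' + A (y s) (w - w') := by
    simp only [sub_apply, map_sub]; abel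
  rw [e]
  refine (norm_add_le _ _).trans ?_
  have h1 := (ContinuousLinearMap.le_opNorm (A (y s) - A (y' s)) w').trans
    (mul_le_mul_of_nonneg_right (hA.lip _ _ (hyR s hs) (hyR' s hs)) (norm_nonneg _))
  have h2 := (ContinuousLinearMap.le_opNorm (A (y s)) (w - w')).trans
    (mul_le_mul_of_nonneg_right (hA.bound _ (hyR s hs)) (norm_nonneg _))
  nlinarith

end ODE

/-! ### Left-invariant frames -/

section Frame

open Metric

variable {V : Type*} [NormedAddCommGroup V] [NormedSpace ℝ V]

/-- A frame `A` on the ball of radius `R`, with derivative `A'` and `C^{1,1}` bounds, which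
satisfies the structure equations `[A v, A w] = A [v, w]`. -/
structure FrameOn (br : V →L[ℝ] V →L[ℝ] V) (A : V → V →L[ℝ] V) (A' : V → V →L[ℝ] V →L[ℝ] V)
    (R K : ℝ) : Prop extends BoundedLip A R K where
  hasFDerivWithinAt : ∀ x, ‖x‖ ≤ R → HasFDerivWithinAt A (A' x) (closedBall 0 R) x
  bound' : ∀ x, ‖x‖ ≤ R → ‖A' x‖ ≤ K
  taylor : ∀ x y, ‖x‖ ≤ R → ‖y‖ ≤ R → ‖A y - A x - A' x (y - x)‖ ≤ K * ‖y - x‖ ^ 2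
  structure_eq : ∀ x, ‖x‖ ≤ R → ∀ v w, A' x (A x v) w - A' x (A x w) v = A x (br v w)

/-- The first variation of a flow line of a left-invariant frame: if `γ' = A(γ) w`,
`γ₁' = A(γ₁) (w + v)` and `η' = v - [w, η]` then `γ₁ - γ` is `A(γ) η` up to second order terms. -/
theorem FrameOn.norm_variation_le {br : V →L[ℝ] V →L[ℝ] V} {A : V → V →L[ℝ] V}
    {A' : V → V →L[ℝ] V →L[ℝ] V} {R K : ℝ} (h : FrameOn br A A' R K) {w v : V}
    {γ γ₁ η : ℝ → V} (hγ : IsFlowLine A w γ) (hγ₁ : IsFlowLine A (w + v) γ₁)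
    (hγR : ∀ t ∈ Icc (0 : ℝ) 1, ‖γ t‖ ≤ R) (hγ₁R : ∀ t ∈ Icc (0 : ℝ) 1, ‖γ₁ t‖ ≤ R)
    (hη : ∀ t ∈ Icc (0 : ℝ) 1, HasDerivWithinAt η (v - br w (η t)) (Icc 0 1) t)
    {M : ℝ} (hM : (‖γ₁ 0 - γ 0‖ + K * ‖v‖) * Real.exp (K * ‖w‖) ≤ M)
    {t : ℝ} (ht : t ∈ Icc (0 : ℝ) 1) :
    ‖γ₁ t - γ t - A (γ t) (η t)‖ ≤
      (‖γ₁ 0 - γ 0 - A (γ 0) (η 0)‖ + (K * ‖w‖ * M ^ 2 + K * M * ‖v‖)) * Real.exp (K * ‖w‖) := by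
  have hK := h.nonneg
  have hΔ : ∀ s ∈ Icc (0 : ℝ) 1, ‖γ₁ s - γ s‖ ≤ M := by
    intro s hs
    have := h.toBoundedLip.norm_flowLine_sub_le hγ₁ hγ hγ₁R hγR hs
    rw [add_sub_cancel_left] at this
    exact this.trans hM
  have hM0 : 0 ≤ M := (norm_nonneg _).trans (hΔ t ht)
  have hmaps : MapsTo γ (Icc 0 1) (closedBall 0 R) := fun s hs => by simpa using hγR s hs
  have hJ : ∀ s ∈ Icc (0 : ℝ) 1, HasDerivWithinAt (fun s => A (γ s) (η s))
      (A' (γ s) (A (γ s) w) (η s) + A (γ s) (v - br w (η s))) (Icc 0 1) s := fun s hs =>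
    ((h.hasFDerivWithinAt (γ s) (hγR s hs)).comp_hasDerivWithinAt s (hγ s hs) hmaps).clm_apply
      (hη s hs)
  refine norm_le_of_norm_hasDerivWithinAt_le (f := fun s => γ₁ s - γ s - A (γ s) (η s))
    (f' := fun s => A (γ₁ s) (w + v) - A (γ s) w -
      (A' (γ s) (A (γ s) w) (η s) + A (γ s) (v - br w (η s)))) (by positivity) (by positivity)
    (fun s hs => ((hγ₁ s hs).sub (hγ s hs)).sub (hJ s hs)) le_rfl (fun s hs => ?_) ht
  -- The structure equation turns `A' (A w) η - A [w, η]` into `A' (A η) w`. The linear part of the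
  -- error is therefore driven by the error itself; a Taylor remainder and a mixed second order term
  -- are left over.
  have hst := h.structure_eq (γ s) (hγR s hs) w (η s)
  have e : A (γ₁ s) (w + v) - A (γ s) w -
      (A' (γ s) (A (γ s) w) (η s) + A (γ s) (v - br w (η s))) =
      A' (γ s) (γ₁ s - γ s - A (γ s) (η s)) w
      + (A (γ₁ s) - A (γ s) - A' (γ s) (γ₁ s - γ s)) w + (A (γ₁ s) - A (γ s)) v := by
    have : A (γ s) (br w (η s)) =
      A' (γ s) (A (γ s) w) (η s) - A' (γ s) (A (γ s) (η s)) w := hst.symm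
    simp only [map_sub, map_add, sub_apply, this]
    abel
  rw [e]
  have b1 : ‖A' (γ s) (γ₁ s - γ s - A (γ s) (η s)) w‖ ≤
      K * ‖γ₁ s - γ s - A (γ s) (η s)‖ * ‖w‖ :=
    (ContinuousLinearMap.le_opNorm₂ _ _ _).trans (by gcongr; exact h.bound' _ (hγR s hs))
  have b2 : ‖(A (γ₁ s) - A (γ s) - A' (γ s) (γ₁ s - γ s)) w‖ ≤ K * M ^ 2 * ‖w‖ := by
    refine (ContinuousLinearMap.le_opNorm _ _).trans ?_
    gcongr
    refine (h.taylor _ _ (hγR s hs) (hγ₁R s hs)).trans ?_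
    gcongr
    exact hΔ s hs
  have b3 : ‖(A (γ₁ s) - A (γ s)) v‖ ≤ K * M * ‖v‖ := by
    refine (ContinuousLinearMap.le_opNorm _ _).trans ?_
    gcongr
    refine (h.lip _ _ (hγ₁R s hs) (hγR s hs)).trans ?_
    gcongr
    exact hΔ s hs
  refine (norm_add₃_le).trans ?_
  linarith

/-- Flow lines in the ball are determined by their initial value. -/
theorem BoundedLip.flowLine_unique {F : Type*} [NormedAddCommGroup F] [NormedSpace ℝ F]
    {A : V → F →L[ℝ] V} {R K : ℝ} (hA : BoundedLip A R K)
    {w : F} {y y' : ℝ → V} (hy : IsFlowLine A w y) (hy' : IsFlowLine A w y')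
    (hyR : ∀ t ∈ Icc (0 : ℝ) 1, ‖y t‖ ≤ R) (hyR' : ∀ t ∈ Icc (0 : ℝ) 1, ‖y' t‖ ≤ R)
    (h0 : y 0 = y' 0) {t : ℝ} (ht : t ∈ Icc (0 : ℝ) 1) : y t = y' t := by
  have := hA.norm_flowLine_sub_le hy hy' hyR hyR' ht
  simpa [h0, sub_eq_zero] using this

theorem IsFlowLine.reverse {F : Type*} [NormedAddCommGroup F] [NormedSpace ℝ F]
    {A : V → F →L[ℝ] V} {w : F} {y : ℝ → V} (hy : IsFlowLine A w y) :
    IsFlowLine A (-w) (fun t => y (1 - t)) := by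
  intro t ht
  have hm : MapsTo (fun t : ℝ => 1 - t) (Icc 0 1) (Icc 0 1) := fun s hs =>
    ⟨by linarith [hs.2], by linarith [hs.1]⟩
  have h2 : HasDerivWithinAt (fun t : ℝ => 1 - t) (-1) (Icc 0 1) t := by
    simpa using (hasDerivWithinAt_id t (Icc (0 : ℝ) 1)).const_sub 1
  have := (hy _ (hm ht)).scomp t h2 hm
  simpa [Function.comp_def] using this

theorem IsFlowLine.rescale {F : Type*} [NormedAddCommGroup F] [NormedSpace ℝ F]
    {A : V → F →L[ℝ] V} {w : F} {y : ℝ → V} (hy : IsFlowLine A w y) {c : ℝ}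
    (hc : c ∈ Icc (0 : ℝ) 1) : IsFlowLine A (c • w) (fun t => y (c * t)) := by
  intro t ht
  have hm : MapsTo (fun t : ℝ => c * t) (Icc 0 1) (Icc 0 1) := fun s hs =>
    ⟨mul_nonneg hc.1 hs.1, mul_le_one₀ hc.2 hs.1 hs.2⟩
  have h2 : HasDerivWithinAt (fun t : ℝ => c * t) c (Icc 0 1) t := by
    simpa using (hasDerivWithinAt_id t (Icc (0 : ℝ) 1)).const_mul c
  have := (hy _ (hm ht)).scomp t h2 hm
  simpa [Function.comp_def] using this

end Frame

/-! ### Attainable directions -/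

section Attainable

open Metric

variable {V : Type*} [NormedAddCommGroup V] [NormedSpace ℝ V]
  {F : Type*} [NormedAddCommGroup F] [NormedSpace ℝ F]

/-- The flow lines of the frame field `A v` exist within distance `m` of their starting point, and
their points are at `d`-distance at most `cost` from it. -/
def Attainable (A : V → V →L[ℝ] V) (d : V → V → ℝ≥0∞) (R m : ℝ) (cost : ℝ≥0∞) (v : V) : Prop :=
  ∀ p, ‖p‖ + m ≤ R → ∃ y : ℝ → V, y 0 = p ∧ IsFlowLine A v y ∧
    ∀ t ∈ Icc (0 : ℝ) 1, ‖y t - p‖ ≤ m ∧ d p (y t) ≤ cost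

/-- `d` satisfies the triangle inequality and the arcs of constant control `u` have length at most
`N u`. -/
structure ArcBound (ι : F →L[ℝ] V) (N : F → ℝ) (A : V → V →L[ℝ] V) (d : V → V → ℝ≥0∞)
    (R : ℝ) : Prop where
  triangle : ∀ p q r, d p r ≤ d p q + d q r
  arc_le : ∀ (u : F) (y : ℝ → V), IsFlowLine A (ι u) y → (∀ t ∈ Icc (0 : ℝ) 1, ‖y t‖ ≤ R) →
    d (y 0) (y 1) ≤ ENNReal.ofReal (N u)

variable {br : V →L[ℝ] V →L[ℝ] V} {A : V → V →L[ℝ] V}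
  {A' : V → V →L[ℝ] V →L[ℝ] V} {R K : ℝ} {ι : F →L[ℝ] V} {N : F → ℝ} {d : V → V → ℝ≥0∞}

/-- The vector `exp (ad a₁) ⋯ exp (ad a_k) u`. -/
noncomputable def conjWord (br : V →L[ℝ] V →L[ℝ] V) (ι : F →L[ℝ] V) : List F → F → V
  | [], u => ι u
  | a :: l, u => NormedSpace.exp (br (ι a)) (conjWord br ι l u)

theorem conjWord_smul (c : ℝ) (l : List F) (u : F) :
    conjWord br ι l (c • u) = c • conjWord br ι l u := by
  induction l with
  | nil => simp [conjWord]
  | cons a l ih => simp [conjWord, ih]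

variable [CompleteSpace V]

/-- Following the control `u` up to time `t` is, after reparametrisation, a unit time arc of the
control `t • u`, of cost `t * N u`. -/
theorem FrameOn.attainable_control (h : FrameOn br A A' R K) (hR : 0 < R)
    (hd : ArcBound ι N A d R) (hN : ∀ (c : ℝ) u, N (c • u) = |c| * N u) (hN0 : ∀ u, 0 ≤ N u)
    (u : F) : Attainable A d R (K * ‖ι u‖) (ENNReal.ofReal (N u)) (ι u) := by
  intro p hp
  obtain ⟨y, hy0, hy, hb⟩ := h.toBoundedLip.exists_flowLine hR hp
  refine ⟨y, hy0, hy, fun t ht => ⟨hb t ht, ?_⟩⟩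
  have hyR : ∀ s ∈ Icc (0 : ℝ) 1, ‖y s‖ ≤ R := fun s hs => by
    linarith [hb s hs, norm_le_norm_add_norm_sub' (y s) p]
  have h1 := hd.arc_le (t • u) (fun s => y (t * s)) (by simpa using hy.rescale ht)
    (fun s hs => hyR _ ⟨mul_nonneg ht.1 hs.1, mul_le_one₀ ht.2 hs.1 hs.2⟩)
  simp only [mul_zero, mul_one, hy0] at h1
  refine h1.trans (ENNReal.ofReal_le_ofReal ?_)
  rw [hN, abs_of_nonneg ht.1]
  exact mul_le_of_le_one_left (hN0 u) ht.2

/-- Conjugating the flow of `A v` by the flow of the control `a` gives the flow of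
`A (exp (ad a) v)`. -/
theorem FrameOn.attainable_conj (h : FrameOn br A A' R K) (hR : 0 < R)
    (hd : ArcBound ι N A d R) (hN : ∀ (c : ℝ) u, N (c • u) = |c| * N u)
    {m : ℝ} (hm : 0 ≤ m) {cost : ℝ≥0∞} {v : V} (hv : Attainable A d R m cost v) (a : F) :
    Attainable A d R (m + 2 * (K * ‖ι a‖)) (cost + 2 * ENNReal.ofReal (N a))
      (NormedSpace.exp (br (ι a)) v) := by
  have hK := h.nonneg
  have hKa : 0 ≤ K * ‖ι a‖ := by positivity
  intro p hp
  obtain ⟨x, hx0, hx, hxb⟩ := h.toBoundedLip.exists_flowLine hR (w := ι a) (p := p) (by linarith)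
  have hxR : ∀ s ∈ Icc (0 : ℝ) 1, ‖x s‖ ≤ R := fun s hs => by
    linarith [hxb s hs, norm_le_norm_add_norm_sub' (x s) p]
  have h1 : (1 : ℝ) ∈ Icc (0 : ℝ) 1 := right_mem_Icc.2 zero_le_one
  have h0 : (0 : ℝ) ∈ Icc (0 : ℝ) 1 := left_mem_Icc.2 zero_le_one
  have hx1 := hxb 1 h1
  have hx1' := norm_le_norm_add_norm_sub' (x 1) p
  obtain ⟨z, hz0, hz, hzb⟩ := hv (x 1) (by linarith)
  have hzR : ∀ t ∈ Icc (0 : ℝ) 1, ‖z t‖ + K * ‖ι (-a)‖ ≤ R := fun t ht => by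
    rw [map_neg, norm_neg]
    linarith [(hzb t ht).1, norm_le_norm_add_norm_sub' (z t) (x 1)]
  -- From each `z t` the flow of `-a` leads back. Its end point `f t 1` is the conjugated flow at
  -- time `t`, and `f 0` retraces `x` to `p`.
  have hex : ∀ t, ∃ f : ℝ → V, t ∈ Icc (0 : ℝ) 1 → (f 0 = z t ∧ IsFlowLine A (ι (-a)) f ∧
      ∀ s ∈ Icc (0 : ℝ) 1, ‖f s - z t‖ ≤ K * ‖ι (-a)‖) := by
    intro t
    by_cases ht : t ∈ Icc (0 : ℝ) 1
    · obtain ⟨f, hf⟩ := h.toBoundedLip.exists_flowLine hR (hzR t ht)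
      exact ⟨f, fun _ => hf⟩
    · exact ⟨0, fun h => absurd h ht⟩
  choose f hf using hex
  have hfR : ∀ t ∈ Icc (0 : ℝ) 1, ∀ s ∈ Icc (0 : ℝ) 1, ‖f t s‖ ≤ R := fun t ht s hs => by
    linarith [(hf t ht).2.2 s hs, hzR t ht, norm_le_norm_add_norm_sub' (f t s) (z t)]
  have hdx : d p (x 1) ≤ ENNReal.ofReal (N a) := by
    rw [← hx0]; exact hd.arc_le a x hx hxR
  have hy0 : f 0 1 = p := by
    have e := h.toBoundedLip.flowLine_unique (hf 0 h0).2.1 (by simpa using hx.reverse)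
      (hfR 0 h0) (fun s hs => hxR _ ⟨by linarith [hs.2], by linarith [hs.1]⟩)
      (by simp [(hf 0 h0).1, hz0]) h1
    simpa [hx0] using e
  refine ⟨fun t => f t 1, hy0, fun t ht => ?_, fun t ht => ⟨?_, ?_⟩⟩
  · rw [hasDerivWithinAt_iff_isLittleO]
    set E := Real.exp (K * ‖ι (-a)‖) with hE
    have hzt := hz t ht
    have o1 : (fun s => z s - z t - (s - t) • A (z t) v) =o[𝓝[Icc 0 1] t] fun s => s - t :=
      hasDerivWithinAt_iff_isLittleO.1 hzt
    have o2 : (fun s => ‖z s - z t‖ ^ 2) =o[𝓝[Icc 0 1] t] fun s => s - t := by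
      have O1 : (fun s => ‖z s - z t‖) =O[𝓝[Icc 0 1] t] fun s => s - t :=
        (hzt.hasFDerivWithinAt.isBigO_sub).norm_left
      have o3 : (fun s => ‖z s - z t‖) =o[𝓝[Icc 0 1] t] fun _ => (1 : ℝ) := by
        rw [Asymptotics.isLittleO_one_iff]
        have := (hzt.continuousWithinAt.sub_const (z t)).norm
        simpa [ContinuousWithinAt] using this
      simpa [pow_two] using O1.mul_isLittleO o3
    have o4 : (fun s => (‖z s - z t - (s - t) • A (z t) v‖ +
        K * ‖ι (-a)‖ * E ^ 2 * ‖z s - z t‖ ^ 2) * E) =o[𝓝[Icc 0 1] t] fun s => s - t := by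
      have := (o1.norm_left.add (o2.const_mul_left (K * ‖ι (-a)‖ * E ^ 2))).const_mul_left E
      simpa only [mul_comm E] using this
    refine Asymptotics.IsBigO.trans_isLittleO ?_ o4
    refine Asymptotics.IsBigO.of_bound 1 ?_
    filter_upwards [self_mem_nhdsWithin] with s hs
    -- The backward flow has control `-a`, so its variation field solves `η' = [a, η]` and carries
    -- `(s - t) v` to `exp (ad a) ((s - t) v)`. The error consists of the `o(s - t)` error of `z` at
    -- `t` and a term quadratic in `z s - z t`.
    have hη : ∀ r ∈ Icc (0 : ℝ) 1, HasDerivWithinAt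
        (fun r : ℝ => NormedSpace.exp (r • br (ι a)) ((s - t) • v))
        (0 - br (ι (-a)) (NormedSpace.exp (r • br (ι a)) ((s - t) • v))) (Icc 0 1) r := by
      intro r _
      have := (hasDerivAt_exp_smul_const' (𝕂 := ℝ) (br (ι a)) r).clm_apply
        (hasDerivAt_const r ((s - t) • v))
      simpa using this.hasDerivWithinAt
    have key := h.norm_variation_le (v := 0) (w := ι (-a)) (hf t ht).2.1
      (by simpa using (hf s hs).2.1) (hfR t ht) (hfR s hs) hη
      (M := ‖z s - z t‖ * E) (by simp [(hf t ht).1, (hf s hs).1, hE]) h1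
    simp only [(hf t ht).1, (hf s hs).1, one_smul, zero_smul, NormedSpace.exp_zero,
      one_apply_eq_self, norm_zero, mul_zero, add_zero, map_smul] at key
    rw [one_mul, Real.norm_of_nonneg (by positivity)]
    refine key.trans (le_of_eq ?_)
    rw [hE]; ring
  · have e1 := (hf t ht).2.2 1 h1
    have e2 := (hzb t ht).1
    rw [map_neg, norm_neg] at e1
    have : f t 1 - p = (f t 1 - z t) + (z t - x 1) + (x 1 - p) := by abel
    rw [this]
    refine norm_add₃_le.trans ?_
    linarith
  · have e1 := hd.arc_le (-a) _ (hf t ht).2.1 (hfR t ht)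
    have hNa : N (-a) = N a := by simpa using hN (-1) a
    rw [(hf t ht).1, hNa] at e1
    calc d p (f t 1) ≤ d p (x 1) + d (x 1) (f t 1) := hd.triangle _ _ _
      _ ≤ d p (x 1) + (d (x 1) (z t) + d (z t) (f t 1)) := by gcongr; exact hd.triangle _ _ _
      _ ≤ ENNReal.ofReal (N a) + (cost + ENNReal.ofReal (N a)) := by
          gcongr; exact (hzb t ht).2
      _ = cost + 2 * ENNReal.ofReal (N a) := by ring

theorem FrameOn.attainable_conjWord (h : FrameOn br A A' R K) (hR : 0 < R)
    (hd : ArcBound ι N A d R) (hN : ∀ (c : ℝ) u, N (c • u) = |c| * N u) (hN0 : ∀ u, 0 ≤ N u)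
    (l : List F) (u : F) :
    Attainable A d R (K * ‖ι u‖ + (l.map fun a => 2 * (K * ‖ι a‖)).sum)
      (ENNReal.ofReal (N u) + (l.map fun a => 2 * ENNReal.ofReal (N a)).sum)
      (conjWord br ι l u) := by
  have hK := h.nonneg
  induction l with
  | nil => simpa [conjWord] using h.attainable_control hR hd hN hN0 u
  | cons a l ih =>
    have hs : 0 ≤ K * ‖ι u‖ + (l.map fun a => 2 * (K * ‖ι a‖)).sum :=
      add_nonneg (by positivity) (List.sum_nonneg (by simp; intros; positivity))
    have := h.attainable_conj hR hd hN hs ih a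
    simp only [List.map_cons, List.sum_cons, conjWord]
    convert this using 1 <;> ring

end Attainable

/-! ### Uniform local connectivity by horizontal curves -/

section Connectivity

open Metric

variable {V : Type*} [NormedAddCommGroup V] [NormedSpace ℝ V]

open Classical in
/-- The time-one flow of the frame field `A w` inside the ball of radius `R`. -/
noncomputable def frameFlow (A : V → V →L[ℝ] V) (R : ℝ) (w q : V) : V :=
  if h : ∃ y : ℝ → V, y 0 = q ∧ IsFlowLine A w y ∧ ∀ t ∈ Icc (0 : ℝ) 1, ‖y t‖ ≤ R
  then h.choose 1 else q

/-- The successive flows of `A (τ₀ v₀)`, `A (τ₁ v₁)`, ... -/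
noncomputable def frameFlowSeq (A : V → V →L[ℝ] V) (R : ℝ) (v : ℕ → V) (p : V) (τ : ℕ → ℝ) : ℕ → V
  | 0 => p
  | i + 1 => frameFlow A R (τ i • v i) (frameFlowSeq A R v p τ i)

variable {A : V → V →L[ℝ] V} {R K : ℝ}

theorem BoundedLip.frameFlow_eq (hA : BoundedLip A R K) {w : V} {y : ℝ → V}
    (hy : IsFlowLine A w y) (hyR : ∀ t ∈ Icc (0 : ℝ) 1, ‖y t‖ ≤ R) :
    frameFlow A R w (y 0) = y 1 := by
  have hex : ∃ y' : ℝ → V, y' 0 = y 0 ∧ IsFlowLine A w y' ∧ ∀ t ∈ Icc (0 : ℝ) 1, ‖y' t‖ ≤ R :=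
    ⟨y, rfl, hy, hyR⟩
  rw [frameFlow, dif_pos hex]
  exact hA.flowLine_unique hex.choose_spec.2.1 hy hex.choose_spec.2.2 hyR hex.choose_spec.1
    (right_mem_Icc.2 zero_le_one)

variable {F : Type*} [NormedAddCommGroup F] [NormedSpace ℝ F]

theorem ArcBound.dist_self {ι : F →L[ℝ] V} {N : F → ℝ} {d : V → V → ℝ≥0∞} {A : V → V →L[ℝ] V}
    {R : ℝ} (hd : ArcBound ι N A d R) (hN : N 0 = 0) {p : V} (hp : ‖p‖ ≤ R) : d p p = 0 := by
  have := hd.arc_le 0 (fun _ => p) (fun t _ => by simpa using hasDerivWithinAt_const t _ p)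
    (fun _ _ => hp)
  simpa [hN] using this

variable [CompleteSpace V]

/-- Quantitative strict differentiability of the time-one flow at control `0` and point `p`, with
constants that see the frame only through `K`. The velocity error is `(A y - A y') w'`, small
because `w'` is, plus `(A y - A p) (w - w')`, small because `y` stays near `p`. -/
theorem BoundedLip.norm_frameFlow_sub_le (hA : BoundedLip A R K) (hR : 0 < R) {p q q' w w' : V}
    {ρ r : ℝ} (hp : ‖p‖ ≤ R) (hq : ‖q - p‖ ≤ ρ) (hw : ‖w‖ ≤ r) (hw' : ‖w'‖ ≤ r)
    (hr : K * r ≤ 1) (hqR : ‖q‖ + K * r ≤ R) (hqR' : ‖q'‖ + K * r ≤ R) :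
    ‖frameFlow A R w q - q‖ ≤ K * r ∧
    ‖frameFlow A R w q - frameFlow A R w' q' - (q - q') - A p (w - w')‖ ≤
      (4 * K + 4 * K ^ 2) * (ρ + r) * (‖q - q'‖ + ‖w - w'‖) := by
  have hK := hA.nonneg
  have hρ : 0 ≤ ρ := (norm_nonneg _).trans hq
  have hr0 : 0 ≤ r := (norm_nonneg _).trans hw
  have h1 : (1 : ℝ) ∈ Icc (0 : ℝ) 1 := right_mem_Icc.2 zero_le_one
  have h0 : (0 : ℝ) ∈ Icc (0 : ℝ) 1 := left_mem_Icc.2 zero_le_one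
  have hKw : K * ‖w‖ ≤ K * r := by gcongr
  have hKw' : K * ‖w'‖ ≤ K * r := by gcongr
  obtain ⟨y, hy0, hy, hyb⟩ := hA.exists_flowLine hR (w := w) (p := q) (by linarith)
  obtain ⟨y', hy0', hy', hyb'⟩ := hA.exists_flowLine hR (w := w') (p := q') (by linarith)
  have hyR : ∀ s ∈ Icc (0 : ℝ) 1, ‖y s‖ ≤ R := fun s hs => by
    linarith [hyb s hs, norm_le_norm_add_norm_sub' (y s) q]
  have hyR' : ∀ s ∈ Icc (0 : ℝ) 1, ‖y' s‖ ≤ R := fun s hs => by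
    linarith [hyb' s hs, norm_le_norm_add_norm_sub' (y' s) q']
  have e1 : frameFlow A R w q = y 1 := by rw [← hy0]; exact hA.frameFlow_eq hy hyR
  have e1' : frameFlow A R w' q' = y' 1 := by rw [← hy0']; exact hA.frameFlow_eq hy' hyR'
  rw [e1, e1']
  refine ⟨(hyb 1 h1).trans hKw, ?_⟩
  set Δ := ‖q - q'‖ + K * ‖w - w'‖ with hΔ
  have hΔ0 : 0 ≤ Δ := by positivity
  have hclose : ∀ s ∈ Icc (0 : ℝ) 1, ‖y s - y' s‖ ≤ 3 * Δ := by
    intro s hs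
    have h2 := hA.norm_flowLine_sub_le hy hy' hyR hyR' hs
    rw [hy0, hy0'] at h2
    have h3 : Real.exp (K * ‖w'‖) ≤ 3 := by
      refine (Real.exp_le_exp.2 (hKw'.trans hr)).trans ?_
      linarith [Real.exp_one_lt_d9]
    nlinarith
  have hg : ∀ s ∈ Icc (0 : ℝ) 1, HasDerivWithinAt (fun s => y s - y' s - s • A p (w - w'))
      (A (y s) w - A (y' s) w' - A p (w - w')) (Icc 0 1) s := fun s hs => by
    have := ((hy s hs).sub (hy' s hs)).sub
      ((hasDerivWithinAt_id s (Icc (0 : ℝ) 1)).smul_const (A p (w - w')))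
    rw [one_smul] at this
    exact this
  have hgb : ∀ s ∈ Icc (0 : ℝ) 1, ‖A (y s) w - A (y' s) w' - A p (w - w')‖ ≤
      K * (3 * Δ) * r + K * (K * r + ρ) * ‖w - w'‖ := by
    intro s hs
    have e : A (y s) w - A (y' s) w' - A p (w - w') =
        (A (y s) - A (y' s)) w' + (A (y s) - A p) (w - w') := by
      simp only [sub_apply, map_sub]; abel
    rw [e]
    refine (norm_add_le _ _).trans (add_le_add ?_ ?_)
    · refine (ContinuousLinearMap.le_opNorm _ _).trans ?_
      gcongr
      refine (hA.lip _ _ (hyR s hs) (hyR' s hs)).trans ?_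
      gcongr
      exact hclose s hs
    · refine (ContinuousLinearMap.le_opNorm _ _).trans ?_
      gcongr
      refine (hA.lip _ _ (hyR s hs) hp).trans ?_
      gcongr
      have : y s - p = (y s - q) + (q - p) := by abel
      rw [this]
      exact (norm_add_le _ _).trans (add_le_add ((hyb s hs).trans hKw) hq)
  have key := (convex_Icc (0 : ℝ) 1).norm_image_sub_le_of_norm_hasDerivWithin_le hg hgb h0 h1
  simp only [hy0, hy0', one_smul, zero_smul, sub_zero, norm_one, mul_one] at key
  have e3 : y 1 - y' 1 - (q - q') - A p (w - w') =
      y 1 - y' 1 - A p (w - w') - (q - q') := by abel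
  rw [e3]
  refine key.trans ?_
  have n1 := norm_nonneg (q - q')
  have n2 := norm_nonneg (w - w')
  have := mul_nonneg hK hr0
  have := mul_nonneg hK hρ
  have t1 : 0 ≤ K * r * ‖q - q'‖ := by positivity
  have t2 : 0 ≤ K * ρ * ‖q - q'‖ := by positivity
  have t3 : 0 ≤ K * r * ‖w - w'‖ := by positivity
  have t4 : 0 ≤ K * ρ * ‖w - w'‖ := by positivity
  have t5 : 0 ≤ K ^ 2 * r * ‖q - q'‖ := by positivity
  have t6 : 0 ≤ K ^ 2 * ρ * ‖q - q'‖ := by positivity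
  have t7 : 0 ≤ K ^ 2 * r * ‖w - w'‖ := by positivity
  have t8 : 0 ≤ K ^ 2 * ρ * ‖w - w'‖ := by positivity
  rw [hΔ]
  linarith

/-- By the chain rule, the derivative at `τ = 0` of the composed flows is `τ ↦ A p (∑ τ j • v j)`.
The constant is chosen before the frame, the directions and the base point; this is what makes the
inverse function theorem uniform over a family of frames. -/
theorem exists_frameFlowSeq_bound (K β : ℝ) (hK : 0 ≤ K) (hβ : 0 ≤ β) (i : ℕ) :
    ∃ C : ℝ, 0 ≤ C ∧ ∀ (A : V → V →L[ℝ] V) (R : ℝ), 0 < R → BoundedLip A R K →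
      ∀ (v : ℕ → V), (∀ j, ‖v j‖ ≤ β) → ∀ (p : V), ‖p‖ + 1 ≤ R → ∀ θ T : ℝ, 0 ≤ θ → C * θ ≤ 1 →
      ∀ τ τ' : ℕ → ℝ, (∀ j, |τ j| ≤ θ) → (∀ j, |τ' j| ≤ θ) → (∀ j, |τ j - τ' j| ≤ T) →
      ‖frameFlowSeq A R v p τ i - p‖ ≤ C * θ ∧
      ‖frameFlowSeq A R v p τ i - frameFlowSeq A R v p τ' i -
        A p (∑ j ∈ Finset.range i, (τ j - τ' j) • v j)‖ ≤ C * θ * T := by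
  induction i with
  | zero =>
    refine ⟨0, le_rfl, fun A R hR hA v hv p hp θ T hθ hC τ τ' hτ hτ' hT => ?_⟩
    simp [frameFlowSeq]
  | succ i ih =>
    obtain ⟨C, hC0, ih⟩ := ih
    set L := 1 + K * (i * β) with hL
    have hL0 : 0 ≤ L := by positivity
    refine ⟨C + K * β + (4 * K + 4 * K ^ 2) * (C + β) * (L + β), by positivity,
      fun A R hR hA v hv p hp θ T hθ hC τ τ' hτ hτ' hT => ?_⟩
    have hT0 : 0 ≤ T := (abs_nonneg _).trans (hT 0)
    have hx : 0 ≤ (4 * K + 4 * K ^ 2) * (C + β) * (L + β) := by positivity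
    have hx' := mul_nonneg hx hθ
    have hCθ := mul_nonneg hC0 hθ
    have hKβθ : 0 ≤ K * β * θ := by positivity
    have hC1 : C * θ ≤ 1 := by nlinarith
    obtain ⟨a1, a2⟩ := ih A R hR hA v hv p hp θ T hθ hC1 τ τ' hτ hτ' hT
    obtain ⟨b1, -⟩ := ih A R hR hA v hv p hp θ T hθ hC1 τ' τ hτ' hτ
      (fun j => by rw [abs_sub_comm]; exact hT j)
    set q := frameFlowSeq A R v p τ i
    set q' := frameFlowSeq A R v p τ' i
    have hw : ∀ τ : ℕ → ℝ, (∀ j, |τ j| ≤ θ) → ‖τ i • v i‖ ≤ β * θ := fun τ hτ => by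
      rw [norm_smul, mul_comm β]
      exact mul_le_mul (hτ i) (hv i) (norm_nonneg _) hθ
    have hww : ‖τ i • v i - τ' i • v i‖ ≤ β * T := by
      rw [← sub_smul, norm_smul, mul_comm β]
      exact mul_le_mul (hT i) (hv i) (norm_nonneg _) hT0
    have hpR : ‖p‖ ≤ R := by linarith
    have hn : ∀ q : V, ‖q - p‖ ≤ C * θ → ‖q‖ + K * (β * θ) ≤ R := fun q h => by
      linarith [norm_le_norm_add_norm_sub' q p]
    obtain ⟨c1, c2⟩ := hA.norm_frameFlow_sub_le hR (p := p) (ρ := C * θ) (r := β * θ) hpR a1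
      (hw τ hτ) (hw τ' hτ') (by linarith) (hn q a1) (hn q' b1)
    have hqq : ‖q - q'‖ ≤ L * T := by
      have hs : ‖A p (∑ j ∈ Finset.range i, (τ j - τ' j) • v j)‖ ≤ K * (i * β) * T := by
        refine ((A p).le_opNorm _).trans ?_
        have : ‖∑ j ∈ Finset.range i, (τ j - τ' j) • v j‖ ≤ i * β * T := by
          refine (norm_sum_le _ _).trans ((Finset.sum_le_card_nsmul _ _ (β * T) ?_).trans ?_)
          · intro j _
            rw [norm_smul, mul_comm β]
            exact mul_le_mul (hT j) (hv j) (norm_nonneg _) hT0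
          · simp [mul_assoc]
        calc ‖A p‖ * _ ≤ K * (i * β * T) := by gcongr; exact hA.bound p hpR
          _ = _ := by ring
      have h2 := norm_le_norm_sub_add (q - q') (A p (∑ j ∈ Finset.range i, (τ j - τ' j) • v j))
      have h3 : C * θ * T ≤ 1 * T := by gcongr
      rw [hL]; linarith
    refine ⟨?_, ?_⟩
    · have : frameFlowSeq A R v p τ (i + 1) - p =
          (frameFlow A R (τ i • v i) q - q) + (q - p) := by
        simp [frameFlowSeq, q]
      rw [this]
      refine (norm_add_le _ _).trans ?_
      linarith
    · have : frameFlowSeq A R v p τ (i + 1) - frameFlowSeq A R v p τ' (i + 1) -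
          A p (∑ j ∈ Finset.range (i + 1), (τ j - τ' j) • v j) =
          (frameFlow A R (τ i • v i) q - frameFlow A R (τ' i • v i) q' - (q - q') -
            A p (τ i • v i - τ' i • v i)) +
          (q - q' - A p (∑ j ∈ Finset.range i, (τ j - τ' j) • v j)) := by
        rw [Finset.sum_range_succ, map_add, sub_smul (τ i)]
        simp only [frameFlowSeq, q, q']
        abel
      rw [this]
      refine (norm_add_le _ _).trans ?_
      have h4 : (4 * K + 4 * K ^ 2) * (C * θ + β * θ) * (‖q - q'‖ + ‖τ i • v i - τ' i • v i‖) ≤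
          (4 * K + 4 * K ^ 2) * (C * θ + β * θ) * (L * T + β * T) := by gcongr
      have h5 : 0 ≤ K * β * θ * T := by positivity
      nlinarith

theorem frameFlowSeq_dist_le {ι : F →L[ℝ] V} {N : F → ℝ} {d : V → V → ℝ≥0∞}
    (hA : BoundedLip A R K) (hd : ArcBound ι N A d R) (hN : N 0 = 0) {v : ℕ → V} {p : V}
    {τ : ℕ → ℝ} {cost : ℝ≥0∞} {n : ℕ} (hv : ∀ i < n, Attainable A d R 1 cost (τ i • v i))
    (hP : ∀ i < n, ‖frameFlowSeq A R v p τ i‖ + 1 ≤ R) (hp : ‖p‖ ≤ R) :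
    d p (frameFlowSeq A R v p τ n) ≤ n * cost := by
  induction n with
  | zero => simp [frameFlowSeq, hd.dist_self hN hp]
  | succ n ih =>
    have h1 := ih (fun i hi => hv i (by omega)) (fun i hi => hP i (by omega))
    have hPn := hP n (by omega)
    obtain ⟨y, hy0, hy, hyb⟩ := hv n (by omega) _ hPn
    have hyR : ∀ s ∈ Icc (0 : ℝ) 1, ‖y s‖ ≤ R := fun s hs => by
      linarith [(hyb s hs).1, norm_le_norm_add_norm_sub' (y s) (frameFlowSeq A R v p τ n)]
    have e : frameFlowSeq A R v p τ (n + 1) = y 1 := by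
      rw [frameFlowSeq, ← hA.frameFlow_eq hy hyR, hy0]
    rw [e]
    refine (hd.triangle _ (frameFlowSeq A R v p τ n) _).trans ?_
    push_cast
    rw [add_mul, one_mul]
    gcongr
    exact (hyb 1 (right_mem_Icc.2 zero_le_one)).2

/-- Uniform version of the Chow–Rashevskii theorem: if the directions `v i`, close to a basis `b`,
are attainable, then all points at distance at most `δ` are at bounded `d`-distance, where `δ`
depends only on the bounds for the frame. -/
theorem exists_dist_le_of_attainable {n : ℕ} (b : Basis (Fin n) ℝ V) (K : ℝ) (hK : 0 ≤ K) :
    ∃ δ > 0, ∃ κ > 0, ∀ (A : V → V →L[ℝ] V) (R : ℝ), 0 < R → BoundedLip A R K →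
      (∀ x, ‖x‖ ≤ R → ∃ e : V ≃L[ℝ] V, (e : V →L[ℝ] V) = A x ∧ ‖(e.symm : V →L[ℝ] V)‖ ≤ K) →
      ∀ (ι : F →L[ℝ] V) (N : F → ℝ) (d : V → V → ℝ≥0∞), ArcBound ι N A d R → N 0 = 0 →
      ∀ (cost : ℝ≥0∞) (v : Fin n → V), (∀ i, ‖v i - b i‖ ≤ κ) →
      (∀ i, ∀ c : ℝ, |c| ≤ 1 → Attainable A d R 1 cost (c • v i)) →
      ∀ p q, ‖p‖ + 2 ≤ R → ‖q - p‖ ≤ δ → d p q ≤ n * cost := by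
  have : FiniteDimensional ℝ V := b.finiteDimensional_of_finite
  set β : ℝ := 1 + ∑ i, ‖b i‖ with hβ
  have hβ0 : 0 ≤ β := by positivity
  choose C hC0 hC using exists_frameFlowSeq_bound (V := V) K β hK hβ0
  set C' : ℝ := 1 + ∑ i ∈ Finset.range (n + 1), C i with hC'
  have hCC : ∀ i ≤ n, C i ≤ C' := fun i hi => by
    have := Finset.single_le_sum (f := C) (fun i _ => hC0 i) (Finset.mem_range.2 (by omega) :
      i ∈ Finset.range (n + 1))
    linarith
  have hC'1 : 1 ≤ C' := by
    have := Finset.sum_nonneg (s := Finset.range (n + 1)) (f := C) (fun i _ => hC0 i)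
    linarith
  let M : (Fin n → ℝ) ≃L[ℝ] V := b.equivFun.symm.toContinuousLinearEquiv
  have hM : ∀ x, M x = ∑ i, x i • b i := fun x => b.equivFun_symm_apply x
  -- `B` bounds the inverse of the derivative at `0`, which is `A p` composed with the basis `b`.
  -- The radius `θ` and the tolerance `κ` are such that the nonlinearity of the flows and the
  -- deviation of `v` from `b` contribute at most `1 / (4 * B)` each. So the map of flow times is
  -- within `1 / (2 * B) < B⁻¹` of its linear part, and it covers a ball of radius `(B⁻¹ - 1 / (2 *
  -- B)) * θ`.
  set B : ℝ := ‖(M.symm : V →L[ℝ] (Fin n → ℝ))‖ * K + 1 with hB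
  have hB0 : 0 < B := by positivity
  have hB1 : 1 ≤ B := by rw [hB]; have := mul_nonneg (norm_nonneg (M.symm : V →L[ℝ] (Fin n → ℝ))) hK; linarith
  set θ : ℝ := 1 / (4 * B * C') with hθ
  have hθ0 : 0 < θ := by positivity
  have hCθ : C' * θ = 1 / (4 * B) := by rw [hθ]; field_simp
  have hCθ1 : C' * θ ≤ 1 := by
    rw [hCθ, div_le_one (by positivity)]; linarith
  have hθ1 : θ ≤ 1 := by nlinarith
  set κ : ℝ := 1 / (4 * B * (K * n + 1)) with hκ
  have hκ0 : 0 < κ := by positivity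
  have hκ1 : κ ≤ 1 := by
    rw [hκ, div_le_one (by positivity)]
    nlinarith [mul_nonneg hK (Nat.cast_nonneg n : (0 : ℝ) ≤ n)]
  have hκK : K * n * κ ≤ 1 / (4 * B) := by
    rw [hκ]
    have : K * n * (1 / (4 * B * (K * n + 1))) = (K * n / (K * n + 1)) * (1 / (4 * B)) := by
      field_simp
    rw [this]
    exact mul_le_of_le_one_left (by positivity) ((div_le_one (by positivity)).2 (by linarith))
  refine ⟨(B⁻¹ - 1 / (2 * B)) * θ, ?_, κ, hκ0, ?_⟩
  · have : B⁻¹ - 1 / (2 * B) = 1 / (2 * B) := by field_simp; norm_num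
    rw [this]; positivity
  intro A R hR hA hinv ι N d hd hN cost v hv hatt p q hp hq
  let v' : ℕ → V := fun j => if h : j < n then v ⟨j, h⟩ else 0
  let ext : (Fin n → ℝ) → ℕ → ℝ := fun x j => if h : j < n then x ⟨j, h⟩ else 0
  have hv' : ∀ j, ‖v' j‖ ≤ β := by
    intro j
    by_cases h : j < n
    · simp only [v', h, dif_pos]
      have h1 := hv ⟨j, h⟩
      have h2 : ‖b ⟨j, h⟩‖ ≤ ∑ i, ‖b i‖ :=
        Finset.single_le_sum (f := fun i => ‖b i‖) (fun _ _ => norm_nonneg _) (Finset.mem_univ _)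
      linarith [norm_le_norm_add_norm_sub' (v ⟨j, h⟩) (b ⟨j, h⟩)]
    · simpa [v', h] using hβ0
  have hext : ∀ (x : Fin n → ℝ) (c : ℝ), ‖x‖ ≤ c → ∀ j, |ext x j| ≤ c := by
    intro x c hx j
    by_cases h : j < n
    · simpa [ext, h] using (norm_le_pi_norm x ⟨j, h⟩).trans hx
    · simpa [ext, h] using (norm_nonneg x).trans hx
  have hext' : ∀ (x y : Fin n → ℝ) j, ext x j - ext y j = ext (x - y) j := by
    intro x y j
    by_cases h : j < n <;> simp [ext, h]
  let f : (Fin n → ℝ) → V := fun x => frameFlowSeq A R v' p (ext x) n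
  have hpR : ‖p‖ ≤ R := by linarith
  obtain ⟨e, heA, hes⟩ := hinv p hpR
  let f' : (Fin n → ℝ) →L[ℝ] V := (A p).comp (M : (Fin n → ℝ) →L[ℝ] V)
  have hCi : ∀ i ≤ n, ∀ c, 0 ≤ c → C i * c ≤ C' * c := fun i hi c hc =>
    mul_le_mul_of_nonneg_right (hCC i hi) hc
  have happ : ApproximatesLinearOn f f' (closedBall 0 θ) (1 / (2 * B)).toNNReal := by
    intro x hx y hy
    rw [mem_closedBall_zero_iff] at hx hy
    obtain ⟨-, h2⟩ := hC n A R hR hA v' hv' p (by linarith) θ ‖x - y‖ hθ0.le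
      ((hCi n le_rfl θ hθ0.le).trans hCθ1) (ext x) (ext y) (hext x θ hx) (hext y θ hy)
      (fun j => by rw [hext']; exact hext _ _ le_rfl j)
    have hsum : ∑ j ∈ Finset.range n, (ext x j - ext y j) • v' j = ∑ i, (x i - y i) • v i := by
      rw [Finset.sum_range]
      refine Finset.sum_congr rfl fun i _ => ?_
      simp [ext, v']
    rw [hsum] at h2
    rw [Real.coe_toNNReal _ (by positivity)]
    have e1 : f x - f y - f' (x - y) = (frameFlowSeq A R v' p (ext x) n -
        frameFlowSeq A R v' p (ext y) n - A p (∑ i, (x i - y i) • v i)) +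
        A p (∑ i, (x i - y i) • (v i - b i)) := by
      have hMs : f' (x - y) = A p (∑ i, (x i - y i) • b i) := by
        simp only [f', ContinuousLinearMap.comp_apply, ContinuousLinearEquiv.coe_coe, hM,
          Pi.sub_apply]
      simp only [hMs, f, smul_sub, Finset.sum_sub_distrib, map_sub]
      abel
    have e2 : ‖A p (∑ i, (x i - y i) • (v i - b i))‖ ≤ K * n * κ * ‖x - y‖ := by
      refine ((A p).le_opNorm _).trans ?_
      have : ‖∑ i, (x i - y i) • (v i - b i)‖ ≤ n * (κ * ‖x - y‖) := by
        refine (norm_sum_le _ _).trans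
          ((Finset.sum_le_card_nsmul _ _ (κ * ‖x - y‖) ?_).trans ?_)
        · intro j _
          rw [norm_smul, mul_comm κ]
          exact mul_le_mul (norm_le_pi_norm (x - y) j) (hv j) (norm_nonneg _) (norm_nonneg _)
        · simp
      calc ‖A p‖ * _ ≤ K * (n * (κ * ‖x - y‖)) := by gcongr; exact hA.bound p hpR
        _ = _ := by ring
    rw [e1]
    refine (norm_add_le _ _).trans ?_
    have h3 : C n * θ * ‖x - y‖ ≤ 1 / (4 * B) * ‖x - y‖ := by
      rw [← hCθ]; gcongr; exact hCC n le_rfl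
    have h4 : K * n * κ * ‖x - y‖ ≤ 1 / (4 * B) * ‖x - y‖ := by gcongr
    have h5 : 1 / (2 * B) = 1 / (4 * B) + 1 / (4 * B) := by field_simp; norm_num
    rw [h5, add_mul]
    linarith
  let g : f'.NonlinearRightInverse :=
    { toFun := fun z => M.symm (e.symm z)
      nnnorm := B.toNNReal
      bound' := fun z => by
        rw [Real.coe_toNNReal _ hB0.le]
        calc ‖M.symm (e.symm z)‖ ≤ ‖(M.symm : V →L[ℝ] (Fin n → ℝ))‖ * ‖e.symm z‖ :=
              (M.symm : V →L[ℝ] (Fin n → ℝ)).le_opNorm _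
          _ ≤ ‖(M.symm : V →L[ℝ] (Fin n → ℝ))‖ * (K * ‖z‖) := by
              gcongr
              exact ((e.symm : V →L[ℝ] V).le_opNorm z).trans (by gcongr)
          _ ≤ B * ‖z‖ := by rw [hB, add_mul, ← mul_assoc]; linarith [norm_nonneg z]
      right_inv' := fun z => by
        have h : ∀ x, A p x = e x := fun x => by rw [← heA]; rfl
        simp [f', h] }
  have hsurj := happ.surjOn_closedBall_of_nonlinearRightInverse g hθ0.le Subset.rfl
  have hf0 : f 0 = p := by
    have h1 := (hC n A R hR hA v' hv' p (by linarith) 0 0 le_rfl (by simp) (ext 0) (ext 0)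
      (hext 0 0 (by simp)) (hext 0 0 (by simp)) (by simp)).1
    simpa [sub_eq_zero] using h1
  have hgB : ((g.nnnorm : NNReal) : ℝ) = B := Real.coe_toNNReal _ hB0.le
  rw [hf0, hgB, Real.coe_toNNReal _ (by positivity)] at hsurj
  obtain ⟨x, hx, hxq⟩ := hsurj (by rw [mem_closedBall, dist_eq_norm]; exact hq : q ∈ _)
  rw [mem_closedBall_zero_iff] at hx
  rw [← hxq]
  refine frameFlowSeq_dist_le hA hd hN (fun i hi => ?_) (fun i hi => ?_) hpR
  · have : v' i = v ⟨i, hi⟩ := by simp [v', hi]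
    rw [this]
    exact hatt _ _ ((hext x θ hx i).trans hθ1)
  · have h1 := (hC i A R hR hA v' hv' p (by linarith) θ (2 * θ) hθ0.le
      ((hCi i hi.le θ hθ0.le).trans hCθ1) (ext x) (ext x) (hext x θ hx) (hext x θ hx)
      (by simp [hθ0.le])).1
    have h2 := (h1.trans (hCi i hi.le θ hθ0.le)).trans hCθ1
    linarith [norm_le_norm_add_norm_sub' (frameFlowSeq A R v' p (ext x) i) p]

end Connectivity

/-! ### Comparison of control systems -/

section Transport

open Metric

variable {V : Type*} [NormedAddCommGroup V] [NormedSpace ℝ V]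
  {F : Type*} [NormedAddCommGroup F] [NormedSpace ℝ F]

/-- Grönwall's inequality in integral form. -/
theorem le_mul_exp_integral_of_le {k f : ℝ → ℝ} (hk : Continuous k) (hf : Continuous f)
    (hk0 : ∀ t, 0 ≤ k t) {a b c : ℝ}
    (h : ∀ t ∈ Icc a b, f t ≤ c + ∫ s in a..t, k s * f s) {t : ℝ} (ht : t ∈ Icc a b) :
    f t ≤ c * Real.exp (∫ s in a..t, k s) := by
  have hab : a ≤ b := ht.1.trans ht.2
  let H : ℝ → ℝ := fun t => c + ∫ s in a..t, k s * f s
  let Q : ℝ → ℝ := fun t => ∫ s in a..t, k s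
  have hH : ∀ t, HasDerivAt H (k t * f t) t := fun t =>
    ((hk.mul hf).integral_hasStrictDerivAt a t).hasDerivAt.const_add c
  have hQ : ∀ t, HasDerivAt Q (k t) t := fun t => (hk.integral_hasStrictDerivAt a t).hasDerivAt
  have hG : ∀ t, HasDerivAt (fun t => H t * Real.exp (-Q t))
      (k t * f t * Real.exp (-Q t) + H t * (Real.exp (-Q t) * (-k t))) t := fun t =>
    (hH t).mul (hQ t).neg.exp
  have hanti : AntitoneOn (fun t => H t * Real.exp (-Q t)) (Icc a b) := by
    refine antitoneOn_of_deriv_nonpos (convex_Icc a b)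
      (fun t _ => (hG t).continuousAt.continuousWithinAt)
      (fun t _ => (hG t).differentiableAt.differentiableWithinAt) (fun t ht => ?_)
    rw [interior_Icc] at ht
    rw [(hG t).deriv]
    have h1 := h t (Ioo_subset_Icc_self ht)
    have h2 : k t * f t ≤ k t * H t := mul_le_mul_of_nonneg_left h1 (hk0 t)
    nlinarith [Real.exp_pos (-Q t)]
  have h3 := hanti (left_mem_Icc.2 hab) ht ht.1
  have h4 : H t * Real.exp (-Q t) ≤ c := by simpa [H, Q] using h3
  calc f t ≤ H t := h t ht
    _ = H t * Real.exp (-Q t) * Real.exp (Q t) := by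
        rw [mul_assoc, ← Real.exp_add]; simp
    _ ≤ c * Real.exp (Q t) := by gcongr

/-- `c` is an absolutely continuous solution of `c' = A(c) u` on `[a, b]` with integrable `u`. -/
structure IsControlCurve (A : V → F →L[ℝ] V) (c : ℝ → V) (u : ℝ → F) (a b : ℝ) : Prop where
  continuousOn : ContinuousOn c (Icc a b)
  intervalIntegrable : IntervalIntegrable u volume a b
  eq_integral : ∀ t ∈ Icc a b, c t = c a + ∫ τ in a..t, A (c τ) (u τ)

theorem intervalIntegrable_clm_apply {B : ℝ → F →L[ℝ] V} {u : ℝ → F} {a b : ℝ} (hab : a ≤ b)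
    (hB : ContinuousOn B (Icc a b)) (hu : IntervalIntegrable u volume a b) :
    IntervalIntegrable (fun t => B t (u t)) volume a b := by
  obtain ⟨K, hK⟩ := isCompact_Icc.exists_bound_of_continuousOn hB
  rw [intervalIntegrable_iff_integrableOn_Ioc_of_le hab] at hu ⊢
  have hBm : AEStronglyMeasurable B (volume.restrict (Ioc a b)) :=
    (hB.aestronglyMeasurable_of_isCompact isCompact_Icc measurableSet_Icc).mono_measure
      (Measure.restrict_mono Ioc_subset_Icc_self le_rfl)
  refine Integrable.mono' (hu.norm.const_mul K)
    ((ContinuousLinearMap.id ℝ (F →L[ℝ] V)).aestronglyMeasurable_comp₂ hBm hu.1) ?_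
  filter_upwards [ae_restrict_mem measurableSet_Ioc] with t ht
  refine (ContinuousLinearMap.le_opNorm _ _).trans ?_
  gcongr
  exact hK t (Ioc_subset_Icc_self ht)

theorem BoundedLip.continuousOn {A : V → F →L[ℝ] V} {R K : ℝ} (hA : BoundedLip A R K) :
    ContinuousOn A (closedBall 0 R) := by
  have : LipschitzOnWith K.toNNReal A (closedBall 0 R) :=
    LipschitzOnWith.of_dist_le_mul fun x hx y hy => by
      rw [dist_eq_norm, dist_eq_norm, Real.coe_toNNReal _ hA.nonneg]
      exact hA.lip x y (by simpa using hx) (by simpa using hy)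
  exact this.continuousOn

/-- A control curve of `A₁` is followed by a curve of class `C¹` of `A₂` if `A₁` and `A₂` are
close. -/
theorem IsControlCurve.exists_close [FiniteDimensional ℝ V] [FiniteDimensional ℝ F]
    {A₁ A₂ : V → F →L[ℝ] V} {R K κ L ε : ℝ} (hR : 0 < R)
    (h₁ : BoundedLip A₁ R K) (h₂ : BoundedLip A₂ (R + 1) K)
    (hκ : ∀ x, ‖x‖ ≤ R → ‖A₂ x - A₁ x‖ ≤ κ) {c : ℝ → V} {u : ℝ → F} {a b : ℝ} (hab : a ≤ b)
    (hc : IsControlCurve A₁ c u a b) (hcR : ∀ t ∈ Icc a b, ‖c t‖ ≤ R)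
    (hL : ∫ t in a..b, ‖u t‖ ≤ L) (hε : 0 < ε) {η : ℝ}
    (hη : (κ * (L + ε) + K * ε) * Real.exp (2 * K * (L + ε)) ≤ η) (hη1 : η ≤ 1) :
    ∃ (c' : ℝ → V) (u' : ℝ → F), Continuous u' ∧ c' a = c a ∧
      (∀ t ∈ Icc a b, HasDerivWithinAt c' (A₂ (c' t) (u' t)) (Icc a b) t) ∧
      (∀ t ∈ Icc a b, ‖c' t‖ ≤ R + 1) ∧ ‖c' b - c b‖ ≤ η ∧
      ∫ t in a..b, ‖u t - u' t‖ ≤ ε := by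
  have hK := h₁.nonneg
  have hκ0 : 0 ≤ κ := (norm_nonneg _).trans (hκ 0 (by simpa using hR.le))
  have hui := hc.intervalIntegrable
  have hR1 : 0 < R + 1 := by linarith
  -- The control is replaced by a continuous one at an `L¹` cost of `ε`, so that the new curve is of
  -- class `C¹`.
  obtain ⟨u', -, hu'ε, hu'c, -⟩ :=
    ((intervalIntegrable_iff_integrableOn_Ioc_of_le hab).1 hui).exists_hasCompactSupport_integral_sub_le hε
  rw [← intervalIntegral.integral_of_le hab] at hu'ε
  obtain ⟨c', hc'0, hc'⟩ := h₂.exists_curve hR1 hu'c hab (c a)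
  have hc'c : ContinuousOn c' (Icc a b) := fun t ht => (hc' t ht).continuousWithinAt
  let ρ : V → V := radialRetraction (R + 1)
  have hρc : Continuous ρ := by
    have : LipschitzWith 2 ρ := LipschitzWith.of_dist_le_mul fun x y => by
      rw [dist_eq_norm, dist_eq_norm]; exact norm_radialRetraction_sub_le hR1 x y
    exact this.continuous
  let B₂ : ℝ → F →L[ℝ] V := fun t => A₂ (ρ (c' t))
  have hB₂ : ContinuousOn B₂ (Icc a b) :=
    h₂.continuousOn.comp (hρc.comp_continuousOn hc'c)
      (fun t _ => by simpa using norm_radialRetraction_le hR1 (c' t))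
  have hB₁ : ContinuousOn (fun t => A₁ (c t)) (Icc a b) :=
    h₁.continuousOn.comp hc.continuousOn (fun t ht => by simpa using hcR t ht)
  have hsub : ∀ {t}, t ∈ Icc a b → Icc a t ⊆ Icc a b := fun ht => Icc_subset_Icc_right ht.2
  have hc'int : ∀ t ∈ Icc a b, c' t = c a + ∫ τ in a..t, B₂ τ (u' τ) := by
    intro t ht
    have := intervalIntegral.integral_eq_sub_of_hasDeriv_right_of_le ht.1
      (hc'c.mono (hsub ht)) (f' := fun τ => B₂ τ (u' τ)) (fun τ hτ =>
        ((hc' τ (hsub ht (Ioo_subset_Icc_self hτ))).hasDerivAt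
          (Icc_mem_nhds hτ.1 (hτ.2.trans_le ht.2))).hasDerivWithinAt)
      (intervalIntegrable_clm_apply ht.1 (hB₂.mono (hsub ht)) (hu'c.intervalIntegrable _ _))
    rw [this, hc'0]; abel
  have hdiffi : IntervalIntegrable (fun t => u t - u' t) volume a b :=
    hui.sub (hu'c.intervalIntegrable _ _)
  have hu'L : ∫ t in a..b, ‖u' t‖ ≤ L + ε := by
    have h1 : ∫ t in a..b, ‖u' t‖ ≤ ∫ t in a..b, (‖u t‖ + ‖u t - u' t‖) := by
      refine intervalIntegral.integral_mono_on hab (hu'c.norm.intervalIntegrable _ _)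
        (hui.norm.add hdiffi.norm) (fun t _ => ?_)
      have := norm_sub_le (u t) (u t - u' t)
      simpa using this
    rw [intervalIntegral.integral_add hui.norm hdiffi.norm] at h1
    linarith
  have hint_mono : ∀ {g : ℝ → ℝ}, IntervalIntegrable g volume a b → (∀ t, 0 ≤ g t) →
      ∀ t ∈ Icc a b, ∫ s in a..t, g s ≤ ∫ s in a..b, g s := fun hg hg0 t ht =>
    intervalIntegral.integral_mono_interval le_rfl ht.1 ht.2
      (Eventually.of_forall hg0) hg
  -- Both curves are extended by constants outside `[a, b]`, since the integral form of Grönwall's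
  -- inequality is stated for functions continuous on the whole line.
  let P : ℝ → ℝ := fun t => (projIcc a b hab t : ℝ)
  have hP : ∀ t, P t ∈ Icc a b := fun t => (projIcc a b hab t).2
  have hPt : ∀ t ∈ Icc a b, P t = t := fun t ht => by simp [P, projIcc_of_mem hab ht]
  have hPc : Continuous P := continuous_subtype_val.comp continuous_projIcc
  let e : ℝ → ℝ := fun t => ‖c' (P t) - c (P t)‖
  have hec : Continuous e :=
    ((hc'c.comp_continuous hPc hP).sub (hc.continuousOn.comp_continuous hPc hP)).norm
  have hmain : ∀ t ∈ Icc a b,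
      e t ≤ (κ * (L + ε) + K * ε) + ∫ s in a..t, (2 * K * ‖u' s‖) * e s := by
    intro t ht
    have hst := hsub ht
    have i1 := intervalIntegrable_clm_apply ht.1 (hB₂.mono hst) (hu'c.intervalIntegrable a t)
    have hut : IntervalIntegrable u volume a t :=
      hui.mono_set (by rw [uIcc_of_le ht.1, uIcc_of_le hab]; exact hst)
    have i2 := intervalIntegrable_clm_apply ht.1 (hB₁.mono hst) hut
    have e1 : e t = ‖∫ τ in a..t, (B₂ τ (u' τ) - A₁ (c τ) (u τ))‖ := by
      simp only [e, hPt t ht]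
      rw [intervalIntegral.integral_sub i1 i2, hc'int t ht, hc.eq_integral t ht]
      congr 1; abel
    have hdt : IntervalIntegrable (fun t => u t - u' t) volume a t :=
      hut.sub (hu'c.intervalIntegrable _ _)
    have g1 : IntervalIntegrable (fun s => (2 * K * ‖u' s‖) * e s) volume a t :=
      ((continuous_const.mul hu'c.norm).mul hec).intervalIntegrable _ _
    have g2 : IntervalIntegrable (fun s => κ * ‖u' s‖) volume a t :=
      (continuous_const.mul hu'c.norm).intervalIntegrable _ _
    have g3 : IntervalIntegrable (fun s => K * ‖u s - u' s‖) volume a t :=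
      hdt.norm.const_mul K
    have e2 : ‖∫ τ in a..t, (B₂ τ (u' τ) - A₁ (c τ) (u τ))‖ ≤
        ∫ τ in a..t, ((2 * K * ‖u' τ‖) * e τ + κ * ‖u' τ‖ + K * ‖u τ - u' τ‖) := by
      refine intervalIntegral.norm_integral_le_of_norm_le ht.1 ?_ ((g1.add g2).add g3)
      refine Eventually.of_forall fun s hs => ?_
      have hs' : s ∈ Icc a b := hst (Ioc_subset_Icc_self hs)
      have hcs := hcR s hs'
      have hρs : ρ (c s) = c s := radialRetraction_of_norm_le hR1 (by linarith)
      -- Three sources of error: the distance of the two curves (the retraction costs a factor `2`),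
      -- the distance `κ` of the two systems, and the distance of the two controls.
      have e3 : B₂ s (u' s) - A₁ (c s) (u s) = (A₂ (ρ (c' s)) - A₂ (ρ (c s))) (u' s) +
          (A₂ (c s) - A₁ (c s)) (u' s) + (-(A₁ (c s) (u s - u' s))) := by
        simp only [B₂, sub_apply, map_sub, hρs]; abel
      rw [e3]
      refine norm_add₃_le.trans (add_le_add (add_le_add ?_ ?_) ?_)
      · refine (ContinuousLinearMap.le_opNorm _ _).trans ?_
        have := h₂.lip (ρ (c' s)) (ρ (c s)) (norm_radialRetraction_le hR1 _)
          (norm_radialRetraction_le hR1 _)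
        have h5 := norm_radialRetraction_sub_le hR1 (c' s) (c s)
        have h6 : e s = ‖c' s - c s‖ := by simp only [e, hPt s hs']
        rw [h6]
        calc ‖A₂ (ρ (c' s)) - A₂ (ρ (c s))‖ * ‖u' s‖ ≤ K * (2 * ‖c' s - c s‖) * ‖u' s‖ := by
              gcongr; exact this.trans (by gcongr)
          _ = _ := by ring
      · refine (ContinuousLinearMap.le_opNorm _ _).trans ?_
        gcongr
        exact hκ _ hcs
      · rw [norm_neg]
        refine (ContinuousLinearMap.le_opNorm _ _).trans ?_
        gcongr
        exact h₁.bound _ hcs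
    rw [intervalIntegral.integral_add (g1.add g2) g3, intervalIntegral.integral_add g1 g2,
      intervalIntegral.integral_const_mul κ, intervalIntegral.integral_const_mul K] at e2
    have m1 := hint_mono (hu'c.norm.intervalIntegrable a b) (fun t => norm_nonneg _) t ht
    have m2 := hint_mono hdiffi.norm (fun t => norm_nonneg _) t ht
    have m3 : κ * ∫ s in a..t, ‖u' s‖ ≤ κ * (L + ε) := by gcongr; exact m1.trans hu'L
    have m4 : K * ∫ s in a..t, ‖u s - u' s‖ ≤ K * ε := by gcongr; exact m2.trans hu'ε
    rw [e1]
    linarith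
  have hclose : ∀ t ∈ Icc a b, ‖c' t - c t‖ ≤ η := by
    intro t ht
    have h1 := le_mul_exp_integral_of_le (k := fun t => 2 * K * ‖u' t‖)
      (continuous_const.mul hu'c.norm) hec (fun t => by positivity) hmain ht
    simp only [e, hPt t ht] at h1
    refine h1.trans (le_trans ?_ hη)
    have hL0 : 0 ≤ L + ε := (intervalIntegral.integral_nonneg hab
      (fun t _ => norm_nonneg _)).trans hu'L
    gcongr
    rw [intervalIntegral.integral_const_mul]
    gcongr
    exact (hint_mono (hu'c.norm.intervalIntegrable a b) (fun t => norm_nonneg _) t ht).trans hu'L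
  have hc'R : ∀ t ∈ Icc a b, ‖c' t‖ ≤ R + 1 := fun t ht => by
    linarith [hclose t ht, hcR t ht, norm_le_norm_add_norm_sub' (c' t) (c t)]
  refine ⟨c', u', hu'c, hc'0, fun t ht => ?_, hc'R, hclose b (right_mem_Icc.2 hab), hu'ε⟩
  have := hc' t ht
  rwa [radialRetraction_of_norm_le hR1 (hc'R t ht)] at this

/-- A control curve whose length is small compared to the bound of `A` stays in the ball. -/
theorem IsControlCurve.norm_sub_le {A : V → F →L[ℝ] V} {R K : ℝ}
    (hA : BoundedLip A R K) {c : ℝ → V} {u : ℝ → F} {a b : ℝ} (hab : a ≤ b)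
    (hc : IsControlCurve A c u a b) (h : ‖c a‖ + K * (∫ t in a..b, ‖u t‖) < R) :
    ∀ t ∈ Icc a b, ‖c t - c a‖ ≤ K * ∫ t in a..b, ‖u t‖ := by
  have hK := hA.nonneg
  have hui := hc.intervalIntegrable
  have step : ∀ t ∈ Icc a b, (∀ s ∈ Ico a t, ‖c s‖ ≤ R) →
      ‖c t - c a‖ ≤ K * ∫ t in a..b, ‖u t‖ := by
    intro t ht hs
    rw [hc.eq_integral t ht, add_sub_cancel_left]
    have hut : IntervalIntegrable u volume a t :=
      hui.mono_set (by rw [uIcc_of_le ht.1, uIcc_of_le hab]; exact Icc_subset_Icc_right ht.2)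
    refine (intervalIntegral.norm_integral_le_of_norm_le ht.1 (g := fun s => K * ‖u s‖) ?_
      (hut.norm.const_mul K)).trans ?_
    -- The curve is assumed to lie in the ball only before time `t`; the end point is a null set.
    -- This is what allows `t` to be a first exit time below.
    · have : ∀ᵐ s : ℝ, s ≠ t := by simp [ae_iff]
      filter_upwards [this] with s hst hs'
      refine (ContinuousLinearMap.le_opNorm _ _).trans ?_
      gcongr
      exact hA.bound _ (hs s ⟨hs'.1.le, lt_of_le_of_ne hs'.2 hst⟩)
    · rw [intervalIntegral.integral_const_mul]
      gcongr
      exact intervalIntegral.integral_mono_interval le_rfl ht.1 ht.2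
        (Eventually.of_forall fun _ => norm_nonneg _) hui.norm
  have hball : ∀ t ∈ Icc a b, ‖c t‖ < R := by
    by_contra! hcon
    obtain ⟨t₁, ht₁, hRt₁⟩ := hcon
    have hcl : IsCompact (Icc a b ∩ (fun t => ‖c t‖) ⁻¹' (Ici R)) :=
      isCompact_Icc.of_isClosed_subset
        (hc.continuousOn.norm.preimage_isClosed_of_isClosed isClosed_Icc isClosed_Ici)
        inter_subset_left
    -- At the first exit time `t₀` the displacement bound already holds, and by the smallness
    -- hypothesis it excludes `‖c t₀‖ ≥ R`.
    obtain ⟨t₀, ht₀, hmin⟩ := hcl.exists_isLeast ⟨t₁, ht₁, hRt₁⟩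
    have h1 := step t₀ ht₀.1 (fun s hs => by
      by_contra! hsR
      have := hmin ⟨⟨hs.1, hs.2.le.trans ht₀.1.2⟩, hsR.le⟩
      exact absurd hs.2 (not_lt.2 this))
    have h2 : R ≤ ‖c t₀‖ := ht₀.2
    linarith [norm_le_norm_add_norm_sub' (c t₀) (c a)]
  exact fun t ht => step t ht (fun s hs => (hball s ⟨hs.1, hs.2.le.trans ht.2⟩).le)

end Transport

/-! ### Families of control systems -/

section Family

open Metric

variable {V : Type*} [NormedAddCommGroup V] [NormedSpace ℝ V]
  {F : Type*} [NormedAddCommGroup F] [NormedSpace ℝ F]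

/-- `N` is a norm, equivalent to the given one. -/
structure IsEquivNorm (N : F → ℝ) (k k' : ℝ) : Prop where
  pos : 0 < k
  le_norm : ∀ u, k * ‖u‖ ≤ N u
  norm_le : ∀ u, N u ≤ k' * ‖u‖
  smul : ∀ (c : ℝ) u, N (c • u) = |c| * N u
  add_le : ∀ u v, N (u + v) ≤ N u + N v

theorem IsEquivNorm.nonneg {N : F → ℝ} {k k' : ℝ} (hN : IsEquivNorm N k k') (u : F) : 0 ≤ N u :=
  (mul_nonneg hN.pos.le (norm_nonneg u)).trans (hN.le_norm u)

theorem IsEquivNorm.map_zero {N : F → ℝ} {k k' : ℝ} (hN : IsEquivNorm N k k') : N 0 = 0 := by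
  simpa using hN.smul 0 0

theorem IsEquivNorm.continuous {N : F → ℝ} {k k' : ℝ} (hN : IsEquivNorm N k k') :
    Continuous N := by
  have h : ∀ u v, N u - N v ≤ k' * ‖u - v‖ := fun u v => by
    have := hN.add_le (u - v) v
    rw [sub_add_cancel] at this
    linarith [hN.norm_le (u - v)]
  have : LipschitzWith k'.toNNReal N := LipschitzWith.of_dist_le_mul fun u v => by
    rw [dist_eq_norm, dist_eq_norm, Real.norm_eq_abs, abs_le]
    have h1 : k' * ‖u - v‖ ≤ k'.toNNReal * ‖u - v‖ := by gcongr; exact Real.le_coe_toNNReal k'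
    have h2 := h v u
    rw [norm_sub_rev] at h2
    constructor <;> linarith [h u v]
  exact this.continuous

/-- A family of left-invariant frames `A s` with controls in `ι F`, and of distances `d s`, which
degenerates to a frame `A 0`. -/
structure FrameFamily (ι : F →L[ℝ] V) (N : F → ℝ) (br : ℝ → V →L[ℝ] V →L[ℝ] V)
    (A : ℝ → V → V →L[ℝ] V) (d : ℝ → V → V → ℝ≥0∞) : Prop where
  frame : ∀ R : ℝ, ∃ s₀ > 0, ∃ K, 0 ≤ K ∧ ∀ s ∈ Icc 0 s₀,
    (∃ A', FrameOn (br s) (A s) A' R K) ∧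
    (∀ x, ‖x‖ ≤ R → ∃ e : V ≃L[ℝ] V, (e : V →L[ℝ] V) = A s x ∧ ‖(e.symm : V →L[ℝ] V)‖ ≤ K) ∧
    ∀ x, ‖x‖ ≤ R → ‖A s x - A 0 x‖ ≤ K * s
  continuous_bracket : ContinuousAt br 0
  word : ∀ ε > 0, ∃ (b : Basis (Fin (finrank ℝ V)) ℝ V) (l : Fin (finrank ℝ V) → List F)
    (u : Fin (finrank ℝ V) → F), (∀ i, conjWord (br 0) ι (l i) (u i) = b i) ∧
    ∀ i, ‖u i‖ + ((l i).map fun a => 2 * ‖a‖).sum ≤ ε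
  triangle : ∀ s, 0 ≤ s → ∀ p q r, d s p r ≤ d s p q + d s q r
  arc_le : ∀ R : ℝ, ∃ s₀ > 0, ∀ s ∈ Icc 0 s₀, ∀ (c : ℝ → V) (u : ℝ → F) (a b : ℝ), a ≤ b →
    Continuous u → (∀ t ∈ Icc a b, HasDerivWithinAt c (A s (c t) (ι (u t))) (Icc a b) t) →
    (∀ t ∈ Icc a b, ‖c t‖ ≤ R) →
    d s (c a) (c b) ≤ ENNReal.ofReal (∫ t in a..b, N (u t))
  lift : ∀ R L : ℝ, ∃ R', ∃ s₀ > 0, ∀ s ∈ Icc 0 s₀, ∀ p q, ‖p‖ ≤ R → ‖q‖ ≤ R → ∀ l ≤ L,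
    d s p q < ENNReal.ofReal l → ∃ (c : ℝ → V) (u : ℝ → F) (a b : ℝ), a ≤ b ∧
      IsControlCurve (fun x => (A s x).comp ι) c u a b ∧ c a = p ∧ c b = q ∧
      (∀ t ∈ Icc a b, ‖c t‖ ≤ R') ∧ ∫ t in a..b, N (u t) < l

variable {ι : F →L[ℝ] V} {N : F → ℝ} {br : ℝ → V →L[ℝ] V →L[ℝ] V}
  {A : ℝ → V → V →L[ℝ] V} {d : ℝ → V → V → ℝ≥0∞} {k k' : ℝ}

theorem Attainable.mono {A : V → V →L[ℝ] V} {d : V → V → ℝ≥0∞} {R m m' : ℝ} {cost cost' : ℝ≥0∞}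
    {v : V} (h : Attainable A d R m cost v) (hm : m ≤ m') (hc : cost ≤ cost') :
    Attainable A d R m' cost' v := by
  intro p hp
  obtain ⟨y, h0, hy, hb⟩ := h p (by linarith)
  exact ⟨y, h0, hy, fun t ht => ⟨(hb t ht).1.trans hm, (hb t ht).2.trans hc⟩⟩

theorem continuousAt_conjWord [CompleteSpace V] (h : ContinuousAt br 0) (l : List F) (u : F) :
    ContinuousAt (fun s => conjWord (br s) ι l u) 0 := by
  induction l with
  | nil => exact continuousAt_const
  | cons a l ih =>
    have h1 : ContinuousAt (fun s => br s (ι a)) 0 :=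
      ((ContinuousLinearMap.apply ℝ (V →L[ℝ] V) (ι a)).continuous.continuousAt).comp h
    have h2 : ContinuousAt (fun s => NormedSpace.exp (br s (ι a))) 0 :=
      ContinuousAt.comp (f := fun s => br s (ι a)) (NormedSpace.exp_analytic (𝕂 := ℝ) _).continuousAt h1
    exact h2.clm_apply ih

theorem FrameFamily.arcBound (h : FrameFamily ι N br A d) (R : ℝ) :
    ∃ s₀ > 0, ∀ s ∈ Icc 0 s₀, ArcBound ι N (A s) (d s) R := by
  obtain ⟨s₀, hs₀, H⟩ := h.arc_le R
  refine ⟨s₀, hs₀, fun s hs => ⟨h.triangle s hs.1, fun u y hy hyR => ?_⟩⟩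
  simpa using H s hs y (fun _ => u) 0 1 zero_le_one continuous_const hy hyR

/-- Chow's theorem, uniformly in `s`. The words which give a basis for `br 0` give vectors close to
that basis for `br s`, and conjugation makes their directions attainable at a cost which does not
depend on `s`. -/
theorem FrameFamily.equicontinuous [FiniteDimensional ℝ V] (h : FrameFamily ι N br A d)
    (hN : IsEquivNorm N k k') (R : ℝ) (hR : 0 < R) {ε : ℝ} (hε : 0 < ε) :
    ∃ δ > 0, ∃ s₀ > 0, ∀ s ∈ Icc 0 s₀, ∀ p q, ‖p‖ ≤ R → ‖q - p‖ ≤ δ →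
      d s p q ≤ ENNReal.ofReal ε := by
  set n := finrank ℝ V
  obtain ⟨s₁, hs₁, K, hK, hfr⟩ := h.frame (R + 2)
  obtain ⟨s₂, hs₂, harc⟩ := h.arcBound (R + 2)
  -- Words of total length `1 / Q` move points by at most `1`, by the summand `K * ‖ι‖`, and `n` of
  -- them cost at most `ε`, by the summand `n * |k'| / ε`.
  set Q : ℝ := 1 + K * ‖ι‖ + n * |k'| / ε with hQ
  have hQ0 : 0 < Q := by positivity
  obtain ⟨b, l, u, hb, hlu⟩ := h.word (1 / Q) (by positivity)
  obtain ⟨δ, hδ, κ, hκ, H⟩ := exists_dist_le_of_attainable (F := F) b K hK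
  have hcont : ∀ᶠ s in 𝓝 (0 : ℝ), ∀ i, ‖conjWord (br s) ι (l i) (u i) - b i‖ ≤ κ := by
    rw [eventually_all]
    intro i
    have := continuousAt_conjWord (ι := ι) h.continuous_bracket (l i) (u i)
    have h2 := this.eventually_mem (s := closedBall (b i) κ)
      (by simp only [hb]; exact closedBall_mem_nhds _ hκ)
    filter_upwards [h2] with s hs
    simpa [dist_eq_norm] using hs
  obtain ⟨s₃, hs₃, hball⟩ := Metric.eventually_nhds_iff_ball.1 hcont
  refine ⟨δ, hδ, min (min s₁ s₂) (s₃ / 2), by positivity, fun s hs p q hp hq => ?_⟩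
  have hs1 : s ∈ Icc 0 s₁ := ⟨hs.1, hs.2.trans ((min_le_left _ _).trans (min_le_left _ _))⟩
  have hs2 : s ∈ Icc 0 s₂ := ⟨hs.1, hs.2.trans ((min_le_left _ _).trans (min_le_right _ _))⟩
  have hs3 : s ∈ ball (0 : ℝ) s₃ := by
    rw [mem_ball_zero_iff, Real.norm_of_nonneg hs.1]
    exact (hs.2.trans (min_le_right _ _)).trans_lt (by linarith)
  obtain ⟨⟨A', hA'⟩, hinv, -⟩ := hfr s hs1
  have hd := harc s hs2
  set cost : ℝ := |k'| * (1 / Q) with hcost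
  have hatt : ∀ i, ∀ c : ℝ, |c| ≤ 1 →
      Attainable (A s) (d s) (R + 2) 1 (ENNReal.ofReal cost)
        (c • conjWord (br s) ι (l i) (u i)) := by
    intro i c hc
    rw [← conjWord_smul]
    have hcu : ‖c • u i‖ ≤ ‖u i‖ := by
      rw [norm_smul]; exact mul_le_of_le_one_left (norm_nonneg _) hc
    have hw : ‖c • u i‖ + ((l i).map fun a => 2 * ‖a‖).sum ≤ 1 / Q := by linarith [hlu i]
    have hmono1 : ∀ l : List F, (l.map fun a => 2 * (K * ‖ι a‖)).sum ≤
        K * ‖ι‖ * (l.map fun a => 2 * ‖a‖).sum := by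
      intro l
      induction l with
      | nil => simp
      | cons a l ih =>
        simp only [List.map_cons, List.sum_cons]
        have : K * ‖ι a‖ ≤ K * (‖ι‖ * ‖a‖) := by gcongr; exact ι.le_opNorm a
        linarith
    have hmono2 : ∀ l : List F, (l.map fun a => 2 * ENNReal.ofReal (N a)).sum ≤
        ENNReal.ofReal (|k'| * (l.map fun a => 2 * ‖a‖).sum) := by
      intro l
      induction l with
      | nil => simp
      | cons a l ih =>
        simp only [List.map_cons, List.sum_cons]
        have h0 : 0 ≤ (l.map fun a => 2 * ‖a‖).sum := List.sum_nonneg (by simp)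
        rw [mul_add, ENNReal.ofReal_add (by positivity) (by positivity)]
        refine add_le_add ?_ ih
        have : |k'| * (2 * ‖a‖) = 2 * (|k'| * ‖a‖) := by ring
        rw [this, ENNReal.ofReal_mul (by norm_num), ENNReal.ofReal_ofNat]
        gcongr
        exact (hN.norm_le a).trans (by gcongr; exact le_abs_self k')
    refine (hA'.attainable_conjWord (by linarith) hd hN.smul hN.nonneg (l i) (c • u i)).mono ?_ ?_
    · calc K * ‖ι (c • u i)‖ + ((l i).map fun a => 2 * (K * ‖ι a‖)).sum
          ≤ K * (‖ι‖ * ‖c • u i‖) + K * ‖ι‖ * ((l i).map fun a => 2 * ‖a‖).sum :=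
            add_le_add (by gcongr; exact ι.le_opNorm _) (hmono1 _)
        _ = K * ‖ι‖ * (‖c • u i‖ + ((l i).map fun a => 2 * ‖a‖).sum) := by ring
        _ ≤ K * ‖ι‖ * (1 / Q) := by gcongr
        _ ≤ 1 := by
            rw [mul_one_div, div_le_one hQ0, hQ]
            have : 0 ≤ n * |k'| / ε := by positivity
            linarith
    · have h0 : 0 ≤ ((l i).map fun a => 2 * ‖a‖).sum :=
        List.sum_nonneg (by simp)
      calc ENNReal.ofReal (N (c • u i)) + ((l i).map fun a => 2 * ENNReal.ofReal (N a)).sum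
          ≤ ENNReal.ofReal (|k'| * ‖c • u i‖) +
            ENNReal.ofReal (|k'| * ((l i).map fun a => 2 * ‖a‖).sum) := by
            refine add_le_add (ENNReal.ofReal_le_ofReal ?_) (hmono2 _)
            exact (hN.norm_le _).trans (by gcongr; exact le_abs_self k')
        _ = ENNReal.ofReal (|k'| * (‖c • u i‖ + ((l i).map fun a => 2 * ‖a‖).sum)) := by
            rw [mul_add, ENNReal.ofReal_add (by positivity) (by positivity)]
        _ ≤ ENNReal.ofReal cost := ENNReal.ofReal_le_ofReal (by rw [hcost]; gcongr)
  refine (H (A s) (R + 2) (by linarith) hA'.toBoundedLip hinv ι N (d s) hd hN.map_zero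
    (ENNReal.ofReal cost) _ (hball s hs3) hatt p q (by linarith) hq).trans ?_
  rw [← ENNReal.ofReal_natCast, ← ENNReal.ofReal_mul (by positivity)]
  refine ENNReal.ofReal_le_ofReal ?_
  rw [hcost]
  have : (n : ℝ) * (|k'| * (1 / Q)) = (n * |k'| / ε) / Q * ε := by field_simp
  rw [this]
  refine mul_le_of_le_one_left hε.le ((div_le_one hQ0).2 ?_)
  rw [hQ]
  have : 0 ≤ K * ‖ι‖ := by positivity
  linarith

/-- The segment from `p` to `q` stays in the ball by convexity. It is cut into a fixed number of
pieces, each so short that it costs at most `1`. -/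
theorem FrameFamily.exists_bound [FiniteDimensional ℝ V] (h : FrameFamily ι N br A d)
    (hN : IsEquivNorm N k k') (R : ℝ) (hR : 0 < R) :
    ∃ L : ℝ, ∃ s₀ > 0, ∀ s ∈ Icc 0 s₀, ∀ p q, ‖p‖ ≤ R → ‖q‖ ≤ R →
      d s p q ≤ ENNReal.ofReal L := by
  obtain ⟨δ, hδ, s₀, hs₀, H⟩ := h.equicontinuous hN R hR one_pos
  obtain ⟨n, hn⟩ := exists_nat_gt (2 * R / δ)
  have hn0 : 0 < (n : ℝ) := lt_of_le_of_lt (by positivity) hn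
  refine ⟨n + 1, s₀, hs₀, fun s hs p q hp hq => ?_⟩
  let c : ℕ → V := fun i => p + ((i : ℝ) / n) • (q - p)
  have hc : ∀ i ≤ n, ‖c i‖ ≤ R := by
    intro i hi
    have hin : (i : ℝ) / n ∈ Icc (0 : ℝ) 1 :=
      ⟨by positivity, (div_le_one hn0).2 (by exact_mod_cast hi)⟩
    have := (convex_closedBall (0 : V) R).add_smul_sub_mem (x := p) (y := q) (by simpa) (by simpa)
      hin
    simpa using this
  have hstep : ∀ i, ‖c (i + 1) - c i‖ ≤ δ := by
    intro i
    have e : c (i + 1) - c i = (1 / n : ℝ) • (q - p) := by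
      simp only [c]
      push_cast
      rw [add_sub_add_left_eq_sub, ← sub_smul]
      congr 1; ring
    rw [e, norm_smul, Real.norm_of_nonneg (by positivity), one_div, inv_mul_le_iff₀ hn0]
    have h1 : ‖q - p‖ ≤ 2 * R := (norm_sub_le _ _).trans (by linarith)
    rw [div_lt_iff₀ hδ] at hn
    linarith
  have key : ∀ i ≤ n, d s p (c i) ≤ ENNReal.ofReal (i + 1) := by
    intro i
    induction i with
    | zero =>
      intro _
      have e : c 0 = p := by simp [c]
      simpa [e] using H s hs p p hp (by simpa using hδ.le)
    | succ i ih =>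
      intro hi
      refine (h.triangle s hs.1 p (c i) (c (i + 1))).trans ?_
      push_cast
      rw [ENNReal.ofReal_add (by positivity) one_pos.le]
      exact add_le_add (ih (by omega)) (H s hs _ _ (hc i (by omega)) (hstep i))
  have e : c n = q := by simp [c, hn0.ne']
  simpa [e] using key n le_rfl

theorem BoundedLip.comp_right {A : V → V →L[ℝ] V} {R K : ℝ} (hA : BoundedLip A R K)
    (ι : F →L[ℝ] V) : BoundedLip (fun x => (A x).comp ι) R (K * ‖ι‖) := by
  have := hA.nonneg
  refine ⟨by positivity, fun x hx => ?_, fun x y hx hy => ?_⟩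
  · exact (ContinuousLinearMap.opNorm_comp_le _ _).trans (by gcongr; exact hA.bound x hx)
  · rw [← ContinuousLinearMap.sub_comp]
    refine (ContinuousLinearMap.opNorm_comp_le _ _).trans ?_
    calc ‖A x - A y‖ * ‖ι‖ ≤ K * ‖x - y‖ * ‖ι‖ := by gcongr; exact hA.lip x y hx hy
      _ = _ := by ring

theorem BoundedLip.mono {A : V → F →L[ℝ] V} {R R' K K' : ℝ} (hA : BoundedLip A R K)
    (hR : R' ≤ R) (hK : K ≤ K') : BoundedLip A R' K' :=
  ⟨hA.nonneg.trans hK, fun x hx => (hA.bound x (hx.trans hR)).trans hK, fun x y hx hy =>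
    (hA.lip x y (hx.trans hR) (hy.trans hR)).trans (by gcongr)⟩

/-- The distances of the family converge, uniformly on bounded sets. -/
theorem FrameFamily.dist_le_add [FiniteDimensional ℝ V] [FiniteDimensional ℝ F]
    (h : FrameFamily ι N br A d) (hN : IsEquivNorm N k k') (R : ℝ) (hR : 0 < R) {ε : ℝ}
    (hε : 0 < ε) :
    ∃ s₀ > 0, ∀ s ∈ Icc 0 s₀, ∀ s' ∈ Icc 0 s₀, ∀ p q, ‖p‖ ≤ R → ‖q‖ ≤ R →
      d s' p q ≤ d s p q + ENNReal.ofReal ε := by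
  have hk := hN.pos
  obtain ⟨L, s₁, hs₁, hL⟩ := h.exists_bound hN R hR
  obtain ⟨R₂, s₂, hs₂, hlift⟩ := h.lift R (max L 0 + ε)
  set R' := max R R₂ with hR'
  have hR'0 : 0 < R' := lt_max_of_lt_left hR
  obtain ⟨δ, hδ, s₃, hs₃, heq⟩ := h.equicontinuous hN (R' + 1) (by linarith)
    (show 0 < ε / 3 by positivity)
  obtain ⟨s₄, hs₄, K, hK, hfr⟩ := h.frame (R' + 1)
  obtain ⟨s₅, hs₅, harc⟩ := h.arc_le (R' + 1)
  set K₂ := K * ‖ι‖ with hK₂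
  have hK₂0 : 0 ≤ K₂ := by positivity
  set L₂ := (max L 0 + ε) / k with hL₂
  have hL₂0 : 0 ≤ L₂ := by positivity
  set η := min δ 1 with hη
  have hη0 : 0 < η := lt_min hδ one_pos
  -- choice of the error in the control and in the frame
  set ε' := min (min 1 (ε / (3 * (|k'| + 1))))
    (η / (2 * ((K₂ + 1) * Real.exp (2 * K₂ * (L₂ + 1))))) with hε'
  have hε'0 : 0 < ε' := by positivity
  have hε'1 : ε' ≤ 1 := (min_le_left _ _).trans (min_le_left _ _)
  have hε'2 : |k'| * ε' ≤ ε / 3 := by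
    have h1 : ε' ≤ ε / (3 * (|k'| + 1)) := (min_le_left _ _).trans (min_le_right _ _)
    rw [le_div_iff₀ (by positivity)] at h1
    linarith
  have hε'3 : K₂ * ε' * Real.exp (2 * K₂ * (L₂ + 1)) ≤ η / 2 := by
    have h1 : ε' ≤ η / (2 * ((K₂ + 1) * Real.exp (2 * K₂ * (L₂ + 1)))) := min_le_right _ _
    rw [le_div_iff₀ (by positivity)] at h1
    have : 0 < ε' * Real.exp (2 * K₂ * (L₂ + 1)) := by positivity
    linarith
  set κ := η / (2 * ((L₂ + 1) * Real.exp (2 * K₂ * (L₂ + 1)))) with hκ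
  have hκ0 : 0 < κ := by positivity
  have hκ1 : κ * (L₂ + 1) * Real.exp (2 * K₂ * (L₂ + 1)) = η / 2 := by
    rw [hκ]; field_simp
  have hηbound : (κ * (L₂ + ε') + K₂ * ε') * Real.exp (2 * K₂ * (L₂ + ε')) ≤ η := by
    calc (κ * (L₂ + ε') + K₂ * ε') * Real.exp (2 * K₂ * (L₂ + ε'))
        ≤ (κ * (L₂ + 1) + K₂ * ε') * Real.exp (2 * K₂ * (L₂ + 1)) := by gcongr
      _ ≤ η := by rw [add_mul]; linarith
  set s₆ := κ / (2 * (K₂ + 1)) with hs₆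
  have hs₆0 : 0 < s₆ := by positivity
  refine ⟨min (min (min s₁ s₂) (min s₃ s₄)) (min s₅ s₆), by positivity, ?_⟩
  have hsub : ∀ s ∈ Icc 0 (min (min (min s₁ s₂) (min s₃ s₄)) (min s₅ s₆)),
      s ∈ Icc 0 s₁ ∧ s ∈ Icc 0 s₂ ∧ s ∈ Icc 0 s₃ ∧ s ∈ Icc 0 s₄ ∧ s ∈ Icc 0 s₅ ∧
      s ∈ Icc 0 s₆ := by
    intro s hs
    simp only [mem_Icc, le_min_iff] at hs ⊢
    tauto
  intro s hs s' hs' p q hp hq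
  obtain ⟨a1, a2, -, a4, -, a6⟩ := hsub s hs
  obtain ⟨-, -, b3, b4, b5, b6⟩ := hsub s' hs'
  have hdL := hL s a1 p q hp hq
  have hdtop : d s p q ≠ ⊤ := (hdL.trans_lt ENNReal.ofReal_lt_top).ne
  set D := (d s p q).toReal with hD
  have hD0 : 0 ≤ D := ENNReal.toReal_nonneg
  have hdD : d s p q = ENNReal.ofReal D := (ENNReal.ofReal_toReal hdtop).symm
  have hDL : D ≤ max L 0 := by
    rw [hdD] at hdL
    exact (ENNReal.ofReal_le_ofReal_iff (le_max_right L 0)).1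
      (hdL.trans (ENNReal.ofReal_le_ofReal (le_max_left _ _)))
  -- One third of `ε` pays for the choice of an almost minimal curve, one for the change of control,
  -- and one for the jump from the new end point `c' b` to `q`.
  obtain ⟨c, u, a, b, hab, hc, hca, hcb, hcR, hNl⟩ := hlift s a2 p q hp hq (D + ε / 3)
    (by linarith) (by
      rw [hdD]; exact (ENNReal.ofReal_lt_ofReal_iff (by linarith)).2 (by linarith))
  have hui := hc.intervalIntegrable
  have hNi : IntervalIntegrable (fun t => N (u t)) volume a b := by
    rw [intervalIntegrable_iff_integrableOn_Ioc_of_le hab] at hui ⊢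
    refine Integrable.mono' (hui.norm.const_mul |k'|)
      (hN.continuous.comp_aestronglyMeasurable hui.1) (Eventually.of_forall fun t => ?_)
    rw [Real.norm_of_nonneg (hN.nonneg _)]
    exact (hN.norm_le _).trans (by gcongr; exact le_abs_self k')
  have huL : ∫ t in a..b, ‖u t‖ ≤ L₂ := by
    rw [hL₂, le_div_iff₀ hk, mul_comm, ← intervalIntegral.integral_const_mul]
    refine (intervalIntegral.integral_mono_on hab (hui.norm.const_mul k) hNi
      (fun t _ => hN.le_norm (u t))).trans ?_
    linarith
  obtain ⟨⟨A₁', hA₁⟩, -, hA10⟩ := hfr s a4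
  obtain ⟨⟨A₂', hA₂⟩, -, hA20⟩ := hfr s' b4
  have hclose : ∀ x, ‖x‖ ≤ R' → ‖(A s' x).comp ι - (A s x).comp ι‖ ≤ κ := by
    intro x hx
    rw [← ContinuousLinearMap.sub_comp]
    refine (ContinuousLinearMap.opNorm_comp_le _ _).trans ?_
    have e : A s' x - A s x = (A s' x - A 0 x) - (A s x - A 0 x) := by abel
    have h1 : ‖A s' x - A s x‖ ≤ K * (2 * s₆) := by
      rw [e]
      refine (norm_sub_le _ _).trans ?_
      have := hA20 x (by linarith)
      have := hA10 x (by linarith)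
      have : K * s ≤ K * s₆ := by gcongr; exact a6.2
      have : K * s' ≤ K * s₆ := by gcongr; exact b6.2
      linarith
    calc ‖A s' x - A s x‖ * ‖ι‖ ≤ K * (2 * s₆) * ‖ι‖ := by gcongr
      _ = K₂ / (K₂ + 1) * κ := by rw [hs₆, hK₂]; field_simp
      _ ≤ κ := mul_le_of_le_one_left hκ0.le ((div_le_one (by positivity)).2 (by linarith))
  obtain ⟨c', u', hu'c, hc'0, hc', hc'R, hc'b, hu'⟩ := hc.exists_close hR'0
    ((hA₁.toBoundedLip.comp_right ι).mono (by linarith) le_rfl)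
    (hA₂.toBoundedLip.comp_right ι) hclose hab
    (fun t ht => (hcR t ht).trans (le_max_right _ _)) huL hε'0 hηbound (min_le_right _ _)
  have hd1 : d s' p (c' b) ≤ ENNReal.ofReal (D + ε / 3 + ε / 3) := by
    have h1 := harc s' b5 c' u' a b hab hu'c hc' hc'R
    rw [hc'0, hca] at h1
    refine h1.trans (ENNReal.ofReal_le_ofReal ?_)
    have hdi : IntervalIntegrable (fun t => u t - u' t) volume a b :=
      hui.sub (hu'c.intervalIntegrable _ _)
    have h2 : ∫ t in a..b, N (u' t) ≤ ∫ t in a..b, (N (u t) + |k'| * ‖u t - u' t‖) := by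
      refine intervalIntegral.integral_mono_on hab
        ((hN.continuous.comp hu'c).intervalIntegrable _ _) (hNi.add (hdi.norm.const_mul _))
        (fun t _ => ?_)
      have h3 := hN.add_le (u t) (u' t - u t)
      rw [add_sub_cancel] at h3
      have h4 := hN.norm_le (u' t - u t)
      rw [norm_sub_rev] at h4
      have h5 : k' * ‖u t - u' t‖ ≤ |k'| * ‖u t - u' t‖ := by gcongr; exact le_abs_self k'
      linarith
    rw [intervalIntegral.integral_add hNi (hdi.norm.const_mul _),
      intervalIntegral.integral_const_mul] at h2
    have h6 : |k'| * ∫ t in a..b, ‖u t - u' t‖ ≤ |k'| * ε' := by gcongr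
    linarith
  have hd2 : d s' (c' b) q ≤ ENNReal.ofReal (ε / 3) := by
    refine heq s' b3 _ _ (hc'R b (right_mem_Icc.2 hab)) ?_
    rw [← hcb, norm_sub_rev]
    exact hc'b.trans (min_le_left _ _)
  calc d s' p q ≤ d s' p (c' b) + d s' (c' b) q := h.triangle s' hs'.1 _ _ _
    _ ≤ ENNReal.ofReal (D + ε / 3 + ε / 3) + ENNReal.ofReal (ε / 3) := add_le_add hd1 hd2
    _ = d s p q + ENNReal.ofReal ε := by
        rw [hdD, ← ENNReal.ofReal_add (by positivity) (by positivity),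
          ← ENNReal.ofReal_add (by positivity) (by positivity)]
        congr 1; ring

end Family

/-! ### The function `(1 - exp (-T)) / T` -/

section Psi

variable {V : Type*} [NormedAddCommGroup V] [NormedSpace ℝ V]
  {W : Type*} [NormedAddCommGroup W] [NormedSpace ℝ W]

theorem exp_intertwine [CompleteSpace V] [CompleteSpace W] {S : V →L[ℝ] W} {X : V →L[ℝ] V}
    {Y : W →L[ℝ] W} (h : S.comp X = Y.comp S) (x : V) :
    S (NormedSpace.exp X x) = NormedSpace.exp Y (S x) := by
  have hX := (ContinuousLinearMap.apply ℝ V x).hasSum (NormedSpace.exp_series_hasSum_exp' (𝕂 := ℝ) X)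
  have hY := (ContinuousLinearMap.apply ℝ W (S x)).hasSum
    (NormedSpace.exp_series_hasSum_exp' (𝕂 := ℝ) Y)
  have hSX := S.hasSum hX
  have hpow : ∀ n : ℕ, S ((X ^ n) x) = (Y ^ n) (S x) := by
    intro n
    induction n with
    | zero => simp
    | succ n ih =>
      rw [pow_succ', pow_succ']
      simp only [mul_apply_eq_comp, ← ih]
      exact congrArg (fun f => f ((X ^ n) x)) h
  refine HasSum.unique (hSX.congr_fun ?_) hY
  intro n
  simp only [ContinuousLinearMap.apply_apply, map_smul, hpow]

/-- The endomorphism `(x, y) ↦ (y - T x, 0)`. -/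
noncomputable def psiGenerator (T : V →L[ℝ] V) : V × V →L[ℝ] V × V :=
  (ContinuousLinearMap.snd ℝ V V - T.comp (ContinuousLinearMap.fst ℝ V V)).prod 0

theorem psiGenerator_apply (T : V →L[ℝ] V) (z : V × V) : psiGenerator T z = (z.2 - T z.1, 0) := rfl

/-- The entire function `(1 - exp (-T)) / T = ∑ (-T)ᵏ / (k + 1)!`. -/
noncomputable def psi (T : V →L[ℝ] V) : V →L[ℝ] V :=
  (ContinuousLinearMap.fst ℝ V V).comp ((NormedSpace.exp (psiGenerator T)).comp
    (ContinuousLinearMap.inr ℝ V V))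

theorem psi_apply (T : V →L[ℝ] V) (y : V) :
    psi T y = (NormedSpace.exp (psiGenerator T) (0, y)).1 := rfl

/-- The block form of `psi` avoids any division by `T`: smoothness, intertwining and the
differential equation are all inherited from the exponential. -/
theorem contDiff_psi [CompleteSpace V] {n : WithTop ℕ∞} :
    ContDiff ℝ n (psi : (V →L[ℝ] V) → V →L[ℝ] V) := by
  have h1 : ContDiff ℝ n (NormedSpace.exp : (V × V →L[ℝ] V × V) → V × V →L[ℝ] V × V) :=
    AnalyticOnNhd.contDiff fun x _ => NormedSpace.exp_analytic x
  have h2 : ContDiff ℝ n (psiGenerator : (V →L[ℝ] V) → V × V →L[ℝ] V × V) := by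
    have e : (psiGenerator : (V →L[ℝ] V) → V × V →L[ℝ] V × V) = fun T =>
        (ContinuousLinearMap.inl ℝ V V).comp (ContinuousLinearMap.snd ℝ V V -
          T.comp (ContinuousLinearMap.fst ℝ V V)) := by
      funext T; ext z <;> simp [psiGenerator]
    rw [e]
    fun_prop
  have h3 := h1.comp h2
  unfold psi
  fun_prop

theorem psi_intertwine [CompleteSpace V] [CompleteSpace W] {S : V →L[ℝ] W} {T : V →L[ℝ] V}
    {T' : W →L[ℝ] W} (h : S.comp T = T'.comp S) (y : V) : S (psi T y) = psi T' (S y) := by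
  have h1 : (S.prodMap S).comp (psiGenerator T) = (psiGenerator T').comp (S.prodMap S) := by
    ext z
    · simp [psiGenerator_apply]
      exact congrArg (fun f => f z) h
    · simp [psiGenerator_apply]
    · simp [psiGenerator_apply]
    · simp [psiGenerator_apply]
  have h2 := exp_intertwine h1 (0, y)
  rw [psi_apply, psi_apply]
  have h3 := congrArg Prod.fst h2
  simpa using h3

/-- The flow of `psiGenerator T` keeps the second component `y` fixed and solves `x' = y - T x` in
the first one. The rescaling `(x, y) ↦ (t x, y)` intertwines `psiGenerator (t T)` with `t
psiGenerator T`, which identifies the solution vanishing at `0` with `t ψ(t T) y`. -/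
theorem hasDerivAt_smul_psi [CompleteSpace V] (T : V →L[ℝ] V) (y : V) (t : ℝ) :
    HasDerivAt (fun t : ℝ => t • psi (t • T) y) (y - T (t • psi (t • T) y)) t := by
  have hZ : ∀ t, HasDerivAt (fun t : ℝ => NormedSpace.exp (t • psiGenerator T) ((0 : V), y))
      (psiGenerator T (NormedSpace.exp (t • psiGenerator T) ((0 : V), y))) t := fun t => by
    simpa using (hasDerivAt_exp_smul_const' (𝕂 := ℝ) (psiGenerator T) t).clm_apply
      (hasDerivAt_const t ((0 : V), y))
  have h2 : ∀ t : ℝ, (NormedSpace.exp (t • psiGenerator T) ((0 : V), y)).2 = y := by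
    intro t
    have hd : ∀ t : ℝ, HasDerivAt
        (fun t : ℝ => (NormedSpace.exp (t • psiGenerator T) ((0 : V), y)).2) 0 t := fun t => by
      exact (ContinuousLinearMap.snd ℝ V V).hasFDerivAt.comp_hasDerivAt t (hZ t)
    have := is_const_of_deriv_eq_zero (fun t => (hd t).differentiableAt) (fun t => (hd t).deriv) t 0
    simpa using this
  have h1 : ∀ t : ℝ, (NormedSpace.exp (t • psiGenerator T) ((0 : V), y)).1 =
      t • psi (t • T) y := by
    intro t
    let S : V × V →L[ℝ] V × V :=
      (t • ContinuousLinearMap.fst ℝ V V).prod (ContinuousLinearMap.snd ℝ V V)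
    have hS : S.comp (psiGenerator (t • T)) = (t • psiGenerator T).comp S := by
      ext z <;> simp [psiGenerator_apply, S]
    have := congrArg Prod.fst (exp_intertwine hS (0, y))
    simpa [S, psi_apply] using this.symm
  have h3 := (ContinuousLinearMap.fst ℝ V V).hasFDerivAt.comp_hasDerivAt t (hZ t)
  simpa only [Function.comp_def, ContinuousLinearMap.coe_fst', psiGenerator_apply, h2, h1] using h3

theorem psi_eq_sum_of_pow_eq_zero [CompleteSpace V] {T : V →L[ℝ] V} {m : ℕ} (hT : T ^ m = 0) :
    psi T = ∑ k ∈ Finset.range m, ((-1 : ℝ) ^ k * ((k + 1)! : ℝ)⁻¹) • T ^ k := by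
  ext y
  have hpow : ∀ k : ℕ, (psiGenerator T ^ (k + 1)) ((0 : V), y) = ((-1 : ℝ) ^ k • (T ^ k) y, 0) := by
    intro k
    induction k with
    | zero => simp [psiGenerator_apply]
    | succ k ih =>
      rw [pow_succ', mul_apply_eq_comp, ih, psiGenerator_apply, pow_succ' T]
      simp [pow_succ]
  have hsum := (ContinuousLinearMap.apply ℝ (V × V) ((0 : V), y)).hasSum
    (NormedSpace.exp_series_hasSum_exp' (𝕂 := ℝ) (psiGenerator T))
  have hz : ∀ n ∉ Finset.range (m + 1), (ContinuousLinearMap.apply ℝ (V × V) ((0 : V), y))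
      (((n ! : ℝ)⁻¹) • psiGenerator T ^ n) = 0 := by
    intro n hn
    obtain ⟨k, rfl⟩ : ∃ k, n = m + k + 1 := ⟨n - (m + 1), by simp at hn; omega⟩
    simp [hpow, pow_add T m k, hT]
  have := hsum.unique (hasSum_sum_of_ne_finset_zero hz)
  rw [psi_apply]
  have h3 := congrArg Prod.fst this
  rw [Finset.sum_range_succ'] at h3
  simp only [ContinuousLinearMap.apply_apply] at h3
  rw [h3]
  simp [hpow, Prod.fst_sum, smul_smul, mul_comm]

theorem psi_zero [CompleteSpace V] : psi (0 : V →L[ℝ] V) = 1 := by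
  simpa using psi_eq_sum_of_pow_eq_zero (T := (0 : V →L[ℝ] V)) (m := 1) (pow_one 0)

end Psi

/-! ### The Maurer–Cartan equation in exponential coordinates. -/

section MaurerCartan

set_option maxSynthPendingDepth 3

variable {V : Type*} [NormedAddCommGroup V] [NormedSpace ℝ V] [CompleteSpace V]

theorem contDiff_psi_bracket (br : V →L[ℝ] V →L[ℝ] V) {n : WithTop ℕ∞} :
    ContDiff ℝ n fun p => psi (br p) := contDiff_psi.comp br.contDiff

/-- The Maurer–Cartan equation for the form `Ω_p = psi (ad p)`. -/
theorem maurerCartan_psi {br : V →L[ℝ] V →L[ℝ] V} (hanti : ∀ x y, br x y = -br y x)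
    (hjac : ∀ x y z, br x (br y z) = br (br x y) z + br y (br x z)) (p v w : V) :
    fderiv ℝ (fun p => psi (br p)) p v w - fderiv ℝ (fun p => psi (br p)) p w v =
      -br (psi (br p) v) (psi (br p) w) := by
  set O : V → V →L[ℝ] V := fun p => psi (br p) with hO
  have hO2 : ContDiff ℝ 2 O := contDiff_psi_bracket br
  have hOd : ∀ q, HasFDerivAt O (fderiv ℝ O q) q := fun q =>
    (hO2.differentiable (by norm_num) q).hasFDerivAt
  have hO1 : ContDiff ℝ 1 (fderiv ℝ O) := hO2.fderiv_right (by norm_num)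
  have hOdd : ∀ q, HasFDerivAt (fderiv ℝ O) (fderiv ℝ (fderiv ℝ O) q) q := fun q =>
    (hO1.differentiable (by norm_num) q).hasFDerivAt
  have hline : ∀ (p : V) (t : ℝ), HasDerivAt (fun t : ℝ => t • p) p t := fun p t => by
    simpa using (hasDerivAt_id t).smul_const p
  have hΦ : ∀ (p y : V) (t : ℝ), HasDerivAt (fun t : ℝ => t • O (t • p) y)
      (y - br p (t • O (t • p) y)) t := fun p y t => by
    simpa [hO] using hasDerivAt_smul_psi (br p) y t
  -- The derivative at `t = 1` of `t ↦ t O(t q) y` is computed by the product rule and by the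
  -- differential equation of `psi`. Differentiating the resulting identity in the direction `v`
  -- gives `hE'`.
  have hE : ∀ q y, O q y + fderiv ℝ O q q y = y - br q (O q y) := by
    intro q y
    have h1 := hΦ q y 1
    have h2 : HasDerivAt (fun t : ℝ => t • O (t • q) y)
        ((1 : ℝ) • fderiv ℝ O ((1 : ℝ) • q) q y + (1 : ℝ) • O ((1 : ℝ) • q) y) 1 := by
      have h3 : HasDerivAt (fun t : ℝ => O (t • q)) (fderiv ℝ O ((1 : ℝ) • q) q) 1 :=
        (hOd _).comp_hasDerivAt 1 (hline q 1)
      have h4 : HasDerivAt (fun t : ℝ => O (t • q) y) (fderiv ℝ O ((1 : ℝ) • q) q y) 1 := by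
        simpa using h3.clm_apply (hasDerivAt_const (1 : ℝ) y)
      exact (hasDerivAt_id (1 : ℝ)).smul h4
    have := h2.unique h1
    simp only [one_smul] at this
    rw [← this]; abel
  have hE' : ∀ q v y, (2 : ℝ) • fderiv ℝ O q v y + fderiv ℝ (fderiv ℝ O) q q v y =
      -br v (O q y) - br q (fderiv ℝ O q v y) := by
    intro q v y
    have hsymm : fderiv ℝ (fderiv ℝ O) q q v = fderiv ℝ (fderiv ℝ O) q v q :=
      (hO2.contDiffAt.isSymmSndFDerivAt (by simp)) q v
    have d0 : HasDerivAt (fun t : ℝ => q + t • v) v 0 := by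
      simpa using (hline v 0).const_add q
    have q0 : q + (0 : ℝ) • v = q := by simp
    have d1 : HasDerivAt (fun t : ℝ => O (q + t • v)) (fderiv ℝ O q v) 0 := by
      have := (hOd (q + (0 : ℝ) • v)).comp_hasDerivAt 0 d0
      rwa [q0] at this
    have d2 : HasDerivAt (fun t : ℝ => fderiv ℝ O (q + t • v)) (fderiv ℝ (fderiv ℝ O) q v) 0 := by
      have := (hOdd (q + (0 : ℝ) • v)).comp_hasDerivAt (f := fun t : ℝ => q + t • v) 0 d0
      rwa [q0] at this
    have d1y : HasDerivAt (fun t : ℝ => O (q + t • v) y) (fderiv ℝ O q v y) 0 := by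
      simpa using d1.clm_apply (hasDerivAt_const (0 : ℝ) y)
    have d2y : HasDerivAt (fun t : ℝ => fderiv ℝ O (q + t • v) (q + t • v) y)
        (fderiv ℝ (fderiv ℝ O) q v q y + fderiv ℝ O q v y) 0 := by
      simpa using (d2.clm_apply d0).clm_apply (hasDerivAt_const (0 : ℝ) y)
    have dbr : HasDerivAt (fun t : ℝ => br (q + t • v)) (br v) 0 :=
      br.hasFDerivAt.comp_hasDerivAt 0 d0
    have d3 : HasDerivAt (fun t : ℝ => y - br (q + t • v) (O (q + t • v) y))
        (-(br v (O q y) + br q (fderiv ℝ O q v y))) 0 := by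
      simpa using (dbr.clm_apply d1y).const_sub y
    have e : (fun t : ℝ => O (q + t • v) y + fderiv ℝ O (q + t • v) (q + t • v) y) =
        fun t : ℝ => y - br (q + t • v) (O (q + t • v) y) := funext fun t => hE _ _
    have d4 := d1y.add d2y
    have d4' := d4.unique (e ▸ d3 : HasDerivAt (fun t : ℝ => O (q + t • v) y +
      fderiv ℝ O (q + t • v) (q + t • v) y) _ 0)
    rw [hsymm, two_smul]
    calc _ = fderiv ℝ O q v y + (fderiv ℝ (fderiv ℝ O) q v q y + fderiv ℝ O q v y) := by abel
      _ = _ := by rw [d4']; abel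
  have hH : ∀ (v y : V) (t : ℝ), HasDerivAt (fun t : ℝ => t ^ 2 • fderiv ℝ O (t • p) v y)
      (-br v (t • O (t • p) y) - br p (t ^ 2 • fderiv ℝ O (t • p) v y)) t := by
    intro v y t
    have h3 : HasDerivAt (fun t : ℝ => fderiv ℝ O (t • p)) (fderiv ℝ (fderiv ℝ O) (t • p) p) t :=
      (hOdd (t • p)).comp_hasDerivAt (f := fun t : ℝ => t • p) t (hline p t)
    have h4 : HasDerivAt (fun t : ℝ => fderiv ℝ O (t • p) v y)
        (fderiv ℝ (fderiv ℝ O) (t • p) p v y) t := by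
      simpa using (h3.clm_apply (hasDerivAt_const t v)).clm_apply (hasDerivAt_const t y)
    have h5 : HasDerivAt (fun t : ℝ => t ^ 2) (2 * t) t := by simpa using hasDerivAt_pow 2 t
    have h6 := h5.smul h4
    refine h6.congr_deriv ?_
    have h7 := hE' (t • p) v y
    simp only [map_smul, smul_apply] at h7
    have h8 := congrArg (fun z => t • z) h7
    simp only [smul_add, smul_sub, smul_neg, smul_smul] at h8
    simp only [map_smul]
    rw [pow_two, add_comm]
    linear_combination (norm := module) h8
  -- The defect of the Maurer–Cartan equation along the ray through `p`. By the Jacobi identity it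
  -- solves the linear equation `F' = -[p, F]` with `F 0 = 0`, so it vanishes.
  set Fv : ℝ → V := fun t => t ^ 2 • fderiv ℝ O (t • p) v w - t ^ 2 • fderiv ℝ O (t • p) w v +
    br (t • O (t • p) v) (t • O (t • p) w) with hFv
  have hF : ∀ t, HasDerivAt Fv (-br p (Fv t)) t := by
    intro t
    have hb : HasDerivAt (fun t : ℝ => br (t • O (t • p) v)) (br (v - br p (t • O (t • p) v))) t :=
      br.hasFDerivAt.comp_hasDerivAt t (hΦ p v t)
    have hd := ((hH v w t).sub (hH w v t)).add (hb.clm_apply (hΦ p w t))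
    refine hd.congr_deriv ?_
    simp only [hFv]
    set a := t • O (t • p) v
    set b := t • O (t • p) w
    have j := hjac p a b
    simp only [map_add, map_sub, sub_apply, j, hanti w a]
    abel
  have hzero := norm_le_of_norm_hasDerivWithinAt_le (f := Fv) (f' := fun t => -br p (Fv t))
    (δ := 0) (K := ‖br p‖) (ε := 0) (norm_nonneg _) le_rfl
    (fun t _ => (hF t).hasDerivWithinAt) (by simp [hFv])
    (fun t _ => by rw [norm_neg, add_zero]; exact (br p).le_opNorm _)
    (right_mem_Icc.2 (zero_le_one' ℝ))
  have h0 : Fv 1 = 0 := by simpa using hzero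
  simp only [hFv, one_pow, one_smul] at h0
  exact eq_neg_of_add_eq_zero_left h0

end MaurerCartan

/-! ### The frames defined by a smooth family of Lie brackets -/

section FrameOfBracket

set_option maxSynthPendingDepth 3

open Metric

variable {V : Type*} [NormedAddCommGroup V] [NormedSpace ℝ V]
  {W : Type*} [NormedAddCommGroup W] [NormedSpace ℝ W]

theorem ContDiffOn.exists_taylor_bound {g : V → W} {U C : Set V} (hU : IsOpen U)
    (hg : ContDiffOn ℝ 2 g U) (hC : IsCompact C) (hconv : Convex ℝ C) (hCU : C ⊆ U) :
    ∃ K, 0 ≤ K ∧ (∀ x ∈ C, ‖g x‖ ≤ K) ∧ (∀ x ∈ C, ‖fderiv ℝ g x‖ ≤ K) ∧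
      (∀ x ∈ C, ∀ y ∈ C, ‖g x - g y‖ ≤ K * ‖x - y‖) ∧
      ∀ x ∈ C, ∀ y ∈ C, ‖g y - g x - fderiv ℝ g x (y - x)‖ ≤ K * ‖y - x‖ ^ 2 := by
  have hg1 : ContDiffOn ℝ 1 (fderiv ℝ g) U := hg.fderiv_of_isOpen hU (by norm_num)
  have hg2 : ContinuousOn (fderiv ℝ (fderiv ℝ g)) U :=
    hg1.continuousOn_fderiv_of_isOpen hU (by norm_num)
  obtain ⟨K₀, h₀⟩ := hC.exists_bound_of_continuousOn (hg.continuousOn.mono hCU)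
  obtain ⟨K₁, h₁⟩ := hC.exists_bound_of_continuousOn (hg1.continuousOn.mono hCU)
  obtain ⟨K₂, h₂⟩ := hC.exists_bound_of_continuousOn (hg2.mono hCU)
  have hd : ∀ x ∈ U, HasFDerivAt g (fderiv ℝ g x) x := fun x hx =>
    ((hg.differentiableOn (by norm_num)).differentiableAt (hU.mem_nhds hx)).hasFDerivAt
  have hd1 : ∀ x ∈ U, HasFDerivAt (fderiv ℝ g) (fderiv ℝ (fderiv ℝ g) x) x := fun x hx =>
    ((hg1.differentiableOn (by norm_num)).differentiableAt (hU.mem_nhds hx)).hasFDerivAt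
  set K := max 0 (max K₀ (max K₁ K₂)) with hK
  have k0 : K₀ ≤ K := by simp [hK]
  have k1 : K₁ ≤ K := by simp [hK]
  have k2 : K₂ ≤ K := by simp [hK]
  refine ⟨K, le_max_left _ _, fun x hx => (h₀ x hx).trans k0, fun x hx => (h₁ x hx).trans k1,
    fun x hx y hy => ?_, fun x hx y hy => ?_⟩
  · exact hconv.norm_image_sub_le_of_norm_hasFDerivWithin_le
      (fun z hz => (hd z (hCU hz)).hasFDerivWithinAt) (fun z hz => (h₁ z hz).trans k1) hy hx
  · have hseg : segment ℝ x y ⊆ C := hconv.segment_subset hx hy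
    have : ‖g y - g x - fderiv ℝ g x (y - x)‖ ≤ K * ‖y - x‖ * ‖y - x‖ :=
      (convex_segment x y).norm_image_sub_le_of_norm_hasFDerivWithin_le'
      (f := g) (f' := fderiv ℝ g) (C := K * ‖y - x‖)
      (fun z hz => (hd z (hCU (hseg hz))).hasFDerivWithinAt) (fun z hz => ?_)
      (left_mem_segment ℝ x y) (right_mem_segment ℝ x y)
    · calc _ ≤ K * ‖y - x‖ * ‖y - x‖ := this
        _ = _ := by ring
    · refine (hconv.norm_image_sub_le_of_norm_hasFDerivWithin_le
        (fun w hw => (hd1 w (hCU hw)).hasFDerivWithinAt) (fun w hw => (h₂ w hw).trans k2) hx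
        (hseg hz)).trans ?_
      gcongr
      exact norm_sub_le_of_mem_segment hz

/-- Taylor bounds on the compact convex set `[0, r] × ball`, read off on the slices; hence one
constant for all parameters. -/
theorem ContDiffOn.exists_slice_bound [ProperSpace V] {g : ℝ × V → W} {U : Set (ℝ × V)} (hU : IsOpen U)
    (hg : ContDiffOn ℝ 2 g U) {r R : ℝ} (hr : 0 ≤ r) (hCU : Icc 0 r ×ˢ closedBall 0 R ⊆ U) :
    ∃ K, 0 ≤ K ∧ ∀ s ∈ Icc 0 r, ∀ x, ‖x‖ ≤ R →
      ‖g (s, x)‖ ≤ K ∧ DifferentiableAt ℝ (fun x => g (s, x)) x ∧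
      ‖fderiv ℝ (fun x => g (s, x)) x‖ ≤ K ∧ ‖g (s, x) - g (0, x)‖ ≤ K * s ∧
      ∀ y, ‖y‖ ≤ R → ‖g (s, x) - g (s, y)‖ ≤ K * ‖x - y‖ ∧
        ‖g (s, y) - g (s, x) - fderiv ℝ (fun x => g (s, x)) x (y - x)‖ ≤ K * ‖y - x‖ ^ 2 := by
  have hCc : IsCompact (Icc 0 r ×ˢ closedBall (0 : V) R) :=
    isCompact_Icc.prod (isCompact_closedBall _ _)
  have hCconv : Convex ℝ (Icc 0 r ×ˢ closedBall (0 : V) R) :=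
    (convex_Icc _ _).prod (convex_closedBall _ _)
  obtain ⟨K, hK, a1, a2, a3, a4⟩ := hg.exists_taylor_bound hU hCc hCconv hCU
  have hmem : ∀ {s x}, s ∈ Icc 0 r → ‖x‖ ≤ R → ((s, x) : ℝ × V) ∈ Icc 0 r ×ˢ closedBall (0 : V) R :=
    fun hs hx => ⟨hs, by simpa using hx⟩
  refine ⟨K, hK, fun s hs x hx => ?_⟩
  have hfd : HasFDerivAt (fun x => g (s, x))
      ((fderiv ℝ g (s, x)).comp (ContinuousLinearMap.inr ℝ ℝ V)) x := by
    have h1 : HasFDerivAt g (fderiv ℝ g (s, x)) (s, x) :=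
      ((hg.differentiableOn (by norm_num)).differentiableAt
        (hU.mem_nhds (hCU (hmem hs hx)))).hasFDerivAt
    exact h1.comp x (hasFDerivAt_prodMk_right s x)
  refine ⟨a1 _ (hmem hs hx), hfd.differentiableAt, ?_, ?_, fun y hy => ⟨?_, ?_⟩⟩
  · rw [hfd.fderiv]
    refine (ContinuousLinearMap.opNorm_comp_le _ _).trans ?_
    calc _ ≤ K * 1 := by
          gcongr
          · exact a2 _ (hmem hs hx)
          · exact ContinuousLinearMap.norm_inr_le_one ℝ ℝ V
      _ = K := mul_one K
  · have h0 : (0 : ℝ) ∈ Icc 0 r := ⟨le_rfl, hr⟩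
    refine (a3 _ (hmem hs hx) _ (hmem h0 hx)).trans (le_of_eq ?_)
    have : ‖((s, x) : ℝ × V) - (0, x)‖ = s := by simp [Prod.norm_def, abs_of_nonneg hs.1, hs.1]
    rw [this]
  · refine (a3 _ (hmem hs hx) _ (hmem hs hy)).trans (le_of_eq ?_)
    have : ‖((s, x) : ℝ × V) - (s, y)‖ = ‖x - y‖ := by simp [Prod.norm_def]
    rw [this]
  · have h1 := a4 _ (hmem hs hx) _ (hmem hs hy)
    have e1 : ((s, y) : ℝ × V) - (s, x) = (0, y - x) := by simp
    have e2 : ‖((0, y - x) : ℝ × V)‖ = ‖y - x‖ := by simp [Prod.norm_def]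
    rw [e1, e2] at h1
    rw [hfd.fderiv]
    exact h1

/-- The left-invariant frame `(ad p / (1 - exp (-ad p)))` in exponential coordinates. -/
noncomputable def expFrame (br : V →L[ℝ] V →L[ℝ] V) (p : V) : V →L[ℝ] V :=
  Ring.inverse (psi (br p))

theorem expFrame_psi {br : V →L[ℝ] V →L[ℝ] V} {p : V} (h : IsUnit (psi (br p))) (v : V) :
    expFrame br p (psi (br p) v) = v := by
  have := Ring.inverse_mul_cancel _ h
  exact congrArg (fun f : V →L[ℝ] V => f v) this

theorem psi_expFrame {br : V →L[ℝ] V →L[ℝ] V} {p : V} (h : IsUnit (psi (br p))) (v : V) :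
    psi (br p) (expFrame br p v) = v := by
  have := Ring.mul_inverse_cancel _ h
  exact congrArg (fun f : V →L[ℝ] V => f v) this

theorem exists_continuousLinearEquiv_expFrame {br : V →L[ℝ] V →L[ℝ] V} {p : V}
    (h : IsUnit (psi (br p))) : ∃ e : V ≃L[ℝ] V, (e : V →L[ℝ] V) = expFrame br p ∧
      (e.symm : V →L[ℝ] V) = psi (br p) :=
  ⟨ContinuousLinearEquiv.equivOfInverse (expFrame br p) (psi (br p)) (psi_expFrame h)
    (expFrame_psi h), rfl, rfl⟩

variable [CompleteSpace V]

theorem hasFDerivAt_expFrame {br : V →L[ℝ] V →L[ℝ] V} {p : V} (h : IsUnit (psi (br p))) :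
    ∃ A' : V →L[ℝ] V →L[ℝ] V, HasFDerivAt (expFrame br) A' p ∧
      ∀ x v, A' x v = -expFrame br p (fderiv ℝ (fun p => psi (br p)) p x (expFrame br p v)) := by
  obtain ⟨u, hu⟩ := h
  have h1 := hasFDerivAt_ringInverse (𝕜 := ℝ) u
  have h2 : HasFDerivAt (fun p => psi (br p)) (fderiv ℝ (fun p => psi (br p)) p) p :=
    (((contDiff_psi_bracket br (n := 1)).differentiable (by norm_num)) p).hasFDerivAt
  rw [hu] at h1
  refine ⟨_, h1.comp p h2, fun x v => ?_⟩
  have e : expFrame br p = ((u⁻¹ : (V →L[ℝ] V)ˣ) : V →L[ℝ] V) := by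
    rw [expFrame, ← hu, Ring.inverse_unit]
  rw [e]
  simp

/-- The frame is the inverse of the form `ψ(ad p)`. The derivative of an inverse turns the
Maurer–Cartan equation, evaluated on the frame fields of `v` and `w`, into its dual. -/
theorem expFrame_structure_eq {br : V →L[ℝ] V →L[ℝ] V} (hanti : ∀ x y, br x y = -br y x)
    (hjac : ∀ x y z, br x (br y z) = br (br x y) z + br y (br x z)) {p : V}
    (h : IsUnit (psi (br p))) (v w : V) :
    fderiv ℝ (expFrame br) p (expFrame br p v) w - fderiv ℝ (expFrame br) p (expFrame br p w) v =
      expFrame br p (br v w) := by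
  obtain ⟨A', hA', hA⟩ := hasFDerivAt_expFrame h
  rw [hA'.fderiv, hA, hA]
  have := maurerCartan_psi hanti hjac p (expFrame br p v) (expFrame br p w)
  rw [psi_expFrame h, psi_expFrame h] at this
  rw [neg_sub_neg, ← neg_sub, ← map_sub, this, map_neg, neg_neg]

theorem contDiff_psi_family [FiniteDimensional ℝ V] {br : ℝ → V →L[ℝ] V →L[ℝ] V}
    (hbr : ContDiff ℝ 2 br) : ContDiff ℝ 2 fun z : ℝ × V => psi (br z.1 z.2) :=
  contDiff_psi.comp ((hbr.comp contDiff_fst).clm_apply contDiff_snd)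

theorem isOpen_isUnit_psi {br : ℝ → V →L[ℝ] V →L[ℝ] V}
    (hf : ContDiff ℝ 2 fun z : ℝ × V => psi (br z.1 z.2)) :
    IsOpen {z : ℝ × V | IsUnit (psi (br z.1 z.2))} :=
  Units.isOpen.preimage hf.continuous

theorem contDiffOn_expFrame {br : ℝ → V →L[ℝ] V →L[ℝ] V}
    (hf : ContDiff ℝ 2 fun z : ℝ × V => psi (br z.1 z.2)) :
    ContDiffOn ℝ 2 (fun z : ℝ × V => expFrame (br z.1) z.2)
      {z : ℝ × V | IsUnit (psi (br z.1 z.2))} := by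
  rintro z ⟨u, hu⟩
  have h1 : ContDiffAt ℝ 2 Ring.inverse (psi (br z.1 z.2)) := by
    rw [← hu]; exact contDiffAt_ringInverse ℝ u
  exact (h1.comp z hf.contDiffAt).contDiffWithinAt

theorem exists_tube {V : Type*} [NormedAddCommGroup V] [ProperSpace V] {U : Set (ℝ × V)}
    (hU : IsOpen U) {R : ℝ} (h : ∀ p : V, ‖p‖ ≤ R → ((0, p) : ℝ × V) ∈ U) :
    ∃ r > 0, Icc 0 r ×ˢ closedBall 0 R ⊆ U := by
  obtain ⟨u, v, hu, -, hu0, hv, huv⟩ := generalized_tube_lemma (isCompact_singleton (x := (0 : ℝ)))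
    (isCompact_closedBall (0 : V) R) hU (by
      rintro ⟨s, x⟩ ⟨hs, hx⟩
      rw [mem_singleton_iff] at hs
      subst hs
      exact h x (by simpa using hx))
  obtain ⟨r, hr, hru⟩ := Metric.isOpen_iff.1 hu 0 (hu0 rfl)
  refine ⟨r / 2, by positivity, ?_⟩
  rintro ⟨s, x⟩ ⟨hs, hx⟩
  refine huv ⟨hru ?_, hv hx⟩
  rw [mem_ball_zero_iff, Real.norm_of_nonneg hs.1]
  linarith [hs.2]

/-- Uniform bounds for the frames of a smooth family of brackets. -/
theorem exists_frameOn_expFrame [FiniteDimensional ℝ V] {br : ℝ → V →L[ℝ] V →L[ℝ] V}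
    (hbr : ContDiff ℝ 2 br)
    (hanti : ∀ s x y, br s x y = -br s y x)
    (hjac : ∀ s x y z, br s x (br s y z) = br s (br s x y) z + br s y (br s x z)) (R : ℝ)
    (hunit : ∀ p : V, ‖p‖ ≤ R → IsUnit (psi (br 0 p))) :
    ∃ s₀ > 0, ∃ K, 0 ≤ K ∧ ∀ s ∈ Icc 0 s₀,
      (∃ A', FrameOn (br s) (expFrame (br s)) A' R K) ∧
      (∀ x, ‖x‖ ≤ R → IsUnit (psi (br s x)) ∧ ‖psi (br s x)‖ ≤ K) ∧
      ∀ x, ‖x‖ ≤ R → ‖expFrame (br s) x - expFrame (br 0) x‖ ≤ K * s := by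
  have hf := contDiff_psi_family hbr
  obtain ⟨r, hr, hCU⟩ := exists_tube (isOpen_isUnit_psi hf) hunit
  obtain ⟨K₁, hK₁, a⟩ := (contDiffOn_expFrame hf).exists_slice_bound (isOpen_isUnit_psi hf) hr.le hCU
  obtain ⟨K₂, hK₂⟩ := (isCompact_Icc.prod (isCompact_closedBall _ _)).exists_bound_of_continuousOn
    (hf.continuous.continuousOn (s := Icc 0 r ×ˢ closedBall (0 : V) R))
  have hK1 : K₁ ≤ max K₁ K₂ := le_max_left _ _
  have hK0 : 0 ≤ max K₁ K₂ := hK₁.trans hK1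
  have hu : ∀ s ∈ Icc 0 r, ∀ x, ‖x‖ ≤ R → IsUnit (psi (br s x)) := by
    intro s hs x hx
    have h1 : ((s, x) : ℝ × V) ∈ Icc 0 r ×ˢ closedBall (0 : V) R := ⟨hs, by simpa using hx⟩
    have h2 := hCU h1
    rwa [mem_ofPred_eq] at h2
  refine ⟨r, hr, max K₁ K₂, hK0, fun s hs => ⟨⟨fderiv ℝ (expFrame (br s)),
    ⟨⟨hK0, fun x hx => ((a s hs x hx).1).trans hK1, fun x y hx hy => ?_⟩,
      fun x hx => ((a s hs x hx).2.1).hasFDerivAt.hasFDerivWithinAt,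
      fun x hx => ((a s hs x hx).2.2.1).trans hK1, fun x y hx hy => ?_,
      fun x hx v w => expFrame_structure_eq (hanti s) (hjac s) (hu s hs x hx) v w⟩⟩,
    fun x hx => ⟨hu s hs x hx, ?_⟩, fun x hx => ?_⟩⟩
  · exact (((a s hs x hx).2.2.2.2 y hy).1).trans (mul_le_mul_of_nonneg_right hK1 (norm_nonneg _))
  · exact (((a s hs x hx).2.2.2.2 y hy).2).trans (mul_le_mul_of_nonneg_right hK1 (by positivity))
  · exact (hK₂ (s, x) ⟨hs, by simpa using hx⟩).trans (le_max_right _ _)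
  · exact ((a s hs x hx).2.2.2.1).trans (mul_le_mul_of_nonneg_right hK1 hs.1)

end FrameOfBracket

/-! ### Filtered Lie brackets and their dilations -/

section FilteredBracket

set_option maxSynthPendingDepth 3

variable {V : Type*} [NormedAddCommGroup V] [NormedSpace ℝ V]

/-- A Lie bracket `b` with the projections `P i` of a direct sum decomposition whose associated
filtration is compatible with the bracket and generated in degree one. -/
structure FilteredBracket (n : ℕ) (b : V →L[ℝ] V →L[ℝ] V) (P : ℕ → V →L[ℝ] V) : Prop where
  anti : ∀ x y, b x y = -b y x
  jacobi : ∀ x y z, b x (b y z) = b (b x y) z + b y (b x z)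
  proj_proj : ∀ i j x, P i (P j x) = if i = j then P j x else 0
  sum_proj : ∀ x, ∑ j ∈ Finset.range (n + 1), P j x = x
  proj_zero : ∀ x, P 0 x = 0
  proj_of_lt : ∀ j x, n < j → P j x = 0
  proj_bracket : ∀ j k l x y, j + k < l → P l (b (P j x) (P k y)) = 0
  generate : ∀ i z, 1 ≤ i →
    P (i + 1) z ∈ Submodule.span ℝ {w | ∃ x y, w = P (i + 1) (b (P 1 x) (P i y))}

/-- The brackets `∑ s ^ (j + k - l) [x_j, y_k]_l`, which degenerate to a graded bracket at
`s = 0`. -/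
noncomputable def bracketFamily (n : ℕ) (b : V →L[ℝ] V →L[ℝ] V) (P : ℕ → V →L[ℝ] V) (s : ℝ) :
    V →L[ℝ] V →L[ℝ] V :=
  ∑ j ∈ Finset.range (n + 1), ∑ k ∈ Finset.range (n + 1), ∑ l ∈ Finset.range (n + 1),
    -- The subtraction is truncated for `l > j + k`, which is harmless for a filtered bracket
    -- because those components vanish. At `s = 0` the convention `0 ^ 0 = 1` keeps the terms with
    -- `l = j + k`.
    s ^ (j + k - l) • (ContinuousLinearMap.compL ℝ V V V (P l)).comp (b.bilinearComp (P j) (P k))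

/-- The dilation with weight `j` on the summand of degree `j`. -/
noncomputable def dilation (n : ℕ) (P : ℕ → V →L[ℝ] V) (s : ℝ) : V →L[ℝ] V :=
  ∑ j ∈ Finset.range (n + 1), s ^ j • P j

variable {n : ℕ} {b : V →L[ℝ] V →L[ℝ] V} {P : ℕ → V →L[ℝ] V}

theorem bracketFamily_apply (s : ℝ) (x y : V) : bracketFamily n b P s x y =
    ∑ j ∈ Finset.range (n + 1), ∑ k ∈ Finset.range (n + 1), ∑ l ∈ Finset.range (n + 1),
      s ^ (j + k - l) • P l (b (P j x) (P k y)) := by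
  simp [bracketFamily, sum_apply]

theorem dilation_apply (s : ℝ) (x : V) :
    dilation n P s x = ∑ j ∈ Finset.range (n + 1), s ^ j • P j x := by
  simp [dilation, sum_apply]

theorem contDiff_bracketFamily {m : WithTop ℕ∞} : ContDiff ℝ m (bracketFamily n b P) := by
  unfold bracketFamily
  fun_prop

theorem continuous_dilation : Continuous (dilation n P) := by
  unfold dilation
  fun_prop

namespace FilteredBracket

theorem ext (h : FilteredBracket n b P) {x y : V} (hxy : ∀ l, P l x = P l y) : x = y := by
  rw [← h.sum_proj x, ← h.sum_proj y]
  exact Finset.sum_congr rfl fun l _ => hxy l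

theorem proj_sum (h : FilteredBracket n b P) (l : ℕ) (f : ℕ → V) :
    P l (∑ j ∈ Finset.range (n + 1), P j (f j)) = P l (f l) := by
  simp only [map_sum, h.proj_proj]
  rw [Finset.sum_ite_eq]
  split_ifs with hl
  · rfl
  · rw [h.proj_of_lt]
    simpa using hl

theorem proj_dilation (h : FilteredBracket n b P) (s : ℝ) (l : ℕ) (x : V) :
    P l (dilation n P s x) = s ^ l • P l x := by
  have : dilation n P s x = ∑ j ∈ Finset.range (n + 1), P j (s ^ j • x) := by
    simp [dilation_apply]
  rw [this, h.proj_sum, map_smul]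

theorem proj_bracketFamily (h : FilteredBracket n b P) (s : ℝ) (l : ℕ) (x y : V) :
    P l (bracketFamily n b P s x y) = ∑ j ∈ Finset.range (n + 1), ∑ k ∈ Finset.range (n + 1),
      s ^ (j + k - l) • P l (b (P j x) (P k y)) := by
  rw [bracketFamily_apply]
  simp only [map_sum]
  refine Finset.sum_congr rfl fun j _ => Finset.sum_congr rfl fun k _ => ?_
  have := h.proj_sum l fun l => s ^ (j + k - l) • b (P j x) (P k y)
  simp only [map_sum, map_smul] at this
  simpa using this

/-- On the component of degree `l` coming from degrees `j` and `k`, both sides carry `s ^ (j + k -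
l) t ^ (j + k)`. For `s = 1` this says that the bracket at `t` is the pullback of `b` by the
dilation; for `s = 0`, that dilations respect the limit bracket. -/
theorem dilation_bracketFamily (h : FilteredBracket n b P) (s t : ℝ) (x y : V) :
    dilation n P t (bracketFamily n b P (s * t) x y) =
      bracketFamily n b P s (dilation n P t x) (dilation n P t y) := by
  refine h.ext fun l => ?_
  rw [h.proj_dilation, h.proj_bracketFamily, h.proj_bracketFamily, Finset.smul_sum]
  refine Finset.sum_congr rfl fun j _ => ?_
  rw [Finset.smul_sum]
  refine Finset.sum_congr rfl fun k _ => ?_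
  rw [h.proj_dilation, h.proj_dilation]
  simp only [map_smul, smul_apply, smul_smul]
  rcases lt_or_ge (j + k) l with hl | hl
  · simp [h.proj_bracket j k l x y hl]
  · congr 1
    obtain ⟨m, hm⟩ := Nat.exists_eq_add_of_le hl
    rw [hm, Nat.add_sub_cancel_left, mul_pow]
    have : t ^ j * t ^ k = t ^ l * t ^ m := by rw [← pow_add, ← pow_add, hm]
    calc _ = s ^ m * (t ^ l * t ^ m) := by ring
      _ = _ := by rw [← this]; ring

theorem bracketFamily_one (h : FilteredBracket n b P) : bracketFamily n b P 1 = b := by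
  ext x y
  refine h.ext fun l => ?_
  rw [h.proj_bracketFamily]
  conv_rhs => rw [← h.sum_proj x, ← h.sum_proj y]
  simp only [map_sum, sum_apply, one_pow, one_smul]
  exact Finset.sum_comm

theorem dilation_bracketFamily_one (h : FilteredBracket n b P) (s : ℝ) (x y : V) :
    dilation n P s (bracketFamily n b P s x y) = b (dilation n P s x) (dilation n P s y) := by
  have := h.dilation_bracketFamily 1 s x y
  rwa [one_mul, h.bracketFamily_one] at this

theorem dilation_bracketFamily_zero (h : FilteredBracket n b P) (t : ℝ) (x y : V) :
    dilation n P t (bracketFamily n b P 0 x y) =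
      bracketFamily n b P 0 (dilation n P t x) (dilation n P t y) := by
  simpa using h.dilation_bracketFamily 0 t x y

theorem dilation_dilation (h : FilteredBracket n b P) (s t : ℝ) (x : V) :
    dilation n P s (dilation n P t x) = dilation n P (s * t) x := by
  refine h.ext fun l => ?_
  simp only [h.proj_dilation, smul_smul, mul_pow]

theorem dilation_one (h : FilteredBracket n b P) (x : V) : dilation n P 1 x = x :=
  h.ext fun l => by simp [h.proj_dilation]

theorem dilation_inv_dilation (h : FilteredBracket n b P) {s : ℝ} (hs : s ≠ 0) (x : V) :
    dilation n P s⁻¹ (dilation n P s x) = x := by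
  rw [h.dilation_dilation, inv_mul_cancel₀ hs, h.dilation_one]

theorem dilation_dilation_inv (h : FilteredBracket n b P) {s : ℝ} (hs : s ≠ 0) (x : V) :
    dilation n P s (dilation n P s⁻¹ x) = x := by
  rw [h.dilation_dilation, mul_inv_cancel₀ hs, h.dilation_one]

theorem dilation_of_degree_one (h : FilteredBracket n b P) (s : ℝ) {x : V} (hx : P 1 x = x) :
    dilation n P s x = s • x := by
  refine h.ext fun l => ?_
  rw [h.proj_dilation, ← hx, map_smul, h.proj_proj]
  split_ifs with hl
  · simp [hl]
  · simp

theorem norm_dilation_le (h : FilteredBracket n b P) :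
    ∃ K, 0 ≤ K ∧ ∀ s ∈ Icc (0 : ℝ) 1, ∀ x, ‖dilation n P s x‖ ≤ K * s * ‖x‖ := by
  refine ⟨∑ j ∈ Finset.range (n + 1), ‖P j‖, by positivity, fun s hs x => ?_⟩
  rw [dilation_apply, Finset.sum_mul, Finset.sum_mul]
  refine norm_sum_le_of_le _ fun j _ => ?_
  rcases Nat.eq_zero_or_pos j with rfl | hj
  · simpa [h.proj_zero] using mul_nonneg (mul_nonneg (norm_nonneg (P 0)) hs.1) (norm_nonneg x)
  · rw [norm_smul, norm_pow, Real.norm_of_nonneg hs.1]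
    calc s ^ j * ‖P j x‖ ≤ s ^ 1 * (‖P j‖ * ‖x‖) := by
          exact mul_le_mul (pow_le_pow_of_le_one hs.1 hs.2 hj) ((P j).le_opNorm x)
            (norm_nonneg _) (pow_nonneg hs.1 1)
      _ = _ := by ring

theorem bracketFamily_anti (h : FilteredBracket n b P) (s : ℝ) (x y : V) :
    bracketFamily n b P s x y = -bracketFamily n b P s y x := by
  refine h.ext fun l => ?_
  rw [map_neg, h.proj_bracketFamily, h.proj_bracketFamily, Finset.sum_comm,
    ← Finset.sum_neg_distrib]
  refine Finset.sum_congr rfl fun j _ => ?_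
  rw [← Finset.sum_neg_distrib]
  refine Finset.sum_congr rfl fun k _ => ?_
  rw [h.anti, map_neg, smul_neg, add_comm j k]

/-- For `s ≠ 0` the bracket is conjugate to `b` by a dilation, so the identity is inherited. Both
sides are continuous in `s`, which gives the case `s = 0`. -/
theorem bracketFamily_jacobi (h : FilteredBracket n b P) (s : ℝ) (x y z : V) :
    bracketFamily n b P s x (bracketFamily n b P s y z) =
      bracketFamily n b P s (bracketFamily n b P s x y) z +
        bracketFamily n b P s y (bracketFamily n b P s x z) := by
  have hc : Continuous (bracketFamily n b P) := (contDiff_bracketFamily (m := 0)).continuous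
  have key : EqOn (fun s => bracketFamily n b P s x (bracketFamily n b P s y z))
      (fun s => bracketFamily n b P s (bracketFamily n b P s x y) z +
        bracketFamily n b P s y (bracketFamily n b P s x z)) {0}ᶜ := by
    intro s hs
    have hs : s ≠ 0 := hs
    have := congrArg (dilation n P s⁻¹)
      (h.jacobi (dilation n P s x) (dilation n P s y) (dilation n P s z))
    simp only [← h.dilation_bracketFamily_one, map_add, h.dilation_inv_dilation hs] at this
    exact this
  have h2 := Continuous.ext_on (dense_compl_singleton (0 : ℝ)) (by fun_prop) (by fun_prop) key
  exact congrFun h2 s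

/-- There is no summand of degree `0`, so the adjoint map of the graded bracket raises the degree by
at least one, and no degree exceeds `n`. -/
theorem bracketFamily_zero_pow (h : FilteredBracket n b P) (p : V) :
    bracketFamily n b P 0 p ^ n = 0 := by
  have key : ∀ m x, ∀ l ≤ m, P l ((bracketFamily n b P 0 p ^ m) x) = 0 := by
    intro m
    induction m with
    | zero =>
      intro x l hl
      obtain rfl : l = 0 := by omega
      exact h.proj_zero _
    | succ m ih =>
      intro x l hl
      rw [pow_succ', mul_apply_eq_comp, h.proj_bracketFamily]
      refine Finset.sum_eq_zero fun j _ => Finset.sum_eq_zero fun k _ => ?_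
      rcases Nat.eq_zero_or_pos j with rfl | hj
      · simp [h.proj_zero]
      rcases le_or_gt k m with hk | hk
      · rw [ih x k hk, map_zero, map_zero, smul_zero]
      · rcases lt_or_ge l (j + k) with hl2 | hl2
        · simp [(Nat.sub_pos_of_lt hl2).ne']
        · omega
  ext x
  refine h.ext fun l => ?_
  rcases le_or_gt l n with hl | hl
  · rw [key n x l hl]; simp
  · rw [h.proj_of_lt _ _ hl, h.proj_of_lt _ _ hl]

theorem isUnit_psi_zero [CompleteSpace V] (h : FilteredBracket n b P) (p : V) :
    IsUnit (psi (bracketFamily n b P 0 p)) := by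
  rw [psi_eq_sum_of_pow_eq_zero (m := n + 1) (by rw [pow_succ, h.bracketFamily_zero_pow, zero_mul]),
    Finset.sum_range_succ']
  simp only [pow_zero, zero_add, Nat.factorial_one, Nat.cast_one, inv_one, mul_one, one_smul]
  refine IsNilpotent.isUnit_add_one ⟨n, ?_⟩
  have e : (∑ k ∈ Finset.range n, ((-1 : ℝ) ^ (k + 1) * ((k + 1 + 1)! : ℝ)⁻¹) •
      bracketFamily n b P 0 p ^ (k + 1)) = bracketFamily n b P 0 p *
      ∑ k ∈ Finset.range n, ((-1 : ℝ) ^ (k + 1) * ((k + 1 + 1)! : ℝ)⁻¹) •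
        bracketFamily n b P 0 p ^ k := by
    rw [Finset.mul_sum]
    refine Finset.sum_congr rfl fun k _ => ?_
    rw [mul_smul_comm]
    congr 1
    exact pow_succ' _ _
  rw [e, Commute.mul_pow, h.bracketFamily_zero_pow, zero_mul]
  refine Commute.sum_right _ _ _ fun k _ => ?_
  exact ((Commute.refl _).pow_right k).smul_right _

variable [FiniteDimensional ℝ V] {F : Type*} [NormedAddCommGroup F] [NormedSpace ℝ F]

/-- The span is stable under `exp (ad a)` by construction. Being closed, it is also stable under `ad
a`, the derivative of `exp (t ad a)` at `t = 0`. It contains degree one, and generation in degree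
one then yields all degrees. -/
theorem span_conjWord (h : FilteredBracket n b P) {ι : F →L[ℝ] V} (hι : ∀ x, ∃ u, P 1 x = ι u) :
    Submodule.span ℝ {z | ∃ l u, z = conjWord (bracketFamily n b P 0) ι l u} = ⊤ := by
  have : CompleteSpace V := FiniteDimensional.complete ℝ V
  set S := Submodule.span ℝ {z | ∃ l u, z = conjWord (bracketFamily n b P 0) ι l u} with hS
  have hexp : ∀ a, ∀ z ∈ S, NormedSpace.exp (bracketFamily n b P 0 (ι a)) z ∈ S := by
    intro a z hz
    induction hz using Submodule.span_induction with
    | mem z hz =>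
      obtain ⟨l, u, rfl⟩ := hz
      exact Submodule.subset_span ⟨a :: l, u, rfl⟩
    | zero => simp
    | add x y _ _ hx hy => rw [map_add]; exact S.add_mem hx hy
    | smul c x _ hx => rw [map_smul]; exact S.smul_mem c hx
  have had : ∀ a, ∀ z ∈ S, bracketFamily n b P 0 (ι a) z ∈ S := by
    intro a z hz
    have hd : HasDerivAt (fun t : ℝ => NormedSpace.exp (t • bracketFamily n b P 0 (ι a)) z)
        (bracketFamily n b P 0 (ι a) z) 0 := by
      simpa using (hasDerivAt_exp_smul_const' (𝕂 := ℝ) (bracketFamily n b P 0 (ι a))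
        (0 : ℝ)).clm_apply (hasDerivAt_const (0 : ℝ) z)
    refine S.closed_of_finiteDimensional.mem_of_tendsto hd.tendsto_slope (Eventually.of_forall
      fun t => ?_)
    rw [slope_def_module]
    refine S.smul_mem _ (S.sub_mem ?_ (by simpa using hz))
    have := hexp (t • a) z hz
    simpa using this
  have hW : ∀ i z, P (i + 1) z ∈ S := by
    intro i
    induction i with
    | zero =>
      intro z
      obtain ⟨u, hu⟩ := hι z
      rw [zero_add, hu]
      exact Submodule.subset_span ⟨[], u, rfl⟩
    | succ i ih =>
      intro z
      refine Submodule.span_le.2 ?_ (h.generate (i + 1) z (by omega))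
      rintro w ⟨x, y, rfl⟩
      obtain ⟨u, hu⟩ := hι x
      have h1 := had u _ (ih y)
      suffices hb : P (i + 1 + 1) (b (P 1 x) (P (i + 1) y)) =
          bracketFamily n b P 0 (ι u) (P (i + 1) y) by
        rw [hb]; exact h1
      refine h.ext fun l => ?_
      rw [h.proj_bracketFamily, h.proj_proj, ← hu]
      simp only [h.proj_proj]
      rw [Finset.sum_eq_single 1, Finset.sum_eq_single (i + 1)]
      · simp only [if_true]
        split_ifs with hl
        · subst hl; simp [add_comm]
        · rcases lt_or_ge (1 + (i + 1)) l with hl2 | hl2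
          · simp [h.proj_bracket _ _ _ x y hl2]
          · have : 1 + (i + 1) - l ≠ 0 := by omega
            simp [this]
      · intro k _ hk
        simp [hk]
      · intro hk
        rw [if_pos rfl, h.proj_of_lt _ y]
        · simp
        · simpa using hk
      · intro j _ hj
        simp [hj]
      · intro hk
        refine Finset.sum_eq_zero fun k _ => ?_
        rw [if_pos rfl, h.proj_of_lt _ x]
        · simp
        · simpa using hk
  rw [eq_top_iff]
  intro z _
  rw [← h.sum_proj z]
  refine S.sum_mem fun j _ => ?_
  cases j with
  | zero => rw [h.proj_zero]; exact S.zero_mem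
  | succ j => exact hW j z

theorem dilation_conjWord (h : FilteredBracket n b P) {ι : F →L[ℝ] V} (hι1 : ∀ u, P 1 (ι u) = ι u)
    (t : ℝ) (l : List F) (u : F) :
    conjWord (bracketFamily n b P 0) ι (l.map fun a => t • a) (t • u) =
      dilation n P t (conjWord (bracketFamily n b P 0) ι l u) := by
  have : CompleteSpace V := FiniteDimensional.complete ℝ V
  induction l with
  | nil => simp [conjWord, h.dilation_of_degree_one t (hι1 u)]
  | cons a l ih =>
    simp only [List.map_cons, conjWord]
    rw [ih]
    refine (exp_intertwine ?_ _).symm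
    ext y
    simp only [ContinuousLinearMap.comp_apply]
    rw [h.dilation_bracketFamily_zero, h.dilation_of_degree_one t (hι1 a), map_smul ι]

/-- A basis is extracted from the spanning words. Applying the dilation by a small `t`, an
automorphism of the limit bracket, keeps it a basis and multiplies every letter by `t`. -/
theorem exists_basis_conjWord (h : FilteredBracket n b P) {ι : F →L[ℝ] V}
    (hι1 : ∀ u, P 1 (ι u) = ι u) (hι : ∀ x, ∃ u, P 1 x = ι u) {ε : ℝ} (hε : 0 < ε) :
    ∃ (e : Basis (Fin (finrank ℝ V)) ℝ V) (l : Fin (finrank ℝ V) → List F)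
    (u : Fin (finrank ℝ V) → F), (∀ i, conjWord (bracketFamily n b P 0) ι (l i) (u i) = e i) ∧
    ∀ i, ‖u i‖ + ((l i).map fun a => 2 * ‖a‖).sum ≤ ε := by
  have hs := (h.span_conjWord hι).ge
  have hb := Basis.ofSpan_subset hs
  set e₀ := Basis.ofSpan hs
  let e₁ := e₀.reindex (Fintype.equivFinOfCardEq (finrank_eq_card_basis e₀).symm)
  have he₁ : ∀ i, ∃ l u, e₁ i = conjWord (bracketFamily n b P 0) ι l u := fun i =>
    hb ⟨_, (e₀.reindex_apply _ i).symm⟩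
  choose l u hlu using he₁
  set C : ℝ := ∑ i, (‖u i‖ + ((l i).map fun a => 2 * ‖a‖).sum) with hC
  have hnn : ∀ i, 0 ≤ ‖u i‖ + ((l i).map fun a => 2 * ‖a‖).sum := fun i =>
    add_nonneg (norm_nonneg _) (List.sum_nonneg (by
      intro x hx
      obtain ⟨a, -, rfl⟩ := List.mem_map.1 hx
      positivity))
  have hC0 : 0 ≤ C := Finset.sum_nonneg fun i _ => hnn i
  have ht : 0 < ε / (C + 1) := by positivity
  set t := ε / (C + 1) with ht_def
  let δ : V ≃ₗ[ℝ] V := LinearEquiv.ofLinearMap (dilation n P t).toLinearMap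
    (dilation n P t⁻¹).toLinearMap (by ext x; exact h.dilation_dilation_inv ht.ne' x)
    (by ext x; exact h.dilation_inv_dilation ht.ne' x)
  refine ⟨e₁.map δ, fun i => (l i).map fun a => t • a, fun i => t • u i, fun i => ?_, fun i => ?_⟩
  · rw [h.dilation_conjWord hι1, ← hlu, Basis.map_apply]
    rfl
  · rw [List.map_map]
    have e : ((fun a : F => 2 * ‖a‖) ∘ fun a => t • a) = fun a => t * (2 * ‖a‖) := by
      ext a
      simp [norm_smul, abs_of_pos ht]
      ring
    rw [e, List.sum_map_mul_left, norm_smul, Real.norm_of_nonneg ht.le, ← mul_add]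
    have h1 : ‖u i‖ + ((l i).map fun a => 2 * ‖a‖).sum ≤ C :=
      Finset.single_le_sum (f := fun i => ‖u i‖ + ((l i).map fun a => 2 * ‖a‖).sum)
        (fun i _ => hnn i) (Finset.mem_univ i)
    calc _ ≤ t * (C + 1) := mul_le_mul_of_nonneg_left (by linarith) ht.le
      _ = ε := by rw [ht_def]; field_simp

end FilteredBracket

end FilteredBracket

/-! ### The filtered bracket of an adapted grading -/

section Grading

variable {L : Type*} [LieRing L] [LieAlgebra ℝ L] {D : Submodule ℝ L}

theorem bracketFiltration_mono : Monotone (bracketFiltration D) := by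
  refine monotone_nat_of_le_succ fun i => ?_
  cases i with
  | zero => exact bot_le
  | succ i => exact le_sup_left

/-- Induction on `i` by the Jacobi identity `[[a, c], y] = [a, [c, y]] - [c, [a, y]]`; both terms
bracket with `D` once and with a shorter element once. -/
theorem lie_mem_bracketFiltration {i j : ℕ} {x y : L} (hx : x ∈ bracketFiltration D i)
    (hy : y ∈ bracketFiltration D j) : ⁅x, y⁆ ∈ bracketFiltration D (i + j) := by
  have h1 : ∀ j x y, x ∈ D → y ∈ bracketFiltration D j → ⁅x, y⁆ ∈ bracketFiltration D (1 + j) := by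
    intro j x y hx hy
    cases j with
    | zero =>
      have : y = 0 := by simpa [bracketFiltration] using hy
      simp [this]
    | succ j =>
      rw [show 1 + (j + 1) = j + 2 by ring]
      exact Submodule.mem_sup_right (Submodule.subset_span ⟨x, hx, y, hy, rfl⟩)
  induction i using Nat.strong_induction_on generalizing j x y with
  | _ i ih =>
    match i, hx with
    | 0, hx =>
      have : x = 0 := by simpa [bracketFiltration] using hx
      simp [this]
    | 1, hx => exact h1 j x y hx hy
    | i + 2, hx =>
      obtain ⟨x₁, hx₁, x₂, hx₂, rfl⟩ := Submodule.mem_sup.1 hx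
      rw [add_lie]
      refine Submodule.add_mem _ (bracketFiltration_mono (by omega)
        (ih (i + 1) (by omega) hx₁ hy)) ?_
      suffices H : ∀ u ∈ Submodule.span ℝ {z | ∃ x ∈ D, ∃ y ∈ bracketFiltration D (i + 1), z = ⁅x, y⁆},
          ⁅u, y⁆ ∈ bracketFiltration D (i + 2 + j) from H x₂ hx₂
      intro u hu
      induction hu using Submodule.span_induction with
      | mem z hz =>
        obtain ⟨a, ha, c, hc, rfl⟩ := hz
        rw [lie_lie]
        refine Submodule.sub_mem _ ?_ ?_
        · rw [show i + 2 + j = 1 + (i + 1 + j) by ring]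
          exact h1 _ _ _ ha (ih (i + 1) (by omega) hc hy)
        · rw [show i + 2 + j = i + 1 + (1 + j) by ring]
          exact ih (i + 1) (by omega) hc (h1 _ _ _ ha hy)
      | zero => simp
      | add u v _ _ hu hv => rw [add_lie]; exact Submodule.add_mem _ hu hv
      | smul c u _ hu => rw [smul_lie]; exact Submodule.smul_mem _ _ hu

namespace AdaptedGrading

variable (𝒲 : AdaptedGrading D)

theorem proj_mem (i : ℕ) (x : L) : 𝒲.proj i x ∈ 𝒲.W i := by
  simp [proj]

theorem proj_of_mem {i j : ℕ} {x : L} (hx : x ∈ 𝒲.W j) : 𝒲.proj i x = if i = j then x else 0 := by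
  have h : (LinearEquiv.ofBijective (DirectSum.coeLinearMap 𝒲.W) 𝒲.bijective).symm x =
      DirectSum.lof ℝ ℕ (fun j => 𝒲.W j) j ⟨x, hx⟩ := by
    rw [LinearEquiv.symm_apply_eq]
    simp
  simp only [proj, LinearMap.comp_apply, LinearEquiv.coe_coe, h]
  rw [DirectSum.component.of]
  split_ifs with h1 h2 h2
  · subst h1; rfl
  · exact absurd h1.symm h2
  · exact absurd h2.symm h1
  · simp

theorem W_le (i : ℕ) : 𝒲.W i ≤ bracketFiltration D i := by
  rw [← 𝒲.filtration]
  exact le_iSup₂_of_le i le_rfl le_rfl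

theorem filtration_succ (i : ℕ) :
    bracketFiltration D (i + 1) = bracketFiltration D i ⊔ 𝒲.W (i + 1) := by
  refine le_antisymm ?_ (sup_le (bracketFiltration_mono (Nat.le_succ i)) (𝒲.W_le _))
  rw [← 𝒲.filtration (i + 1)]
  refine iSup₂_le fun j hj => ?_
  rcases Nat.lt_or_ge j (i + 1) with h | h
  · exact (𝒲.W_le j).trans ((bracketFiltration_mono (Nat.lt_succ_iff.1 h)).trans le_sup_left)
  · obtain rfl : j = i + 1 := le_antisymm hj h
    exact le_sup_right

theorem proj_of_mem_filtration {i l : ℕ} (hil : i < l) {x : L} (hx : x ∈ bracketFiltration D i) :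
    𝒲.proj l x = 0 := by
  rw [← LinearMap.mem_ker]
  refine (?_ : bracketFiltration D i ≤ _) hx
  rw [← 𝒲.filtration]
  refine iSup₂_le fun j hj y hy => ?_
  rw [LinearMap.mem_ker, 𝒲.proj_of_mem hy, if_neg (by omega)]

theorem sub_proj_mem {i : ℕ} {x : L} (hx : x ∈ bracketFiltration D (i + 1)) :
    x - 𝒲.proj (i + 1) x ∈ bracketFiltration D i := by
  rw [𝒲.filtration_succ] at hx
  obtain ⟨y, hy, z, hz, rfl⟩ := Submodule.mem_sup.1 hx
  rw [map_add, 𝒲.proj_of_mem_filtration (Nat.lt_succ_self i) hy, 𝒲.proj_of_mem hz, if_pos rfl]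
  simpa using hy

theorem W_zero : 𝒲.W 0 = ⊥ := le_bot_iff.1 (𝒲.W_le 0)

theorem W_one : 𝒲.W 1 = D := by
  have := 𝒲.filtration_succ 0
  simpa [bracketFiltration] using this.symm

/-- Each step of the filtration determines the next one, so once stationary it remains so. -/
theorem W_succ_eq_bot {i : ℕ} (hi : 1 ≤ i) (h : 𝒲.W i = ⊥) : 𝒲.W (i + 1) = ⊥ := by
  obtain ⟨i, rfl⟩ := Nat.exists_eq_add_of_le' hi
  have h1 : bracketFiltration D (i + 1) = bracketFiltration D i := by
    rw [𝒲.filtration_succ, h, sup_bot_eq]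
  have h2 : bracketFiltration D (i + 2) = bracketFiltration D (i + 1) := by
    refine le_antisymm ?_ (bracketFiltration_mono (Nat.le_succ _))
    refine sup_le le_rfl (Submodule.span_le.2 ?_)
    rintro z ⟨x, hx, y, hy, rfl⟩
    rw [h1] at hy
    have := lie_mem_bracketFiltration (i := 1) hx hy
    rwa [add_comm] at this
  rw [eq_bot_iff]
  intro x hx
  have h3 : x ∈ bracketFiltration D (i + 1) := h2 ▸ 𝒲.W_le _ hx
  have h4 := 𝒲.proj_of_mem_filtration (Nat.lt_succ_self (i + 1)) h3
  rw [𝒲.proj_of_mem hx, if_pos rfl] at h4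
  simp [h4]

/-- The summands are nonzero up to some degree and zero afterwards, apart from degree `0`.
Independent nonzero subspaces number at most `dim L`. This justifies truncating the sums over
degrees at `finrank ℝ L`. -/
theorem W_eq_bot_of_lt [FiniteDimensional ℝ L] {j : ℕ} (hj : finrank ℝ L < j) : 𝒲.W j = ⊥ := by
  by_contra hne
  have hbot : ∀ i, 1 ≤ i → i ≤ j → 𝒲.W i = ⊥ → 𝒲.W j = ⊥ := by
    intro i h1 h2 hbot
    induction j, h2 using Nat.le_induction with
    | base => exact hbot
    | succ m hm ih =>
      refine 𝒲.W_succ_eq_bot (h1.trans hm) ?_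
      by_contra hm0
      exact hm0 (by
        clear ih hj hne hm0
        induction m, hm using Nat.le_induction with
        | base => exact hbot
        | succ m hm ih => exact 𝒲.W_succ_eq_bot (h1.trans hm) ih)
  have hfin := 𝒲.isInternal.submodule_iSupIndep
  have : Fintype {i // 𝒲.W i ≠ ⊥} := hfin.fintypeNeBotOfFiniteDimensional
  have hcard := hfin.subtype_ne_bot_le_finrank
  have h2 : Fintype.card (Fin j) ≤ Fintype.card {i // 𝒲.W i ≠ ⊥} :=
    Fintype.card_le_of_injective
      (fun i : Fin j => (⟨i.1 + 1, fun h => hne (hbot _ (by omega) (by omega) h)⟩ : {i // 𝒲.W i ≠ ⊥}))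
      (fun a c h => by
        have := congrArg Subtype.val h
        exact Fin.ext (by simpa using this))
  rw [Fintype.card_fin] at h2
  omega

theorem sum_proj [FiniteDimensional ℝ L] (x : L) :
    ∑ j ∈ Finset.range (finrank ℝ L + 1), 𝒲.proj j x = x := by
  have hx : x ∈ ⨆ i, 𝒲.W i := by
    rw [𝒲.isInternal.submodule_iSup_eq_top]; trivial
  induction hx using Submodule.iSup_induction' with
  | mem i x hx =>
    rcases le_or_gt i (finrank ℝ L) with h | h
    · rw [Finset.sum_eq_single i]
      · rw [𝒲.proj_of_mem hx, if_pos rfl]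
      · intro j _ hj
        rw [𝒲.proj_of_mem hx, if_neg hj]
      · intro hi
        exact absurd (Finset.mem_range.2 (Nat.lt_succ_of_le h)) hi
    · rw [𝒲.W_eq_bot_of_lt h, Submodule.mem_bot] at hx
      simp [hx]
  | zero => simp
  | add x y _ _ hx hy => simp only [map_add, Finset.sum_add_distrib, hx, hy]

/-- In a bracket `[x, y]` with `x ∈ D` and `y ∈ Vⁱ`, replacing `y` by its top component changes the
bracket by an element of `Vⁱ`, which the projection to degree `i + 1` kills. -/
theorem proj_succ_mem_span {i : ℕ} (hi : 1 ≤ i) (z : L) : 𝒲.proj (i + 1) z ∈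
    Submodule.span ℝ {w | ∃ x y, w = 𝒲.proj (i + 1) ⁅𝒲.proj 1 x, 𝒲.proj i y⁆} := by
  obtain ⟨i, rfl⟩ := Nat.exists_eq_add_of_le' hi
  suffices H : bracketFiltration D (i + 2) ≤ (Submodule.span ℝ
      {w | ∃ x y, w = 𝒲.proj (i + 2) ⁅𝒲.proj 1 x, 𝒲.proj (i + 1) y⁆}).comap (𝒲.proj (i + 2)) by
    have h1 := H (𝒲.W_le _ (𝒲.proj_mem (i + 2) z))
    rw [Submodule.mem_comap, 𝒲.proj_of_mem (𝒲.proj_mem (i + 2) z), if_pos rfl] at h1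
    exact h1
  refine sup_le (fun v hv => ?_) (Submodule.span_le.2 ?_)
  · rw [Submodule.mem_comap, 𝒲.proj_of_mem_filtration (Nat.lt_succ_self _) hv]
    exact Submodule.zero_mem _
  · rintro w ⟨x, hx, y, hy, rfl⟩
    refine Submodule.subset_span ⟨x, y, ?_⟩
    have hx1 : 𝒲.proj 1 x = x := by
      rw [𝒲.proj_of_mem (j := 1) (by rwa [𝒲.W_one]), if_pos rfl]
    rw [hx1]
    have h1 := lie_mem_bracketFiltration (i := 1) hx (𝒲.sub_proj_mem hy)
    have h2 := 𝒲.proj_of_mem_filtration (show 1 + i < i + 2 by omega) h1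
    rw [lie_sub, map_sub] at h2
    exact sub_eq_zero.1 h2

theorem proj_bracket {j k l : ℕ} (h : j + k < l) (x y : L) :
    𝒲.proj l ⁅𝒲.proj j x, 𝒲.proj k y⁆ = 0 :=
  𝒲.proj_of_mem_filtration h (lie_mem_bracketFiltration (𝒲.W_le _ (𝒲.proj_mem j x))
    (𝒲.W_le _ (𝒲.proj_mem k y)))

variable {E : Type*} [NormedAddCommGroup E] [NormedSpace ℝ E]
  [FiniteDimensional ℝ E]

/-- The Lie bracket of `L`, transported to a normed space. -/
noncomputable def _root_.normedBracket (e : L ≃ₗ[ℝ] E) : E →L[ℝ] E →L[ℝ] E :=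
  LinearMap.toContinuousLinearMap (LinearMap.toContinuousLinearMap.toLinearMap ∘ₗ
    (((LieAlgebra.ad ℝ L : L →ₗ[ℝ] L →ₗ[ℝ] L).compl₁₂ e.symm.toLinearMap
      e.symm.toLinearMap).compr₂ e.toLinearMap))

/-- The projections of an adapted grading, transported to a normed space. -/
noncomputable def normedProj (e : L ≃ₗ[ℝ] E) (i : ℕ) : E →L[ℝ] E :=
  LinearMap.toContinuousLinearMap (e.toLinearMap ∘ₗ 𝒲.proj i ∘ₗ e.symm.toLinearMap)

theorem _root_.normedBracket_apply (e : L ≃ₗ[ℝ] E) (x y : E) :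
    normedBracket e x y = e ⁅e.symm x, e.symm y⁆ := rfl

theorem normedProj_apply (e : L ≃ₗ[ℝ] E) (i : ℕ) (x : E) :
    𝒲.normedProj e i x = e (𝒲.proj i (e.symm x)) := rfl

variable [FiniteDimensional ℝ L]

theorem filteredBracket (e : L ≃ₗ[ℝ] E) :
    FilteredBracket (finrank ℝ L) (normedBracket e) (𝒲.normedProj e) where
  anti x y := by
    rw [normedBracket_apply, normedBracket_apply, ← lie_skew, map_neg]
  jacobi x y z := by
    simp only [normedBracket_apply, LinearEquiv.symm_apply_apply, ← map_add]
    rw [leibniz_lie]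
  proj_proj i j x := by
    simp only [normedProj_apply, LinearEquiv.symm_apply_apply]
    rw [𝒲.proj_of_mem (𝒲.proj_mem j _)]
    split_ifs <;> simp
  sum_proj x := by
    simp only [normedProj_apply]
    rw [← map_sum, 𝒲.sum_proj, LinearEquiv.apply_symm_apply]
  proj_zero x := by
    have := 𝒲.proj_mem 0 (e.symm x)
    rw [𝒲.W_zero, Submodule.mem_bot] at this
    rw [normedProj_apply, this, map_zero]
  proj_of_lt j x hj := by
    have := 𝒲.proj_mem j (e.symm x)
    rw [𝒲.W_eq_bot_of_lt hj, Submodule.mem_bot] at this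
    rw [normedProj_apply, this, map_zero]
  proj_bracket j k l x y h := by
    simp only [normedBracket_apply, normedProj_apply, LinearEquiv.symm_apply_apply]
    rw [𝒲.proj_bracket h, map_zero]
  generate i z hi := by
    have h := Submodule.mem_map_of_mem (f := e.toLinearMap) (𝒲.proj_succ_mem_span hi (e.symm z))
    rw [Submodule.map_span] at h
    refine Submodule.span_mono ?_ h
    rintro _ ⟨_, ⟨x, y, rfl⟩, rfl⟩
    refine ⟨e x, e y, ?_⟩
    simp [normedBracket_apply, normedProj_apply]

/-- For `l < j + k` the power of `s = 0` vanishes, and for `l > j + k` the component does; only `l =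
j + k` survives. -/
theorem bracketFamily_zero (e : L ≃ₗ[ℝ] E) (x y : E) :
    bracketFamily (finrank ℝ L) (normedBracket e) (𝒲.normedProj e) 0 x y =
      e (𝒲.nilBracket (e.symm x) (e.symm y)) := by
  have h := 𝒲.filteredBracket e
  rw [bracketFamily_apply, nilBracket]
  simp only [LinearMap.sum_apply, map_sum]
  refine Finset.sum_congr rfl fun j _ => Finset.sum_congr rfl fun k _ => ?_
  have h2 : e ((((LieAlgebra.ad ℝ L : L →ₗ[ℝ] L →ₗ[ℝ] L).compl₁₂ (𝒲.proj j) (𝒲.proj k)).compr₂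
      (𝒲.proj (j + k))) (e.symm x) (e.symm y)) = 𝒲.normedProj e (j + k)
        (normedBracket e (𝒲.normedProj e j x) (𝒲.normedProj e k y)) := by
    simp [normedBracket_apply, normedProj_apply]
  rw [h2, Finset.sum_eq_single (j + k)]
  · simp
  · intro l _ hl
    rcases lt_or_gt_of_ne hl with hl | hl
    · rw [zero_pow (by omega), zero_smul]
    · rw [h.proj_bracket _ _ _ _ _ hl, smul_zero]
  · intro hl
    rw [h.proj_of_lt _ _ (by simpa using hl), smul_zero]

end AdaptedGrading

end Grading

/-! ### Left translations in the Baker–Campbell–Hausdorff group -/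

section BakerCampbellHausdorff

open Polynomial in
theorem Polynomial.X_pow_succ_dvd_of_derivative {p : ℝ[X]} {n : ℕ} (h : X ^ n ∣ derivative p)
    (h0 : p.coeff 0 = 0) : X ^ (n + 1) ∣ p := by
  rw [X_pow_dvd_iff] at h ⊢
  intro d hd
  cases d with
  | zero => exact h0
  | succ d =>
    have := h d (by omega)
    rw [coeff_derivative] at this
    exact (mul_eq_zero.1 this).resolve_right (by positivity)

-- As power series, `P = exp X`, `L = X / (exp X - 1)` and `S = (1 - exp (-X)) / X`, whose product
-- is `1`. For the truncations, `P X S = P - 1` and `L (P - 1) = X` hold modulo `X ^ (n + 1)`, as is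
-- seen by differentiating; combining them and cancelling one factor `X` leaves an identity modulo
-- `X ^ n`.
open Polynomial in
theorem Polynomial.exists_bchKernel_mul_psi (n : ℕ) {P L S : ℝ[X]}
    (hP : P = ∑ k ∈ Finset.range (n + 1), ((k ! : ℝ)⁻¹) • X ^ k)
    (hL : L = ∑ k ∈ Finset.range (n + 1), ((-1 : ℝ) ^ k / (k + 1)) • (P - 1) ^ k)
    (hS : S = ∑ k ∈ Finset.range n, ((-1 : ℝ) ^ k * ((k + 1)! : ℝ)⁻¹) • X ^ k) :
    X ^ n ∣ P * L * S - 1 := by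
  have hfac : ∀ k : ℕ, ((k + 1)! : ℝ)⁻¹ * (k + 1) = (k ! : ℝ)⁻¹ := by
    intro k
    rw [Nat.factorial_succ]
    push_cast
    field_simp
  have hX : ∀ (c : ℝ) (k : ℕ), c • (C (((k + 1 : ℕ) : ℝ)) * X ^ (k + 1 - 1) : ℝ[X]) =
      (c * (k + 1)) • X ^ k := by
    intro c k
    rw [Nat.add_sub_cancel, ← smul_eq_C_mul, smul_smul]
    push_cast
    rfl
  have hP' : derivative P = P - ((n ! : ℝ)⁻¹) • X ^ n := by
    have e : derivative P = ∑ k ∈ Finset.range n, ((k ! : ℝ)⁻¹) • X ^ k := by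
      rw [hP, Finset.sum_range_succ', derivative_add, derivative_sum]
      simp only [pow_zero, derivative_smul, derivative_one, smul_zero, add_zero]
      refine Finset.sum_congr rfl fun k _ => ?_
      rw [derivative_X_pow, hX, hfac]
    rw [e, hP, Finset.sum_range_succ _ n, add_sub_cancel_right]
  set M : ℝ[X] := ∑ k ∈ Finset.range n, ((-1 : ℝ) ^ k * (k ! : ℝ)⁻¹) • X ^ k with hM
  have hS' : derivative (X * S) = M := by
    rw [hS, Finset.mul_sum, derivative_sum]
    refine Finset.sum_congr rfl fun k _ => ?_
    rw [mul_smul_comm, ← pow_succ', derivative_smul, derivative_X_pow, hX, ← hfac k, mul_assoc]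
  have hXS : X * S = 1 - M - ((-1 : ℝ) ^ n * (n ! : ℝ)⁻¹) • X ^ n := by
    rw [sub_sub, hM, ← Finset.sum_range_succ, Finset.sum_range_succ', hS, Finset.mul_sum]
    simp only [pow_zero, Nat.factorial_zero, Nat.cast_one, inv_one, mul_one, one_smul]
    rw [add_comm, sub_add_eq_sub_sub, sub_self, zero_sub, ← Finset.sum_neg_distrib]
    refine Finset.sum_congr rfl fun k _ => ?_
    rw [mul_smul_comm, ← pow_succ', ← neg_smul]
    congr 1
    ring
  have hXP : X ∣ P - 1 := by
    rw [X_dvd_iff, hP]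
    simp [Finset.sum_range_succ', coeff_X_pow]
  have h1 : X ^ (n + 1) ∣ P * (X * S) - (P - 1) := by
    refine X_pow_succ_dvd_of_derivative ⟨?_, ?_⟩ ?_
    · exact -(((n ! : ℝ)⁻¹) • (X * S)) - ((-1 : ℝ) ^ n * (n ! : ℝ)⁻¹) • P + C ((n ! : ℝ)⁻¹)
    · rw [derivative_sub, derivative_mul, hS', derivative_sub, derivative_one, hP']
      have : M = 1 - X * S - ((-1 : ℝ) ^ n * (n ! : ℝ)⁻¹) • X ^ n := by rw [hXS]; ring
      rw [this]
      simp only [smul_eq_C_mul]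
      ring
    · rw [X_dvd_iff] at hXP
      rw [coeff_sub, hXP]
      simp
  have h2 : X ^ (n + 1) ∣ L * (P - 1) - X := by
    have hLd : derivative (L * (P - 1)) =
        (∑ k ∈ Finset.range (n + 1), (-(P - 1)) ^ k) * derivative P := by
      rw [hL, Finset.sum_mul, derivative_sum, Finset.sum_mul]
      refine Finset.sum_congr rfl fun k _ => ?_
      rw [smul_mul_assoc, ← pow_succ, derivative_smul, derivative_pow, derivative_sub,
        derivative_one, sub_zero, neg_pow (P - 1), Nat.add_sub_cancel, smul_eq_C_mul]
      have : (C ((-1 : ℝ) ^ k / (k + 1)) * C (((k + 1 : ℕ) : ℝ)) : ℝ[X]) = (-1) ^ k := by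
        rw [← C_mul]
        push_cast
        rw [div_mul_cancel₀ _ (by positivity)]
        simp
      rw [← this]
      ring
    have hgeom : (∑ k ∈ Finset.range (n + 1), (-(P - 1)) ^ k) * P = 1 - (-(P - 1)) ^ (n + 1) := by
      have := mul_neg_geom_sum (-(P - 1)) (n + 1)
      rw [← this]
      ring
    obtain ⟨J, hJ⟩ := hXP
    refine X_pow_succ_dvd_of_derivative ?_ ?_
    · rw [derivative_sub, hLd, derivative_X, hP', mul_sub, hgeom]
      have e : (-(P - 1)) ^ (n + 1) = X ^ n * (X * (-J) ^ (n + 1)) := by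
        rw [hJ, ← mul_neg, mul_pow]; ring
      rw [e]
      refine ⟨-(X * (-J) ^ (n + 1)) - (∑ k ∈ Finset.range (n + 1), (-(P - 1)) ^ k) *
        C ((n ! : ℝ)⁻¹), ?_⟩
      rw [smul_eq_C_mul]
      ring
    · rw [hJ]
      simp
  have h3 : X ^ (n + 1) ∣ X * (P * L * S - 1) := by
    have : X * (P * L * S - 1) = L * (P * (X * S) - (P - 1)) + (L * (P - 1) - X) := by ring
    rw [this]
    exact dvd_add (h1.mul_left L) h2
  rw [pow_succ'] at h3
  exact (mul_dvd_mul_iff_left X_ne_zero).1 h3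

variable {V : Type*} [NormedAddCommGroup V] [NormedSpace ℝ V]

/-- `nilExp` for continuous linear maps. -/
noncomputable def nilExpL (T : V →L[ℝ] V) : V →L[ℝ] V :=
  ∑ k ∈ Finset.range (finrank ℝ V + 1), ((k ! : ℝ)⁻¹) • T ^ k

/-- `bchKernel` for continuous linear maps. -/
noncomputable def bchKernelL (P : V →L[ℝ] V) : V →L[ℝ] V :=
  P * ∑ k ∈ Finset.range (finrank ℝ V + 1), ((-1 : ℝ) ^ k / (k + 1)) • (P - 1) ^ k

theorem continuous_nilExpL : Continuous (nilExpL : (V →L[ℝ] V) → V →L[ℝ] V) := by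
  unfold nilExpL
  fun_prop

theorem continuous_bchKernelL : Continuous (bchKernelL : (V →L[ℝ] V) → V →L[ℝ] V) := by
  unfold bchKernelL
  fun_prop

theorem nilExpL_zero : nilExpL (0 : V →L[ℝ] V) = 1 := by
  simp [nilExpL, Finset.sum_range_succ']

theorem bchKernelL_nilExpL [CompleteSpace V] {T : V →L[ℝ] V} (hT : T ^ finrank ℝ V = 0) :
    Ring.inverse (psi T) = bchKernelL (nilExpL T) := by
  set n := finrank ℝ V with hn
  obtain ⟨q, hq⟩ := Polynomial.exists_bchKernel_mul_psi n rfl rfl rfl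
  set P : Polynomial ℝ := ∑ k ∈ Finset.range (n + 1), ((k ! : ℝ)⁻¹) • Polynomial.X ^ k
  set L : Polynomial ℝ := ∑ k ∈ Finset.range (n + 1), ((-1 : ℝ) ^ k / (k + 1)) • (P - 1) ^ k with hL
  set S : Polynomial ℝ := ∑ k ∈ Finset.range n, ((-1 : ℝ) ^ k * ((k + 1)! : ℝ)⁻¹) • Polynomial.X ^ k
  have hP : Polynomial.aeval T P = nilExpL T := by simp [P, nilExpL, ← hn]
  have hPL : Polynomial.aeval T (P * L) = bchKernelL (nilExpL T) := by
    rw [map_mul, hP, hL, map_sum, bchKernelL]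
    simp only [map_smul, map_pow, map_sub, hP, map_one, ← hn]
  have hS : Polynomial.aeval T S = psi T := by
    rw [psi_eq_sum_of_pow_eq_zero hT]
    simp [S]
  have h := congrArg (Polynomial.aeval T) hq
  have h1 : Polynomial.aeval T (P * L * S) = 1 := by
    rw [map_sub, map_one, map_mul (Polynomial.aeval T) (Polynomial.X ^ n), map_pow,
      Polynomial.aeval_X, hT, zero_mul] at h
    exact sub_eq_zero.1 h
  have h2 := h1
  rw [mul_comm, map_mul, hS, hPL] at h1
  rw [map_mul, hS, hPL] at h2
  exact Ring.inverse_unit ⟨psi T, bchKernelL (nilExpL T), h1, h2⟩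

/-- The integrand is `H (t, y) y`, with an explicit linear factor `y`. Hence continuity of `H`
suffices, uniformly in `t` by the tube lemma, and the derivative at `0` is `H (t, 0)`. This does not
depend on `t` and is the inverse of `ψ(ad p)` by the polynomial identity. -/
theorem hasFDerivAt_bchMul [FiniteDimensional ℝ V] {br : V →L[ℝ] V →L[ℝ] V} {p : V}
    (hn : br p ^ finrank ℝ V = 0) {br' : V →ₗ[ℝ] V →ₗ[ℝ] V} (h : ∀ x y, br' x y = br x y) :
    HasFDerivAt (bchMul br' p) (expFrame br p) 0 := by
  have : CompleteSpace V := FiniteDimensional.complete ℝ V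
  let Q := Module.End.toContinuousLinearMap (𝕜 := ℝ) V
  have hQ : ∀ (T : Module.End ℝ V) y, Q T y = T y := fun T y => rfl
  have hbr : ∀ x, Q (br' x) = br x := fun x => by ext y; exact h x y
  have hexp : ∀ T, Q (nilExp T) = nilExpL (Q T) := fun T => by
    simp [nilExp, nilExpL, map_sum, map_smul, map_pow]
  have hker : ∀ T, Q (bchKernel T) = bchKernelL (Q T) := fun T => by
    simp [bchKernel, bchKernelL, map_sum, map_smul, map_pow]
  let H : ℝ × V → V →L[ℝ] V := fun z => bchKernelL (nilExpL (br p) * nilExpL (z.1 • br z.2))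
  have hH : Continuous H := continuous_bchKernelL.comp (continuous_const.mul
    (continuous_nilExpL.comp (continuous_fst.smul (br.continuous.comp continuous_snd))))
  have hH0 : ∀ t, H (t, 0) = expFrame br p := fun t => by
    simp only [H, map_zero, smul_zero, nilExpL_zero, mul_one]
    exact (bchKernelL_nilExpL hn).symm
  have hmul : ∀ y, bchMul br' p y = p + ∫ t in (0 : ℝ)..1, H (t, y) y := fun y => by
    rw [bchMul]
    congr 2
    ext t
    rw [← hQ, hker, map_mul, hexp, hexp, map_smul, hbr, hbr]
  rw [hasFDerivAt_iff_isLittleO_nhds_zero, Asymptotics.isLittleO_iff]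
  intro ε hε
  obtain ⟨u, v, hu, hv, hu0, hv0, huv⟩ := generalized_tube_lemma (isCompact_Icc (a := (0 : ℝ)) (b := 1))
    (isCompact_singleton (x := (0 : V))) (hH.isOpen_preimage _ (Metric.isOpen_ball (x := expFrame br p)
      (ε := ε))) (by
        rintro ⟨t, y⟩ ⟨-, hy⟩
        rw [mem_singleton_iff] at hy
        subst hy
        rw [mem_preimage, hH0]
        exact Metric.mem_ball_self hε)
  filter_upwards [hv.mem_nhds (hv0 rfl)] with y hy
  have hint : IntervalIntegrable (fun t => H (t, y) y) volume 0 1 :=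
    Continuous.intervalIntegrable (by fun_prop) _ _
  have e : bchMul br' p (0 + y) - bchMul br' p 0 - expFrame br p y =
      ∫ t in (0 : ℝ)..1, (H (t, y) - expFrame br p) y := by
    simp only [sub_apply]
    rw [intervalIntegral.integral_sub hint (by simp), hmul, hmul]
    simp
  rw [e]
  refine (intervalIntegral.norm_integral_le_of_norm_le_const (C := ε * ‖y‖) fun t ht => ?_).trans
    (by simp)
  rw [uIoc_of_le zero_le_one] at ht
  refine (ContinuousLinearMap.le_opNorm _ _).trans ?_
  gcongr
  have := huv (show ((t, y) : ℝ × V) ∈ u ×ˢ v from ⟨hu0 (Ioc_subset_Icc_self ht), hy⟩)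
  rw [mem_preimage, mem_ball_iff_norm] at this
  exact this.le

end BakerCampbellHausdorff

/-! ### Absolutely continuous functions on intervals -/

namespace AbsolutelyContinuousOnInterval

theorem congr {X : Type*} [PseudoMetricSpace X] {f g : ℝ → X} {a b : ℝ}
    (hf : AbsolutelyContinuousOnInterval f a b) (h : EqOn f g (uIcc a b)) :
    AbsolutelyContinuousOnInterval g a b := by
  refine Tendsto.congr' ?_ hf
  rw [EventuallyEq, eventually_inf_principal]
  refine Eventually.of_forall fun e he => Finset.sum_congr rfl fun i hi => ?_
  rw [h (he.1 i hi).1, h (he.1 i hi).2]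

/-- Together with `eq_integral` this characterises absolute continuity by an integral formula, which
is easier to shift, reflect and concatenate than the definition. -/
theorem of_eq_integral {f g : ℝ → ℝ} {a b : ℝ} (hab : a ≤ b) (hg : IntervalIntegrable g volume a b)
    (h : ∀ t ∈ Icc a b, f t = f a + ∫ s in a..t, g s) : AbsolutelyContinuousOnInterval f a b := by
  have h1 := hg.absolutelyContinuousOnInterval_intervalIntegral (c := a) (by simp)
  have h2 : AbsolutelyContinuousOnInterval (fun _ : ℝ => f a) a b :=
    ((LipschitzWith.const (f a)).lipschitzOnWith (s := uIcc a b)).absolutelyContinuousOnInterval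
  refine (h2.add h1).congr fun t ht => ?_
  rw [uIcc_of_le hab] at ht
  rw [h t ht]
  rfl

theorem eq_integral {f : ℝ → ℝ} {a b : ℝ} (hf : AbsolutelyContinuousOnInterval f a b) {s t : ℝ}
    (hs : s ∈ uIcc a b) (ht : t ∈ uIcc a b) : f t = f s + ∫ τ in s..t, deriv f τ := by
  rw [(hf.mono (uIcc_subset_uIcc hs ht)).integral_deriv_eq_sub]
  ring

theorem comp_add_right {f : ℝ → ℝ} {a b : ℝ} (hab : a ≤ b)
    (hf : AbsolutelyContinuousOnInterval f a b) (k : ℝ) :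
    AbsolutelyContinuousOnInterval (fun t => f (t + k)) (a - k) (b - k) := by
  refine of_eq_integral (g := fun t => deriv f (t + k)) (by linarith)
    (hf.intervalIntegrable_deriv.comp_add_right k) fun t ht => ?_
  rw [intervalIntegral.integral_comp_add_right, sub_add_cancel]
  refine hf.eq_integral left_mem_uIcc ?_
  rw [uIcc_of_le hab]
  exact ⟨by linarith [ht.1], by linarith [ht.2]⟩

theorem comp_sub_left {f : ℝ → ℝ} {a b : ℝ} (hab : a ≤ b)
    (hf : AbsolutelyContinuousOnInterval f a b) (k : ℝ) :
    AbsolutelyContinuousOnInterval (fun t => f (k - t)) (k - b) (k - a) := by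
  refine of_eq_integral (g := fun t => -deriv f (k - t)) (by linarith)
    (hf.intervalIntegrable_deriv.comp_sub_left k).symm.neg fun t ht => ?_
  rw [intervalIntegral.integral_neg, intervalIntegral.integral_comp_sub_left (fun t => deriv f t),
    sub_sub_cancel, ← intervalIntegral.integral_symm]
  refine hf.eq_integral right_mem_uIcc ?_
  rw [uIcc_of_le hab]
  exact ⟨by linarith [ht.2], by linarith [ht.1]⟩

theorem trans {f : ℝ → ℝ} {a b c : ℝ} (hab : a ≤ b) (hbc : b ≤ c)
    (h₁ : AbsolutelyContinuousOnInterval f a b) (h₂ : AbsolutelyContinuousOnInterval f b c) :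
    AbsolutelyContinuousOnInterval f a c := by
  refine of_eq_integral (g := deriv f) (hab.trans hbc)
    (h₁.intervalIntegrable_deriv.trans h₂.intervalIntegrable_deriv) fun t ht => ?_
  rcases le_total t b with h | h
  · exact h₁.eq_integral left_mem_uIcc (by rw [uIcc_of_le hab]; exact ⟨ht.1, h⟩)
  · have ht2 : t ∈ uIcc b c := by rw [uIcc_of_le hbc]; exact ⟨h, ht.2⟩
    rw [← intervalIntegral.integral_add_adjacent_intervals h₁.intervalIntegrable_deriv
      (h₂.intervalIntegrable_deriv.mono_set (uIcc_subset_uIcc left_mem_uIcc ht2)), ← add_assoc,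
      ← h₁.eq_integral left_mem_uIcc right_mem_uIcc]
    exact h₂.eq_integral left_mem_uIcc ht2

theorem eq_integral_of_hasDerivAt {f g : ℝ → ℝ} {a b : ℝ} (hab : a ≤ b)
    (hf : AbsolutelyContinuousOnInterval f a b)
    (hg : ∀ᵐ t ∂(volume.restrict (Ioo a b)), HasDerivAt f (g t) t) {t : ℝ} (ht : t ∈ Icc a b) :
    f t = f a + ∫ s in a..t, g s := by
  rw [hf.eq_integral left_mem_uIcc (by rwa [uIcc_of_le hab])]
  congr 1
  rw [intervalIntegral.integral_of_le ht.1, intervalIntegral.integral_of_le ht.1]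
  refine integral_congr_ae ?_
  have h1 := ae_restrict_of_ae_restrict_of_subset (Ioo_subset_Ioo_right ht.2) hg
  rw [restrict_Ioo_eq_restrict_Ioc] at h1
  filter_upwards [h1] with s hs
  exact hs.deriv

end AbsolutelyContinuousOnInterval

/-! ### Carnot–Carathéodory distances in general -/

section CCDistance

variable {E : Type*} [NormedAddCommGroup E] [NormedSpace ℝ E] {H : Type*} [TopologicalSpace H]
  {I : ModelWithCorners ℝ E H} {M : Type*} [TopologicalSpace M] [ChartedSpace H M] {F : Type*}

theorem ccEDist_lt_iff {X : ∀ p : M, F → TangentSpace I p} {N : F → ℝ} {p q : M} {l : ℝ≥0∞} :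
    ccEDist I X N p q < l ↔ ∃ (c : ℝ → M) (u : ℝ → F) (a b : ℝ), a ≤ b ∧
      IsHorizontalCurve I X c u a b ∧ c a = p ∧ c b = q ∧
      ∫⁻ t in Icc a b, ENNReal.ofReal (N (u t)) < l := by
  simp only [ccEDist, iInf_lt_iff, exists_prop]

theorem ccEDist_le {X : ∀ p : M, F → TangentSpace I p} {N : F → ℝ} {c : ℝ → M} {u : ℝ → F}
    {a b : ℝ} (hab : a ≤ b) (h : IsHorizontalCurve I X c u a b) :
    ccEDist I X N (c a) (c b) ≤ ∫⁻ t in Icc a b, ENNReal.ofReal (N (u t)) := by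
  refine le_of_forall_gt fun l hl => ?_
  exact ccEDist_lt_iff.2 ⟨c, u, a, b, hab, h, rfl, rfl, hl⟩

theorem hasMFDerivAt_comp_smulRight {c : ℝ → M} {h : ℝ → ℝ} {k t : ℝ}
    {v : TangentSpace I (c (h t))}
    (hc : HasMFDerivAt 𝓘(ℝ, ℝ) I c (h t) ((1 : ℝ →L[ℝ] ℝ).smulRight v)) (hh : HasDerivAt h k t) :
    HasMFDerivAt 𝓘(ℝ, ℝ) I (fun s => c (h s)) t ((1 : ℝ →L[ℝ] ℝ).smulRight (k • v)) := by
  have h1 := HasMFDerivAt.comp t hc hh.hasFDerivAt.hasMFDerivAt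
  refine h1.congr_mfderiv ?_
  refine ContinuousLinearMap.ext fun r => ?_
  exact (smul_smul (show ℝ from r) k (show E from v)).symm

theorem IsHorizontalCurve.comp_add_right {X : ∀ p : M, F → TangentSpace I p} {c : ℝ → M}
    {u : ℝ → F} {a b : ℝ} (hab : a ≤ b) (h : IsHorizontalCurve I X c u a b) (k : ℝ) :
    IsHorizontalCurve I X (fun t => c (t + k)) (fun t => u (t + k)) (a - k) (b - k) where
  continuousOn := h.continuousOn.comp (by fun_prop) fun t ht =>
    ⟨by linarith [ht.1], by linarith [ht.2]⟩
  absolutelyContinuous f hf := (h.absolutelyContinuous f hf).comp_add_right hab k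
  hasMFDerivAt := by
    have h1 := (ae_restrict_iff' measurableSet_Ioo).1 h.hasMFDerivAt
    have h2 := (measurePreserving_add_right volume k).quasiMeasurePreserving.ae h1
    rw [ae_restrict_iff' measurableSet_Ioo]
    filter_upwards [h2] with t ht hm
    have := hasMFDerivAt_comp_smulRight (h := fun t => t + k)
      (ht ⟨by linarith [hm.1], by linarith [hm.2]⟩) ((hasDerivAt_id t).add_const k)
    rwa [one_smul] at this

theorem IsHorizontalCurve.comp_sub_left [AddCommGroup F] {X : ∀ p : M, F → TangentSpace I p}
    (hX : ∀ p v, X p (-v) = -X p v) {c : ℝ → M}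
    {u : ℝ → F} {a b : ℝ} (hab : a ≤ b) (h : IsHorizontalCurve I X c u a b) (k : ℝ) :
    IsHorizontalCurve I X (fun t => c (k - t)) (fun t => -u (k - t)) (k - b) (k - a) where
  continuousOn := h.continuousOn.comp (by fun_prop) fun t ht =>
    ⟨by linarith [ht.2], by linarith [ht.1]⟩
  absolutelyContinuous f hf := (h.absolutelyContinuous f hf).comp_sub_left hab k
  hasMFDerivAt := by
    have h1 := (ae_restrict_iff' measurableSet_Ioo).1 h.hasMFDerivAt
    have h2 := (Measure.measurePreserving_sub_left volume k).quasiMeasurePreserving.ae h1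
    rw [ae_restrict_iff' measurableSet_Ioo]
    filter_upwards [h2] with t ht hm
    have := hasMFDerivAt_comp_smulRight (h := fun t => k - t)
      (ht ⟨by linarith [hm.2], by linarith [hm.1]⟩) ((hasDerivAt_id t).const_sub k)
    rwa [neg_smul, one_smul, ← hX] at this

theorem ccEDist_comm [AddCommGroup F] {X : ∀ p : M, F → TangentSpace I p}
    (hX : ∀ p v, X p (-v) = -X p v) {N : F → ℝ} (hN : ∀ v, N (-v) = N v) (p q : M) :
    ccEDist I X N p q = ccEDist I X N q p := by
  suffices H : ∀ p q, ccEDist I X N q p ≤ ccEDist I X N p q from le_antisymm (H q p) (H p q)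
  intro p q
  refine le_of_forall_gt fun l hl => ?_
  obtain ⟨c, u, a, b, hab, h, rfl, rfl, hlt⟩ := ccEDist_lt_iff.1 hl
  refine ccEDist_lt_iff.2 ⟨_, _, (a + b) - b, (a + b) - a, by linarith, h.comp_sub_left hX hab (a + b),
    by simp, by simp, ?_⟩
  simp only [hN]
  have := (Measure.measurePreserving_sub_left volume (a + b)).setLIntegral_comp_preimage_emb
    (MeasurableEquiv.subLeft (a + b)).measurableEmbedding (fun t => ENNReal.ofReal (N (u t))) (Icc a b)
  rw [Set.preimage_const_sub_Icc] at this
  rwa [this]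

theorem _root_.HasMFDerivAt.smulRight_congr {X : ∀ p : M, F → TangentSpace I p} {c : ℝ → M} {t : ℝ}
    {p q : M} {v w : F}
    (h : HasMFDerivAt 𝓘(ℝ, ℝ) I c t (show ℝ →L[ℝ] E from (1 : ℝ →L[ℝ] ℝ).smulRight (show E from X p v)))
    (hq : q = p) (hw : w = v) :
    HasMFDerivAt 𝓘(ℝ, ℝ) I c t
      (show ℝ →L[ℝ] E from (1 : ℝ →L[ℝ] ℝ).smulRight (show E from X q w)) := by
  subst hq hw
  exact h

theorem IsHorizontalCurve.trans {X : ∀ p : M, F → TangentSpace I p} {c c' : ℝ → M}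
    {u u' : ℝ → F} {a b d : ℝ} (hab : a ≤ b) (hbd : b ≤ d) (h : IsHorizontalCurve I X c u a b)
    (h' : IsHorizontalCurve I X c' u' b d) (hb : c b = c' b) :
    IsHorizontalCurve I X (fun t => if t ≤ b then c t else c' t)
      (fun t => if t ≤ b then u t else u' t) a d := by
  have e1 : EqOn c (fun t => if t ≤ b then c t else c' t) (Icc a b) := fun t ht =>
    (if_pos ht.2).symm
  have e2 : EqOn c' (fun t => if t ≤ b then c t else c' t) (Icc b d) := fun t ht => by
    rcases ht.1.eq_or_lt with rfl | h
    · simp [hb]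
    · simp [not_le.2 h]
  refine ⟨?_, fun f hf => ?_, ?_⟩
  · rw [← Icc_union_Icc_eq_Icc hab hbd]
    exact (h.continuousOn.congr e1.symm).union_of_isClosed (h'.continuousOn.congr e2.symm)
      isClosed_Icc isClosed_Icc
  · refine ((h.absolutelyContinuous f hf).congr fun t ht => ?_).trans hab hbd
      ((h'.absolutelyContinuous f hf).congr fun t ht => ?_)
    · rw [uIcc_of_le hab] at ht
      exact congrArg f (e1 ht)
    · rw [uIcc_of_le hbd] at ht
      exact congrArg f (e2 ht)
  · have h1 := (ae_restrict_iff' measurableSet_Ioo).1 h.hasMFDerivAt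
    have h2 := (ae_restrict_iff' measurableSet_Ioo).1 h'.hasMFDerivAt
    have h3 : ∀ᵐ t : ℝ, t ≠ b := by simp [ae_iff]
    rw [ae_restrict_iff' measurableSet_Ioo]
    filter_upwards [h1, h2, h3] with t ht1 ht2 ht3 ht
    rcases lt_or_gt_of_ne ht3 with htb | htb
    · have e : (fun t => if t ≤ b then c t else c' t) =ᶠ[𝓝 t] c := by
        filter_upwards [Iio_mem_nhds htb] with s hs
        exact if_pos (le_of_lt hs)
      exact ((ht1 ⟨ht.1, htb⟩).congr_of_eventuallyEq e).smulRight_congr (if_pos htb.le)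
        (if_pos htb.le)
    · have e : (fun t => if t ≤ b then c t else c' t) =ᶠ[𝓝 t] c' := by
        filter_upwards [Ioi_mem_nhds htb] with s hs
        exact if_neg (not_le.2 hs)
      exact ((ht2 ⟨htb, ht.2⟩).congr_of_eventuallyEq e).smulRight_congr (if_neg (not_le.2 htb))
        (if_neg (not_le.2 htb))

theorem ccEDist_triangle {X : ∀ p : M, F → TangentSpace I p} {N : F → ℝ} (p q r : M) :
    ccEDist I X N p r ≤ ccEDist I X N p q + ccEDist I X N q r := by
  rcases eq_or_ne (ccEDist I X N p q + ccEDist I X N q r) ⊤ with htop | htop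
  · rw [htop]; exact le_top
  obtain ⟨h1, h2⟩ := ENNReal.add_ne_top.1 htop
  refine ENNReal.le_of_forall_pos_le_add fun ε hε _ => ?_
  have hε2 : (ε / 2 : ℝ≥0∞) ≠ 0 := by simpa using hε.ne'
  obtain ⟨c, u, a, b, hab, h, rfl, rfl, hlt⟩ := ccEDist_lt_iff.1 (ENNReal.lt_add_right h1 hε2)
  obtain ⟨c', u', a', b', hab', h', ha', rfl, hlt'⟩ := ccEDist_lt_iff.1
    (ENNReal.lt_add_right h2 hε2)
  have h'' := h'.comp_add_right hab' (a' - b)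
  rw [sub_sub_cancel] at h''
  have hbd : b ≤ b' - (a' - b) := by linarith
  have h3 := ccEDist_le (N := N) (hab.trans hbd) (h.trans hab hbd h'' (by simp [ha']))
  have h4 := (measurePreserving_add_right volume (a' - b)).setLIntegral_comp_preimage_emb
    (measurableEmbedding_addRight (a' - b)) (fun t => ENNReal.ofReal (N (u' t))) (Icc a' b')
  rw [Set.preimage_add_const_Icc, sub_sub_cancel] at h4
  -- The first branch occurs at the final time only when the second curve lives on a single point.
  have e1 : (if b' - (a' - b) ≤ b then c (b' - (a' - b)) else c' (b' - (a' - b) + (a' - b))) = c' b' := by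
    split_ifs with hle
    · have : b' = a' := by linarith
      subst this
      simp [ha']
    · simp
  simp only [if_pos hab, e1] at h3
  refine h3.trans ?_
  have hsub : Icc a (b' - (a' - b)) ⊆ Icc a b ∪ Ioc b (b' - (a' - b)) := fun t ht => by
    rcases le_or_gt t b with h | h
    · exact Or.inl ⟨ht.1, h⟩
    · exact Or.inr ⟨h, ht.2⟩
  refine (lintegral_mono_set hsub).trans ((lintegral_union_le _ _ _).trans ?_)
  have i1 : ∫⁻ t in Icc a b, ENNReal.ofReal (N (if t ≤ b then u t else u' (t + (a' - b)))) =
      ∫⁻ t in Icc a b, ENNReal.ofReal (N (u t)) :=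
    setLIntegral_congr_fun measurableSet_Icc fun t ht => by simp only [if_pos ht.2]
  have i2 : ∫⁻ t in Ioc b (b' - (a' - b)), ENNReal.ofReal
      (N (if t ≤ b then u t else u' (t + (a' - b)))) ≤ ∫⁻ t in Icc a' b', ENNReal.ofReal (N (u' t)) := by
    rw [← h4]
    refine le_of_eq_of_le (setLIntegral_congr_fun measurableSet_Ioc fun t ht => ?_)
      (lintegral_mono_set Ioc_subset_Icc_self)
    simp only [if_neg (not_le.2 ht.1)]
  rw [i1]
  calc _ ≤ (ccEDist I X N (c a) (c b) + ε / 2) + (ccEDist I X N (c b) (c' b') + ε / 2) :=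
        add_le_add hlt.le (i2.trans hlt'.le)
    _ = _ := by
        rw [add_add_add_comm, ENNReal.add_halves]

end CCDistance

/-! ### Horizontal curves and control curves -/

section HorizontalControl

variable {E : Type*} [NormedAddCommGroup E] [NormedSpace ℝ E] {H : Type*} [TopologicalSpace H]
  {I : ModelWithCorners ℝ E H} {M : Type*} [TopologicalSpace M] [ChartedSpace H M]
  {V : Type*} [NormedAddCommGroup V] [NormedSpace ℝ V]

/-- This makes `C¹` solutions in coordinates competitors in the definition of the distance, and so
gives upper bounds. -/
theorem IsHorizontalCurve.of_hasDerivWithinAt {F : Type*} {U : Set V} (hU : IsOpen U) {Q : V → M}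
    (hQ : ContMDiffOn 𝓘(ℝ, V) I 1 Q U) {c c' : ℝ → V} {a b : ℝ} (hab : a ≤ b)
    (hc : ∀ t ∈ Icc a b, HasDerivWithinAt c (c' t) (Icc a b) t) (hc' : ContinuousOn c' (Icc a b))
    (hcU : ∀ t ∈ Icc a b, c t ∈ U) {X : ∀ p : M, F → TangentSpace I p} {u : ℝ → F}
    (hX : ∀ t ∈ Icc a b, mfderiv 𝓘(ℝ, V) I Q (c t) (c' t) = X (Q (c t)) (u t)) :
    IsHorizontalCurve I X (Q ∘ c) u a b := by
  have hcc : ContinuousOn c (Icc a b) := fun t ht => (hc t ht).continuousWithinAt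
  refine ⟨hQ.continuousOn.comp hcc hcU, fun f hf => ?_, ?_⟩
  · rcases hab.eq_or_lt with rfl | hlt
    · refine LipschitzOnWith.absolutelyContinuousOnInterval (K := 0) ?_
      rw [uIcc_self]
      exact LipschitzOnWith.of_dist_le_mul fun x hx y hy => by
        rw [mem_singleton_iff.1 hx, mem_singleton_iff.1 hy]; simp
    · have h1 : ContDiffOn ℝ 1 c (Icc a b) := by
        rw [contDiffOn_one_iff_derivWithin (uniqueDiffOn_Icc hlt)]
        refine ⟨fun t ht => (hc t ht).differentiableWithinAt, hc'.congr fun t ht => ?_⟩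
        exact (hc t ht).derivWithin (uniqueDiffOn_Icc hlt t ht)
      have h2 : ContDiffOn ℝ 1 (f ∘ Q) U := by
        rw [← contMDiffOn_iff_contDiffOn]
        exact (hf.of_le (by norm_num)).comp_contMDiffOn hQ
      refine ContDiffOn.absolutelyContinuousOnInterval ?_
      rw [uIcc_of_le hab]
      exact h2.comp h1 hcU
  · rw [ae_restrict_iff' measurableSet_Ioo]
    refine Eventually.of_forall fun t ht => ?_
    have htI := Ioo_subset_Icc_self ht
    have h1 : HasDerivAt c (c' t) t := (hc t htI).hasDerivAt (Icc_mem_nhds ht.1 ht.2)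
    have h2 : HasMFDerivAt 𝓘(ℝ, V) I Q (c t) (mfderiv 𝓘(ℝ, V) I Q (c t)) :=
      ((hQ.contMDiffAt (hU.mem_nhds (hcU t htI))).mdifferentiableAt (by norm_num)).hasMFDerivAt
    have h3 := HasMFDerivAt.comp t h2 h1.hasFDerivAt.hasMFDerivAt
    refine h3.congr_mfderiv ?_
    refine ContinuousLinearMap.ext fun r => ?_
    have h4 := hX t htI
    change mfderiv 𝓘(ℝ, V) I Q (c t) ((show ℝ from r) • c' t) = (show ℝ from r) • X (Q (c t)) (u t)
    rw [← h4]
    exact map_smul (mfderiv 𝓘(ℝ, V) I Q (c t)) (show ℝ from r) (c' t)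

variable [FiniteDimensional ℝ V] {F : Type*} [NormedAddCommGroup F] [NormedSpace ℝ F]

/-- Horizontality does not include measurability of the control. It is recovered from `u = B c'`
almost everywhere, where `B` is a left inverse of the frame along the curve; finite length then
gives integrability. The integral equation is checked on linear functionals. -/
theorem isControlCurve_of_ae_hasDerivAt {A : V → F →L[ℝ] V} {B : ℝ → V →L[ℝ] F} {c : ℝ → V}
    {u : ℝ → F} {a b : ℝ} (hab : a ≤ b) (hc : ContinuousOn c (Icc a b))
    (hac : ∀ l : V →L[ℝ] ℝ, AbsolutelyContinuousOnInterval (fun t => l (c t)) a b)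
    (hd : ∀ᵐ t ∂(volume.restrict (Ioo a b)), HasDerivAt c (A (c t) (u t)) t)
    (hA : ContinuousOn (fun t => A (c t)) (Icc a b)) (hB : ContinuousOn B (Icc a b))
    (hBA : ∀ t ∈ Icc a b, ∀ w, B t (A (c t) w) = w) {N : F → ℝ} {k k' : ℝ}
    (hN : IsEquivNorm N k k') (hfin : ∫⁻ t in Icc a b, ENNReal.ofReal (N (u t)) ≠ ⊤) :
    IsControlCurve A c u a b ∧
      ∫ t in a..b, N (u t) = (∫⁻ t in Icc a b, ENNReal.ofReal (N (u t))).toReal := by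
  have : CompleteSpace V := FiniteDimensional.complete ℝ V
  have hu : AEStronglyMeasurable u (volume.restrict (Icc a b)) := by
    have hBm : AEStronglyMeasurable B (volume.restrict (Icc a b)) :=
      hB.aestronglyMeasurable_of_isCompact isCompact_Icc measurableSet_Icc
    have h1 := (ContinuousLinearMap.id ℝ (V →L[ℝ] F)).aestronglyMeasurable_comp₂ hBm
      (stronglyMeasurable_deriv c).aestronglyMeasurable
    refine h1.congr ?_
    rw [← restrict_Ioo_eq_restrict_Icc]
    filter_upwards [hd, ae_restrict_mem measurableSet_Ioo] with t ht htm
    rw [ht.deriv]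
    exact hBA t (Ioo_subset_Icc_self htm) _
  have hNu : AEStronglyMeasurable (fun t => N (u t)) (volume.restrict (Icc a b)) :=
    hN.continuous.comp_aestronglyMeasurable hu
  have hNi : Integrable (fun t => N (u t)) (volume.restrict (Icc a b)) :=
    ⟨hNu, (hasFiniteIntegral_iff_ofReal (Eventually.of_forall fun t => hN.nonneg _)).2
      hfin.lt_top⟩
  have hui : IntervalIntegrable u volume a b := by
    rw [intervalIntegrable_iff_integrableOn_Icc_of_le hab]
    refine (hNi.const_mul k⁻¹).mono' hu (Eventually.of_forall fun t => ?_)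
    rw [← div_eq_inv_mul, le_div_iff₀ hN.pos, mul_comm]
    exact hN.le_norm _
  refine ⟨⟨hc, hui, fun t ht => ?_⟩, ?_⟩
  · have hint := intervalIntegrable_clm_apply hab hA hui
    have hint2 : IntervalIntegrable (fun t => A (c t) (u t)) volume a t := hint.mono_set (by
      rw [uIcc_of_le ht.1, uIcc_of_le hab]; exact Icc_subset_Icc_right ht.2)
    refine (SeparatingDual.eq_iff_forall_dual_eq (R := ℝ)).2 fun l => ?_
    rw [map_add, ← ContinuousLinearMap.intervalIntegral_comp_comm l hint2]
    exact (hac l).eq_integral_of_hasDerivAt hab (by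
      filter_upwards [hd] with s hs
      exact l.hasFDerivAt.comp_hasDerivAt s hs) ht
  · rw [intervalIntegral.integral_of_le hab, ← integral_Icc_eq_integral_Ioc,
      integral_eq_lintegral_of_nonneg_ae (Eventually.of_forall fun t => hN.nonneg _) hNu]

end HorizontalControl

/-! ### Left-invariant frames of a Lie group in a chart -/

section ChartFrame

open VectorField

variable {E : Type*} [NormedAddCommGroup E] [NormedSpace ℝ E]
  {G : Type*} [TopologicalSpace G] [ChartedSpace E G] [Group G]

variable (G) in
/-- The parametrisation of a neighbourhood of `1` by the chart at `1`, centred at `0`. -/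
noncomputable def chartParam (x : E) : G :=
  (extChartAt 𝓘(ℝ, E) (1 : G)).symm (x + extChartAt 𝓘(ℝ, E) (1 : G) 1)

variable (G) in
/-- The domain of `chartParam`. -/
def chartDomain : Set E := {x : E | x + extChartAt 𝓘(ℝ, E) (1 : G) 1 ∈ (extChartAt 𝓘(ℝ, E) (1 : G)).target}

variable (E) in
/-- The centred chart at `1`. -/
noncomputable def centredChart (g : G) : E := extChartAt 𝓘(ℝ, E) (1 : G) g - extChartAt 𝓘(ℝ, E) (1 : G) 1

variable (G) in
/-- The left-invariant frame in the chart at `1`. -/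
noncomputable def chartFrame (x : E) : E →L[ℝ] E :=
  (show E →L[ℝ] E from (mfderiv 𝓘(ℝ, E) 𝓘(ℝ, E) (chartParam G) x).inverse).comp
    (show E →L[ℝ] E from mfderiv 𝓘(ℝ, E) 𝓘(ℝ, E) (fun h => chartParam G x * h) (1 : G))

theorem chartFrame_apply (x : E) (v : GroupLieAlgebra 𝓘(ℝ, E) G) : chartFrame G x v =
    mpullback 𝓘(ℝ, E) 𝓘(ℝ, E) (chartParam G) (mulInvariantVectorField v) x := rfl

theorem isOpen_chartDomain : IsOpen (chartDomain (E := E) G) :=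
  (isOpen_extChartAt_target (I := 𝓘(ℝ, E)) (1 : G)).preimage (by fun_prop)

theorem zero_mem_chartDomain : (0 : E) ∈ chartDomain (E := E) G := by
  simp [chartDomain]

theorem chartParam_zero : chartParam G (0 : E) = 1 := by
  simp [chartParam]

theorem chartParam_mem_source {x : E} (hx : x ∈ chartDomain (E := E) G) :
    chartParam G x ∈ (extChartAt 𝓘(ℝ, E) (1 : G)).source :=
  (extChartAt 𝓘(ℝ, E) (1 : G)).map_target hx

theorem centredChart_chartParam {x : E} (hx : x ∈ chartDomain (E := E) G) :
    centredChart E (chartParam G x) = x := by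
  rw [centredChart, chartParam, (extChartAt 𝓘(ℝ, E) (1 : G)).right_inv hx, add_sub_cancel_right]

theorem chartParam_centredChart {g : G} (hg : g ∈ (extChartAt 𝓘(ℝ, E) (1 : G)).source) :
    chartParam G (centredChart E g) = g := by
  rw [chartParam, centredChart, sub_add_cancel, (extChartAt 𝓘(ℝ, E) (1 : G)).left_inv hg]

variable [LieGroup 𝓘(ℝ, E) ∞ G]

theorem contMDiffOn_chartParam :
    ContMDiffOn 𝓘(ℝ, E) 𝓘(ℝ, E) ∞ (chartParam G) (chartDomain (E := E) G) := by
  have : IsManifold 𝓘(ℝ, E) ∞ G := inferInstance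
  refine (contMDiffOn_extChartAt_symm (I := 𝓘(ℝ, E)) (n := ∞) (1 : G)).comp ?_ fun x hx => hx
  exact (contDiff_id.add contDiff_const).contMDiff.contMDiffOn

theorem contMDiffOn_centredChart :
    ContMDiffOn 𝓘(ℝ, E) 𝓘(ℝ, E) ∞ (centredChart E) (extChartAt 𝓘(ℝ, E) (1 : G)).source := by
  have h1 : ContMDiffOn 𝓘(ℝ, E) 𝓘(ℝ, E) ∞ (extChartAt 𝓘(ℝ, E) (1 : G))
    (extChartAt 𝓘(ℝ, E) (1 : G)).source := by
    rw [extChartAt_source]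
    exact contMDiffOn_extChartAt
  exact h1.sub contMDiffOn_const

theorem contMDiffAt_chartParam {x : E} (hx : x ∈ chartDomain (E := E) G) :
    ContMDiffAt 𝓘(ℝ, E) 𝓘(ℝ, E) ∞ (chartParam G) x :=
  contMDiffOn_chartParam.contMDiffAt (isOpen_chartDomain.mem_nhds hx)

theorem contMDiffAt_centredChart {g : G} (hg : g ∈ (extChartAt 𝓘(ℝ, E) (1 : G)).source) :
    ContMDiffAt 𝓘(ℝ, E) 𝓘(ℝ, E) ∞ (centredChart E) g :=
  contMDiffOn_centredChart.contMDiffAt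
    ((isOpen_extChartAt_source (I := 𝓘(ℝ, E)) (1 : G)).mem_nhds hg)

theorem isInvertible_mfderiv_chartParam {x : E} (hx : x ∈ chartDomain (E := E) G) :
    (mfderiv 𝓘(ℝ, E) 𝓘(ℝ, E) (chartParam G) x).IsInvertible := by
  have h1 : MDifferentiableAt 𝓘(ℝ, E) 𝓘(ℝ, E) (chartParam G) x :=
    (contMDiffAt_chartParam hx).mdifferentiableAt (by simp)
  have h2 : MDifferentiableAt 𝓘(ℝ, E) 𝓘(ℝ, E) (centredChart E) (chartParam G x) :=
    (contMDiffAt_centredChart (chartParam_mem_source hx)).mdifferentiableAt (by simp)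
  have h3 : MDifferentiableAt 𝓘(ℝ, E) 𝓘(ℝ, E) (chartParam G) (centredChart E (chartParam G x)) := by
    rwa [centredChart_chartParam hx]
  refine ContinuousLinearMap.IsInvertible.of_inverse
    (g := mfderiv 𝓘(ℝ, E) 𝓘(ℝ, E) (centredChart E) (chartParam G x)) ?_ ?_
  · have e : (chartParam G ∘ centredChart E) =ᶠ[𝓝 (chartParam G x)] id := by
      filter_upwards [(isOpen_extChartAt_source (I := 𝓘(ℝ, E)) (1 : G)).mem_nhds
        (chartParam_mem_source hx)] with g hg
      exact chartParam_centredChart hg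
    have h4 := mfderiv_comp (chartParam G x) h3 h2
    rw [e.mfderiv_eq, mfderiv_id, centredChart_chartParam hx] at h4
    exact h4.symm
  · have e : (centredChart E ∘ chartParam G) =ᶠ[𝓝 x] id := by
      filter_upwards [isOpen_chartDomain.mem_nhds hx] with g hg
      exact centredChart_chartParam hg
    have h4 := mfderiv_comp x h2 h1
    rw [e.mfderiv_eq, mfderiv_id] at h4
    exact h4.symm

theorem mfderiv_chartParam_chartFrame {x : E} (hx : x ∈ chartDomain (E := E) G)
    (v : GroupLieAlgebra 𝓘(ℝ, E) G) :
    mfderiv 𝓘(ℝ, E) 𝓘(ℝ, E) (chartParam G) x (chartFrame G x v) =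
      mulInvariantVectorField v (chartParam G x) := by
  rw [chartFrame_apply, mpullback]
  exact (isInvertible_mfderiv_chartParam hx).self_apply_inverse _

variable [CompleteSpace E]

theorem contDiffOn_chartFrame [FiniteDimensional ℝ E] :
    ContDiffOn ℝ 2 (chartFrame G) (chartDomain (E := E) G) := by
  rw [contDiffOn_clm_apply]
  intro v x hx
  refine ContDiffAt.contDiffWithinAt ?_
  have h1 := contMDiffAt_mulInvariantVectorField (I := 𝓘(ℝ, E)) (G := G) (g := chartParam G x) v
  replace h1 := ContMDiffAt.of_le (m := 2) h1 le_minSmoothness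
  have h2 := h1.mpullback_vectorField_preimage (contMDiffAt_chartParam hx)
    (isInvertible_mfderiv_chartParam hx) (by
      rw [show (2 : WithTop ℕ∞) + 1 = 3 by norm_num]; exact ENat.LEInfty.out)
  exact contMDiffAt_vectorSpace_iff_contDiffAt.1 h2

theorem lieBracketWithin_clm_apply {V : Type*} [NormedAddCommGroup V] [NormedSpace ℝ V]
    {A : V → V →L[ℝ] V} {x : V} (hd : DifferentiableAt ℝ A x) (v w : V) :
    lieBracketWithin ℝ (fun y => A y v) (fun y => A y w) univ x =
      fderiv ℝ A x (A x v) w - fderiv ℝ A x (A x w) v := by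
  have h2 : ∀ u : V, fderiv ℝ (fun y => A y u) x = (fderiv ℝ A x).flip u :=
    fun u => (hd.hasFDerivAt.clm_apply (hasFDerivAt_const u x)).fderiv.trans (by ext; simp)
  rw [lieBracketWithin_univ, lieBracket, h2, h2]
  rfl

/-- The bracket of left-invariant fields is the left-invariant field of the bracket, and pullback by
the chart commutes with Lie brackets of vector fields. -/
theorem chartFrame_structure_eq [FiniteDimensional ℝ E] {x : E} (hx : x ∈ chartDomain (E := E) G)
    (v w : GroupLieAlgebra 𝓘(ℝ, E) G) :
    fderiv ℝ (chartFrame G) x (chartFrame G x v) w - fderiv ℝ (chartFrame G) x (chartFrame G x w) v =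
      chartFrame G x (⁅v, w⁆ : GroupLieAlgebra 𝓘(ℝ, E) G) := by
  have hd : DifferentiableAt ℝ (chartFrame G) x :=
    (contDiffOn_chartFrame.differentiableOn (by norm_num)).differentiableAt
      (isOpen_chartDomain.mem_nhds hx)
  have h1 := mulInvariantVector_mlieBracket (I := 𝓘(ℝ, E)) (G := G) v w
  rw [chartFrame_apply x ⁅v, w⁆, GroupLieAlgebra.bracket_def, h1,
    mpullback_mlieBracket (n := ∞) (mdifferentiableAt_mulInvariantVectorField v)
      (mdifferentiableAt_mulInvariantVectorField w) (contMDiffAt_chartParam hx) (by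
        rw [minSmoothness_of_isRCLikeNormedField]; exact ENat.LEInfty.out), ← mlieBracketWithin_univ,
    mlieBracketWithin_eq_lieBracketWithin]
  exact (lieBracketWithin_clm_apply hd v w).symm

end ChartFrame

/-! ### The time-one map of the flow of a left-invariant frame -/

section TimeOne

variable {V : Type*} [NormedAddCommGroup V] [NormedSpace ℝ V] [CompleteSpace V]
  {br : V →L[ℝ] V →L[ℝ] V} {A : V → V →L[ℝ] V} {A' : V → V →L[ℝ] V →L[ℝ] V} {R K : ℝ}

/-- An open interval around `[0, 1]` is needed for comparison with integral curves in `G`. The curve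
runs backwards from `0` for time `2` and then forwards for time `4`, which explains the factor `6`;
by uniqueness it passes through `0` halfway. -/
theorem BoundedLip.exists_twoSided_flowLine (hR : 0 < R) (h : BoundedLip A R K) {w : V}
    (hw : 6 * (K * ‖w‖) ≤ R) : ∃ z : ℝ → V, z 0 = 0 ∧
      (∀ t ∈ Ioo (-2 : ℝ) 2, HasDerivAt z (A (z t) w) t) ∧
      ∀ t ∈ Icc (-2 : ℝ) 2, ‖z t‖ ≤ R := by
  have hK := h.nonneg
  have hKw : 0 ≤ K * ‖w‖ := by positivity
  obtain ⟨y, hy0, hy, hyb⟩ := h.exists_flowLine hR (w := (-2 : ℝ) • w) (p := 0) (by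
    rw [norm_smul]; norm_num; linarith)
  have e2 : K * ‖(-2 : ℝ) • w‖ = 2 * (K * ‖w‖) := by rw [norm_smul]; norm_num; ring
  have e4 : K * ‖(4 : ℝ) • w‖ = 4 * (K * ‖w‖) := by rw [norm_smul]; norm_num; ring
  simp only [sub_zero, e2] at hyb
  have hy1 := hyb 1 (by simp)
  obtain ⟨x, hx0, hx, hxb⟩ := h.exists_flowLine hR (w := (4 : ℝ) • w) (p := y 1) (by
    rw [e4]; linarith)
  have hxR : ∀ t ∈ Icc (0 : ℝ) 1, ‖x t‖ ≤ R := fun t ht => by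
    have := norm_le_norm_add_norm_sub' (x t) (y 1)
    have := hxb t ht
    rw [e4] at this
    linarith
  have hhalf : x (1 / 2) = 0 := by
    have h1 := hx.rescale (c := 1 / 2) (by norm_num)
    have h2 := hy.reverse
    rw [smul_smul, show (1 / 2 * 4 : ℝ) = 2 by norm_num] at h1
    rw [neg_smul, neg_neg] at h2
    have := h.flowLine_unique h1 h2 (fun t ht => hxR _ ⟨by linarith [ht.1], by linarith [ht.2]⟩)
      (fun t ht => (hyb _ ⟨by linarith [ht.2], by linarith [ht.1]⟩).trans (by linarith))
      (by simp [hx0]) (t := 1) (by simp)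
    simpa [hy0] using this
  refine ⟨fun t => x ((t + 2) / 4), by norm_num at hhalf ⊢; exact hhalf, fun t ht => ?_, fun t ht =>
    hxR _ ⟨by linarith [ht.1], by linarith [ht.2]⟩⟩
  have hm : (t + 2) / 4 ∈ Ioo (0 : ℝ) 1 := ⟨by linarith [ht.1], by linarith [ht.2]⟩
  have h1 := (hx _ (Ioo_subset_Icc_self hm)).hasDerivAt (Icc_mem_nhds hm.1 hm.2)
  have h2 : HasDerivAt (fun t : ℝ => (t + 2) / 4) (1 / 4) t :=
    ((hasDerivAt_id t).add_const 2).div_const 4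
  have h3 := h1.scomp t h2
  rw [map_smul, smul_smul] at h3
  norm_num at h3
  exact h3

/-- The derivative of the exponential map. The first variation formula is applied to two flow lines
from `0`, with `η(t) = t ψ(t ad w) v`; its error is quadratic in `v`. -/
theorem FrameOn.exists_timeOne (hR : 0 < R) (h : FrameOn br A A' R K) :
    ∃ r > 0, ∃ Q : V → V, (∀ w, ‖w‖ < r → ∃ z : ℝ → V, z 0 = 0 ∧ z 1 = Q w ∧
      (∀ t ∈ Ioo (-2 : ℝ) 2, HasDerivAt z (A (z t) w) t) ∧ ∀ t ∈ Icc (-2 : ℝ) 2, ‖z t‖ ≤ R) ∧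
    ∀ w, ‖w‖ < r → HasFDerivAt Q ((A (Q w)).comp (psi (br w))) w := by
  have hK := h.nonneg
  set r := R / (6 * K + 1) with hr
  have hr0 : 0 < r := by positivity
  have hw : ∀ w : V, ‖w‖ < r → 6 * (K * ‖w‖) ≤ R := fun w hw => by
    rw [hr, lt_div_iff₀ (by positivity)] at hw
    nlinarith [norm_nonneg w]
  have hex : ∀ w : V, ∃ z : ℝ → V, ‖w‖ < r → z 0 = 0 ∧
      (∀ t ∈ Ioo (-2 : ℝ) 2, HasDerivAt z (A (z t) w) t) ∧
      ∀ t ∈ Icc (-2 : ℝ) 2, ‖z t‖ ≤ R := fun w => by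
    by_cases hwr : ‖w‖ < r
    · obtain ⟨z, hz⟩ := h.toBoundedLip.exists_twoSided_flowLine hR (hw w hwr)
      exact ⟨z, fun _ => hz⟩
    · exact ⟨0, fun h => absurd h hwr⟩
  choose z hz using hex
  refine ⟨r, hr0, fun w => z w 1, fun w hwr => ⟨z w, (hz w hwr).1, rfl, (hz w hwr).2⟩,
    fun w hwr => ?_⟩
  have hflow : ∀ w, ‖w‖ < r → IsFlowLine A w (z w) := fun w hwr t ht =>
    ((hz w hwr).2.1 t ⟨by linarith [ht.1], by linarith [ht.2]⟩).hasDerivWithinAt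
  have hbd : ∀ w, ‖w‖ < r → ∀ t ∈ Icc (0 : ℝ) 1, ‖z w t‖ ≤ R := fun w hwr t ht =>
    (hz w hwr).2.2 t ⟨by linarith [ht.1], by linarith [ht.2]⟩
  set X := Real.exp (K * ‖w‖) with hX
  have hX0 : 0 < X := Real.exp_pos _
  rw [hasFDerivAt_iff_isLittleO_nhds_zero]
  have hO : (fun v : V => z (w + v) 1 - z w 1 - ((A (z w 1)).comp (psi (br w))) v) =O[𝓝 0]
      fun v : V => ‖v‖ ^ 2 := by
    refine Asymptotics.IsBigO.of_bound ((K * ‖w‖ * (K * X) ^ 2 + K * (K * X)) * X) ?_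
    have hnear : ∀ᶠ v : V in 𝓝 0, ‖w + v‖ < r := by
      have : ContinuousAt (fun v : V => ‖w + v‖) 0 := by fun_prop
      exact this.eventually_lt continuousAt_const (by simpa using hwr)
    filter_upwards [hnear] with v hv
    have h1 := h.norm_variation_le (η := fun t => t • psi (t • br w) v) (hflow w hwr)
      (hflow (w + v) hv) (hbd w hwr) (hbd _ hv)
      (fun t _ => (hasDerivAt_smul_psi (br w) v t).hasDerivWithinAt) (M := K * X * ‖v‖)
      (le_of_eq (by rw [(hz w hwr).1, (hz _ hv).1]; simp; ring)) (t := 1) (by simp)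
    simp only [(hz w hwr).1, (hz _ hv).1, zero_smul, map_zero, sub_self, norm_zero, zero_add,
      one_smul] at h1
    rw [ContinuousLinearMap.comp_apply, Real.norm_of_nonneg (by positivity : 0 ≤ ‖v‖ ^ 2)]
    refine h1.trans (le_of_eq ?_)
    ring
  refine hO.trans_isLittleO ?_
  have := (Asymptotics.isLittleO_norm_pow_id (E' := V) one_lt_two)
  exact this

/-- The derivative formula shows that `Q` is `C¹`, with invertible derivative at `0` because `ψ(0) =
1`. The ball is shrunk so that `ψ(ad w)` stays invertible, whence the local inverse is `C¹` on the
whole image. -/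
theorem FrameOn.exists_timeOne_inverse (hR : 0 < R) (h : FrameOn br A A' R K)
    (hinv : ∀ x, ‖x‖ ≤ R → (A x).IsInvertible) :
    ∃ r > 0, ∃ Q S : V → V, (∀ w ∈ Metric.ball (0 : V) r, ∃ z : ℝ → V, z 0 = 0 ∧ z 1 = Q w ∧
      (∀ t ∈ Ioo (-2 : ℝ) 2, HasDerivAt z (A (z t) w) t) ∧ ∀ t ∈ Icc (-2 : ℝ) 2, ‖z t‖ ≤ R) ∧
    (∀ w ∈ Metric.ball (0 : V) r, IsUnit (psi (br w)) ∧
      HasFDerivAt Q ((A (Q w)).comp (psi (br w))) w ∧ S (Q w) = w) ∧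
    ContDiffOn ℝ 1 Q (Metric.ball 0 r) ∧ IsOpen (Q '' Metric.ball 0 r) ∧
    ContDiffOn ℝ 1 S (Q '' Metric.ball 0 r) := by
  obtain ⟨r, hr, Q, hz, hQ⟩ := h.exists_timeOne hR
  have hQR : ∀ w, ‖w‖ < r → ‖Q w‖ ≤ R := fun w hw => by
    obtain ⟨z, -, hz1, -, hzb⟩ := hz w hw
    rw [← hz1]
    exact hzb 1 (by norm_num)
  have hQc : ContinuousOn Q (Metric.ball 0 r) := fun w hw =>
    (hQ w (by simpa using hw)).continuousAt.continuousWithinAt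
  have hD : ContinuousOn (fun w => (A (Q w)).comp (psi (br w))) (Metric.ball 0 r) := by
    refine ContinuousOn.clm_comp ?_ (contDiff_psi_bracket br (n := 0)).continuous.continuousOn
    exact h.toBoundedLip.continuousOn.comp hQc fun w hw => by
      simpa using hQR w (by simpa using hw)
  have hC : ∀ w ∈ Metric.ball (0 : V) r, ContDiffAt ℝ 1 Q w := fun w hw =>
    contDiffAt_one_iff.2 ⟨_, _, Metric.isOpen_ball.mem_nhds hw, hD, fun x hx =>
      hQ x (by simpa using hx)⟩
  have hequiv : ∀ w, ‖w‖ < r → IsUnit (psi (br w)) → ∃ e : V ≃L[ℝ] V,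
      HasFDerivAt Q (e : V →L[ℝ] V) w := fun w hw hu => by
    obtain ⟨e₁, he₁⟩ := hinv _ (hQR w hw)
    obtain ⟨e₂, -, he₂⟩ := exists_continuousLinearEquiv_expFrame hu
    refine ⟨e₂.symm.trans e₁, ?_⟩
    have := hQ w hw
    rwa [← he₁, ← he₂] at this
  have hu0 : IsUnit (psi (br (0 : V))) := by rw [map_zero, psi_zero]; exact isUnit_one
  obtain ⟨e₀, he₀⟩ := hequiv 0 (by simpa using hr) hu0
  have h0 := hC 0 (Metric.mem_ball_self hr)
  let T := h0.toOpenPartialHomeomorph Q he₀ (by norm_num)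
  have hT0 : (0 : V) ∈ T.source := h0.mem_toOpenPartialHomeomorph_source he₀ (by norm_num)
  have hTQ : ∀ x, T x = Q x := fun x => rfl
  have hUo : IsOpen {w : V | IsUnit (psi (br w))} :=
    Units.isOpen.preimage (contDiff_psi_bracket br (n := 0)).continuous
  obtain ⟨r', hr', hsub⟩ := Metric.isOpen_iff.1
    ((T.open_source.inter hUo).inter (Metric.isOpen_ball (x := (0 : V)) (ε := r))) 0
    ⟨⟨hT0, hu0⟩, Metric.mem_ball_self hr⟩
  have hlt : ∀ w ∈ Metric.ball (0 : V) r', ‖w‖ < r := fun w hw => by simpa using (hsub hw).2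
  refine ⟨r', hr', Q, T.symm, fun w hw => hz w (hlt w hw), fun w hw => ⟨(hsub hw).1.2,
    hQ w (hlt w hw), T.left_inv (hsub hw).1.1⟩, fun w hw => (hC w (hsub hw).2).contDiffWithinAt,
    T.isOpen_image_of_subset_source Metric.isOpen_ball fun w hw => (hsub hw).1.1, ?_⟩
  rintro _ ⟨w, hw, rfl⟩
  obtain ⟨e, he⟩ := hequiv w (hlt w hw) (hsub hw).1.2
  have hl : T.symm (Q w) = w := T.left_inv (hsub hw).1.1
  refine (T.contDiffAt_symm (T.map_source (hsub hw).1.1) (f₀' := e) ?_ ?_).contDiffWithinAt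
  · rw [hTQ, hl]; exact he
  · rw [hTQ, hl]; exact hC w (hsub hw).2

end TimeOne

/-! ### The exponential map of the Lie group. -/

section Exponential

variable {E : Type*} [NormedAddCommGroup E] [NormedSpace ℝ E]
  {G : Type*} [TopologicalSpace G] [ChartedSpace E G] [Group G] [LieGroup 𝓘(ℝ, E) ∞ G]

theorem mfderiv_mul_left_mulInvariantVectorField (v : GroupLieAlgebra 𝓘(ℝ, E) G) (g h : G) :
    mfderiv 𝓘(ℝ, E) 𝓘(ℝ, E) (fun x => g * x) h (mulInvariantVectorField v h) =
      mulInvariantVectorField v (g * h) := by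
  have hd : ∀ k x : G, MDifferentiableAt 𝓘(ℝ, E) 𝓘(ℝ, E) (fun x => k * x) x := fun k x =>
    ((contMDiff_mul_left (I := 𝓘(ℝ, E)) (n := ∞) (a := k)).contMDiffAt).mdifferentiableAt (by simp)
  have h1 := mfderiv_comp_apply (I := 𝓘(ℝ, E)) (I' := 𝓘(ℝ, E)) (I'' := 𝓘(ℝ, E)) (1 : G)
    (g := fun x => g * x) (f := fun x => h * x) (hd g _) (hd h 1) v
  have h2 : ((fun x => g * x) ∘ fun x => h * x) = fun x => g * h * x := by
    ext x; simp [mul_assoc]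
  rw [h2] at h1
  have h3 := congrArg (fun k : G => (show E →L[ℝ] E from
    mfderiv 𝓘(ℝ, E) 𝓘(ℝ, E) (fun x => g * x) k) (show E from mulInvariantVectorField v h)) (mul_one h)
  exact h3.symm.trans h1.symm

theorem isInvertible_mfderiv_mul_left (g : G) :
    (show E →L[ℝ] E from mfderiv 𝓘(ℝ, E) 𝓘(ℝ, E) (fun x => g * x) 1).IsInvertible := by
  have hd : ∀ k x : G, MDifferentiableAt 𝓘(ℝ, E) 𝓘(ℝ, E) (fun x => k * x) x := fun k x =>
    ((contMDiff_mul_left (I := 𝓘(ℝ, E)) (n := ∞) (a := k)).contMDiffAt).mdifferentiableAt (by simp)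
  have key : ∀ g h k : G, g * h = k → h = g⁻¹ * k →
      (show E →L[ℝ] E from mfderiv 𝓘(ℝ, E) 𝓘(ℝ, E) (fun x => g⁻¹ * x) k).comp
        (show E →L[ℝ] E from mfderiv 𝓘(ℝ, E) 𝓘(ℝ, E) (fun x => g * x) h) =
      ContinuousLinearMap.id ℝ E := by
    rintro g h k rfl -
    have h4 := mfderiv_comp h (g := fun x => g⁻¹ * x) (f := fun x => g * x)
      (I := 𝓘(ℝ, E)) (I' := 𝓘(ℝ, E)) (I'' := 𝓘(ℝ, E)) (hd g⁻¹ _) (hd g h)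
    have e : ((fun x => g⁻¹ * x) ∘ fun x => g * x) = id := by ext x; simp
    rw [e, mfderiv_id] at h4
    exact h4.symm
  have h2 := key g⁻¹ g 1 (by simp) (by simp)
  rw [inv_inv] at h2
  exact ContinuousLinearMap.IsInvertible.of_inverse h2 (key g 1 g (by simp) (by simp))

theorem contMDiff_one_mulInvariantVectorField (v : GroupLieAlgebra 𝓘(ℝ, E) G) :
    ContMDiff 𝓘(ℝ, E) 𝓘(ℝ, E).tangent 1
      (fun g : G => (⟨g, mulInvariantVectorField v g⟩ : TangentBundle 𝓘(ℝ, E) G)) :=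
  ContMDiff.of_le (m := 1) (contMDiff_mulInvariantVectorField v)
    (le_trans (by norm_num) (le_minSmoothness (𝕜 := ℝ) (n := 2)))

theorem isInvertible_chartFrame {x : E} (hx : x ∈ chartDomain (E := E) G) :
    (chartFrame G x).IsInvertible := by
  have h1 := isInvertible_mfderiv_chartParam hx
  have h2 := isInvertible_mfderiv_mul_left (E := E) (chartParam G x)
  exact (h1.inverse).comp h2

variable [FiniteDimensional ℝ E] [CompleteSpace E]

variable (E G) in
/-- The Lie bracket of `G` on the model space. -/
noncomputable def modelBracket : E →L[ℝ] E →L[ℝ] E :=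
  normedBracket (lieAlgebraEquivModel E G).toLinearEquiv

theorem exists_frameOn_chartFrame : ∃ R > 0, ∃ K, Metric.closedBall 0 R ⊆ chartDomain (E := E) G ∧
    FrameOn (modelBracket E G) (chartFrame G) (fderiv ℝ (chartFrame G)) R K := by
  obtain ⟨R, hR, hRU⟩ := Metric.nhds_basis_closedBall.mem_iff.1
    (isOpen_chartDomain.mem_nhds (zero_mem_chartDomain (E := E) (G := G)))
  obtain ⟨K, hK, a1, a2, a3, a4⟩ := (contDiffOn_chartFrame (E := E) (G := G)).exists_taylor_bound
    isOpen_chartDomain (isCompact_closedBall (0 : E) R) (convex_closedBall _ _) hRU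
  have hm : ∀ {x : E}, ‖x‖ ≤ R → x ∈ Metric.closedBall (0 : E) R := fun hx => by simpa using hx
  refine ⟨R, hR, K, hRU, ⟨⟨hK, fun x hx => a1 x (hm hx), fun x y hx hy => a3 x (hm hx) y (hm hy)⟩,
    fun x hx => ?_, fun x hx => a2 x (hm hx), fun x y hx hy => a4 x (hm hx) y (hm hy),
    fun x hx v w => chartFrame_structure_eq (hRU (hm hx)) v w⟩⟩
  exact ((contDiffOn_chartFrame.differentiableOn (by norm_num)).differentiableAt
      (isOpen_chartDomain.mem_nhds (hRU (hm hx)))).hasFDerivAt.hasFDerivWithinAt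

variable [T2Space G]

/-- Left translations carry one local integral curve to every point with the same existence time, so
the field is complete. -/
theorem exists_isMIntegralCurve_mulInvariantVectorField (v : GroupLieAlgebra 𝓘(ℝ, E) G) :
    ∃ c : ℝ → G, IsMIntegralCurve (I := 𝓘(ℝ, E)) c (mulInvariantVectorField v) ∧ c 0 = 1 := by
  obtain ⟨c, hc0, hc⟩ := exists_isMIntegralCurveAt_of_contMDiffAt_boundaryless (t₀ := 0)
    ((contMDiff_one_mulInvariantVectorField v).contMDiffAt (x := (1 : G)))
  obtain ⟨ε, hε, hcε⟩ := isMIntegralCurveAt_iff'.1 hc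
  rw [Real.ball_eq_Ioo, zero_sub, zero_add] at hcε
  have hg : ∀ g : G, ∃ c' : ℝ → G, c' 0 = g ∧ IsMIntegralCurveOn (I := 𝓘(ℝ, E)) c'
      (mulInvariantVectorField v) (Ioo (-ε) ε) := fun g => by
    refine ⟨fun t => g * c t, by simp [hc0], fun t ht => ?_⟩
    have h2 : HasMFDerivAt 𝓘(ℝ, E) 𝓘(ℝ, E) (fun x => g * x) (c t) _ :=
      (((contMDiff_mul_left (I := 𝓘(ℝ, E)) (n := ∞) (a := g)).contMDiffAt).mdifferentiableAt
        (by simp)).hasMFDerivAt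
    have h3 := h2.comp_hasMFDerivWithinAt t (hcε t ht)
    refine h3.congr_mfderiv (ContinuousLinearMap.ext fun r => ?_)
    rw [← mfderiv_mul_left_mulInvariantVectorField]
    exact map_smul (mfderiv 𝓘(ℝ, E) 𝓘(ℝ, E) (fun x => g * x) (c t)) (show ℝ from r) _
  obtain ⟨c', h0, h1⟩ := exists_isMIntegralCurve_of_isMIntegralCurveOn
    (contMDiff_one_mulInvariantVectorField v) hε hg (1 : G)
  exact ⟨c', h1, h0⟩

theorem lieExp_eq {v : GroupLieAlgebra 𝓘(ℝ, E) G} {z : ℝ → G} (h0 : z 0 = 1)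
    (hz : IsMIntegralCurveOn (I := 𝓘(ℝ, E)) z (mulInvariantVectorField v) (Ioo (-2) 2)) :
    lieExp v = z 1 := by
  have h := exists_isMIntegralCurve_mulInvariantVectorField v
  rw [lieExp, dif_pos h]
  obtain ⟨h1, h2⟩ := h.choose_spec
  exact isMIntegralCurveOn_Ioo_eqOn_of_contMDiff_boundaryless (t₀ := 0) (by norm_num)
    (contMDiff_one_mulInvariantVectorField v) (h1.isMIntegralCurveOn _) hz (h2.trans h0.symm)
    (by norm_num)

end Exponential

/-! ### The exponential chart -/

section ExpChart

variable {E : Type*} [NormedAddCommGroup E] [NormedSpace ℝ E] [FiniteDimensional ℝ E]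
  [CompleteSpace E]
  {G : Type*} [TopologicalSpace G] [ChartedSpace E G] [Group G] [LieGroup 𝓘(ℝ, E) ∞ G]

variable (G) in
/-- The exponential map on the model space. -/
noncomputable def modelExp (p : E) : G := lieExp ((lieAlgebraEquivModel E G).symm p)

variable (G) in
/-- The left-invariant vector fields, parametrised by the model space. -/
noncomputable def leftField (g : G) (v : E) : TangentSpace 𝓘(ℝ, E) g :=
  mulInvariantVectorField ((lieAlgebraEquivModel E G).symm v) g

/-- `lg` is an inverse, on the open set `Ω`, of the exponential map on the ball of radius `ρ`. -/
structure IsExpChart (ρ : ℝ) (lg : G → E) (Ω : Set G) : Prop where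
  pos : 0 < ρ
  isOpen : IsOpen Ω
  contMDiffOn : ContMDiffOn 𝓘(ℝ, E) 𝓘(ℝ, E) 1 (modelExp (E := E) G) (Metric.ball 0 ρ)
  contMDiffOn_log : ContMDiffOn 𝓘(ℝ, E) 𝓘(ℝ, E) 1 lg Ω
  exp_mem : ∀ p ∈ Metric.ball (0 : E) ρ, modelExp G p ∈ Ω
  log_exp : ∀ p ∈ Metric.ball (0 : E) ρ, lg (modelExp G p) = p
  isUnit_psi : ∀ p ∈ Metric.ball (0 : E) ρ, IsUnit (psi (modelBracket E G p))
  mfderiv_exp : ∀ p ∈ Metric.ball (0 : E) ρ, ∀ v,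
    mfderiv 𝓘(ℝ, E) 𝓘(ℝ, E) (modelExp G) p v = leftField G (modelExp G p) (psi (modelBracket E G p) v)
  log_mem : ∀ g ∈ Ω, lg g ∈ Metric.ball (0 : E) ρ
  exp_log : ∀ g ∈ Ω, modelExp G (lg g) = g

theorem IsExpChart.mfderiv_exp_expFrame {ρ : ℝ} {lg : G → E} {Ω : Set G} (h : IsExpChart ρ lg Ω)
    {p : E} (hp : p ∈ Metric.ball (0 : E) ρ) (v : E) :
    mfderiv 𝓘(ℝ, E) 𝓘(ℝ, E) (modelExp G) p (expFrame (modelBracket E G) p v) =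
      leftField G (modelExp G p) v := by
  exact (h.mfderiv_exp p hp _).trans (by rw [psi_expFrame (h.isUnit_psi p hp)])

variable [T2Space G]

theorem modelExp_eq {v : E} {z : ℝ → G} (h0 : z 0 = 1)
    (hz : IsMIntegralCurveOn (I := 𝓘(ℝ, E)) z (fun g => leftField G g v) (Ioo (-2) 2)) :
    modelExp G v = z 1 := lieExp_eq h0 hz

theorem modelExp_zero : modelExp G (0 : E) = 1 := by
  refine modelExp_eq (z := fun _ => 1) rfl fun t _ => ?_
  refine (hasMFDerivAt_const (1 : G) t).hasMFDerivWithinAt.congr_mfderiv ?_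
  refine ContinuousLinearMap.ext fun r => ?_
  have h : leftField G (1 : G) (0 : E) = 0 := map_zero (mfderiv 𝓘(ℝ, E) 𝓘(ℝ, E) (fun x => (1 : G) * x) 1)
  have key : ∀ (a : ℝ) (v : E), v = 0 → (0 : E) = a • v := by rintro a v rfl; simp
  exact key _ _ h

-- The time-one map in the chart at `1` is the exponential map, by uniqueness of integral curves;
-- its derivative formula and its local inverse are transferred through the chart.
variable (G) in
theorem exists_isExpChart : ∃ (ρ : ℝ) (lg : G → E) (Ω : Set G), IsExpChart ρ lg Ω := by
  obtain ⟨R, hR, K, hRU, hF⟩ := exists_frameOn_chartFrame (E := E) (G := G)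
  have hmem : ∀ {x : E}, ‖x‖ ≤ R → x ∈ chartDomain (E := E) G := fun hx => hRU (by simpa using hx)
  obtain ⟨r, hr, Q, S, hz, hQ, hQc, hQo, hSc⟩ := hF.exists_timeOne_inverse hR fun x hx =>
    isInvertible_chartFrame (hmem hx)
  have hexp : ∀ w ∈ Metric.ball (0 : E) r, Q w ∈ chartDomain (E := E) G ∧
      modelExp G w = chartParam G (Q w) := fun w hw => by
    obtain ⟨z, hz0, hz1, hzd, hzb⟩ := hz w hw
    refine ⟨hz1 ▸ hmem (hzb 1 (by norm_num)), ?_⟩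
    rw [← hz1]
    refine modelExp_eq (z := fun t => chartParam G (z t)) (by simp [hz0, chartParam_zero])
      fun t ht => ?_
    have hm := hmem (hzb t (Ioo_subset_Icc_self ht))
    have h2 : HasMFDerivAt 𝓘(ℝ, E) 𝓘(ℝ, E) (chartParam G) (z t) _ :=
      ((contMDiffAt_chartParam hm).mdifferentiableAt (by simp)).hasMFDerivAt
    have h3 := HasMFDerivAt.comp t h2 (hzd t ht).hasFDerivAt.hasMFDerivAt
    refine h3.hasMFDerivWithinAt.congr_mfderiv (ContinuousLinearMap.ext fun a => ?_)
    change mfderiv 𝓘(ℝ, E) 𝓘(ℝ, E) (chartParam G) (z t) ((show ℝ from a) • chartFrame G (z t) w) =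
      (show ℝ from a) • leftField G (chartParam G (z t)) w
    rw [leftField, ← mfderiv_chartParam_chartFrame hm]
    exact map_smul (mfderiv 𝓘(ℝ, E) 𝓘(ℝ, E) (chartParam G) (z t)) (show ℝ from a) _
  refine ⟨r, fun g => S (centredChart E g), (extChartAt 𝓘(ℝ, E) (1 : G)).source ∩
    centredChart E ⁻¹' (Q '' Metric.ball 0 r), hr, ?_, ?_, ?_, fun p hp => ?_, fun p hp => ?_,
    fun p hp => (hQ p hp).1, fun p hp v => ?_, ?_, ?_⟩
  · exact contMDiffOn_centredChart.continuousOn.isOpen_inter_preimage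
      (isOpen_extChartAt_source (I := 𝓘(ℝ, E)) (1 : G)) hQo
  · refine ContMDiffOn.congr (ContMDiffOn.comp (contMDiffOn_chartParam.of_le (by norm_num))
      hQc.contMDiffOn fun w hw => (hexp w hw).1) fun w hw => (hexp w hw).2
  · exact hSc.contMDiffOn.comp ((contMDiffOn_centredChart.of_le (by norm_num)).mono
      inter_subset_left) fun g hg => hg.2
  · rw [(hexp p hp).2]
    refine ⟨chartParam_mem_source (hexp p hp).1, ?_⟩
    rw [mem_preimage, centredChart_chartParam (hexp p hp).1]
    exact mem_image_of_mem Q hp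
  · rw [(hexp p hp).2, centredChart_chartParam (hexp p hp).1]
    exact (hQ p hp).2.2
  · have h2 : HasMFDerivAt 𝓘(ℝ, E) 𝓘(ℝ, E) (chartParam G) (Q p) _ :=
      ((contMDiffAt_chartParam (hexp p hp).1).mdifferentiableAt (by simp)).hasMFDerivAt
    have h3 := HasMFDerivAt.comp p h2 (hQ p hp).2.1.hasMFDerivAt
    have h4 : modelExp G =ᶠ[𝓝 p] chartParam G ∘ Q := by
      filter_upwards [Metric.isOpen_ball.mem_nhds hp] with w hw
      exact (hexp w hw).2
    have h5 := (h3.congr_of_eventuallyEq h4).mfderiv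
    have h6 := congrArg (fun T : E →L[ℝ] E => T v) h5
    refine Eq.trans h6 ?_
    refine Eq.trans (mfderiv_chartParam_chartFrame (hexp p hp).1 _) ?_
    rw [(hexp p hp).2]
    rfl
  · rintro g ⟨hg, w, hw, hwg⟩
    rw [← hwg, (hQ w hw).2.2]
    exact hw
  · rintro g ⟨hg, w, hw, hwg⟩
    rw [← hwg, (hQ w hw).2.2, (hexp w hw).2, hwg, chartParam_centredChart hg]

end ExpChart

/-! ### Lifting horizontal curves to the exponential chart -/

namespace AbsolutelyContinuousOnInterval

theorem of_dist_le {κ : Type*} [Fintype κ] {f : κ → ℝ → ℝ} {g : ℝ → ℝ} {a b K : ℝ}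
    (hf : ∀ i, AbsolutelyContinuousOnInterval (f i) a b)
    (h : ∀ s ∈ uIcc a b, ∀ t ∈ uIcc a b, dist (g s) (g t) ≤ K * ∑ i, dist (f i s) (f i t)) :
    AbsolutelyContinuousOnInterval g a b := by
  have h1 : Tendsto (fun T : ℕ × (ℕ → ℝ × ℝ) => K * ∑ i, ∑ j ∈ Finset.range T.1,
      dist (f i (T.2 j).1) (f i (T.2 j).2)) (totalLengthFilter ⊓ 𝓟 (disjWithin a b)) (𝓝 0) := by
    have := (tendsto_finsetSum Finset.univ fun i _ => hf i).const_mul K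
    simpa using this
  refine squeeze_zero' (Eventually.of_forall fun T => Finset.sum_nonneg fun _ _ => dist_nonneg) ?_ h1
  rw [eventually_inf_principal]
  refine Eventually.of_forall fun T hT => ?_
  rw [Finset.sum_comm, Finset.mul_sum]
  exact Finset.sum_le_sum fun j hj => h _ (hT.1 j hj).1 _ (hT.1 j hj).2

theorem of_norm_le {V : Type*} [NormedAddCommGroup V] [NormedSpace ℝ V] [FiniteDimensional ℝ V]
    {f : ℝ → V} {g : ℝ → ℝ} {a b K : ℝ} (hK : 0 ≤ K)
    (hf : ∀ l : V →L[ℝ] ℝ, AbsolutelyContinuousOnInterval (fun t => l (f t)) a b)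
    (h : ∀ s ∈ uIcc a b, ∀ t ∈ uIcc a b, ‖g s - g t‖ ≤ K * ‖f s - f t‖) :
    AbsolutelyContinuousOnInterval g a b := by
  let e := finBasis ℝ V
  refine of_dist_le (K := K * ∑ i, ‖e i‖) (fun i => hf (e.coord i).toContinuousLinearMap)
    fun s hs t ht => ?_
  rw [dist_eq_norm, mul_assoc]
  refine (h s hs t ht).trans (mul_le_mul_of_nonneg_left ?_ hK)
  conv_lhs => rw [← e.sum_repr (f s - f t)]
  rw [Finset.mul_sum]
  refine norm_sum_le_of_le _ fun i _ => ?_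
  rw [norm_smul, mul_comm, dist_eq_norm]
  refine mul_le_mul (Finset.single_le_sum (f := fun i => ‖e i‖) (fun _ _ => norm_nonneg _)
    (Finset.mem_univ i)) (le_of_eq ?_) (norm_nonneg _) (by positivity)
  simp

end AbsolutelyContinuousOnInterval

theorem IsHorizontalCurve.mono {E : Type*} [NormedAddCommGroup E] [NormedSpace ℝ E] {H : Type*}
    [TopologicalSpace H] {I : ModelWithCorners ℝ E H} {M : Type*} [TopologicalSpace M]
    [ChartedSpace H M] {F : Type*} {X : ∀ p : M, F → TangentSpace I p} {c : ℝ → M} {u : ℝ → F}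
    {a b t : ℝ} (h : IsHorizontalCurve I X c u a b) (ht : t ∈ Icc a b) :
    IsHorizontalCurve I X c u a t where
  continuousOn := h.continuousOn.mono (Icc_subset_Icc_right ht.2)
  absolutelyContinuous f hf := (h.absolutelyContinuous f hf).mono (by
    rw [uIcc_of_le ht.1, uIcc_of_le (ht.1.trans ht.2)]; exact Icc_subset_Icc_right ht.2)
  hasMFDerivAt := ae_restrict_of_ae_restrict_of_subset (Ioo_subset_Ioo_right ht.2) h.hasMFDerivAt

section Lift

variable {E : Type*} [NormedAddCommGroup E] [NormedSpace ℝ E] [FiniteDimensional ℝ E]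
  [CompleteSpace E]
  {G : Type*} [TopologicalSpace G] [ChartedSpace E G] [Group G] [LieGroup 𝓘(ℝ, E) ∞ G]
  {F : Type*} [NormedAddCommGroup F] [NormedSpace ℝ F]
  {ρ : ℝ} {lg : G → E} {Ω : Set G} {ι : F →L[ℝ] E} {N : F → ℝ} {k k' : ℝ}

variable (G) in
/-- The left-invariant horizontal frame. -/
noncomputable def leftFrame (ι : F →L[ℝ] E) (g : G) (u : F) : TangentSpace 𝓘(ℝ, E) g :=
  leftField G g (ι u)

theorem IsExpChart.mfderiv_log_leftField (h : IsExpChart ρ lg Ω) {g : G} (hg : g ∈ Ω) (v : E) :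
    mfderiv 𝓘(ℝ, E) 𝓘(ℝ, E) lg g (leftField G g v) = expFrame (modelBracket E G) (lg g) v := by
  have key : ∀ p ∈ Metric.ball (0 : E) ρ, ∀ g : G, modelExp G p = g → g ∈ Ω →
      mfderiv 𝓘(ℝ, E) 𝓘(ℝ, E) lg g (leftField G g v) = expFrame (modelBracket E G) p v := by
    rintro p hp _ rfl hg
    have h1 : MDifferentiableAt 𝓘(ℝ, E) 𝓘(ℝ, E) (modelExp (E := E) G) p :=
      (h.contMDiffOn.contMDiffAt (Metric.isOpen_ball.mem_nhds hp)).mdifferentiableAt (by simp)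
    have h2 : MDifferentiableAt 𝓘(ℝ, E) 𝓘(ℝ, E) lg (modelExp G p) :=
      (h.contMDiffOn_log.contMDiffAt (h.isOpen.mem_nhds hg)).mdifferentiableAt (by simp)
    have h3 := mfderiv_comp_apply p h2 h1 (expFrame (modelBracket E G) p v)
    have h4 : lg ∘ modelExp G =ᶠ[𝓝 p] id := by
      filter_upwards [Metric.isOpen_ball.mem_nhds hp] with q hq using h.log_exp q hq
    have h5 : mfderiv 𝓘(ℝ, E) 𝓘(ℝ, E) (lg ∘ modelExp G) p = ContinuousLinearMap.id ℝ E :=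
      h4.mfderiv_eq.trans mfderiv_id
    have h6 := congrArg (fun T : E →L[ℝ] E => T (expFrame (modelBracket E G) p v)) h5
    refine Eq.trans ?_ (h3.symm.trans h6)
    exact congrArg (mfderiv 𝓘(ℝ, E) 𝓘(ℝ, E) lg (modelExp G p)) (h.mfderiv_exp_expFrame hp v).symm
  exact key (lg g) (h.log_mem g hg) g (h.exp_log g hg) hg

/-- Absolute continuity in `G` is tested by globally defined smooth functions, whereas `lg` is only
local and `C¹`. The chart at `1`, cut off by a bump function, is global and smooth; near `0` it
controls `lg` because `lg ∘ chartParam` is `C¹`, hence Lipschitz. -/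
theorem IsExpChart.exists_smooth_bound [T2Space G] (h : IsExpChart ρ lg Ω) (h0 : modelExp G (0 : E) = 1) :
    ∃ ρ' ∈ Ioc 0 ρ, ∃ ζ : G → E, ContMDiff 𝓘(ℝ, E) 𝓘(ℝ, E) ∞ ζ ∧ ∃ K, 0 ≤ K ∧
      ∀ p ∈ Metric.ball (0 : E) ρ', ∀ q ∈ Metric.ball (0 : E) ρ',
        ‖p - q‖ ≤ K * ‖ζ (modelExp G p) - ζ (modelExp G q)‖ := by
  have : IsManifold 𝓘(ℝ, E) ∞ G := inferInstance
  let χ : SmoothBumpFunction 𝓘(ℝ, E) (1 : G) := Classical.choice inferInstance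
  have h00 : (0 : E) ∈ Metric.ball (0 : E) ρ := Metric.mem_ball_self h.pos
  have h1Ω : (1 : G) ∈ Ω := h0 ▸ h.exp_mem 0 h00
  have hc0 : ContinuousAt (modelExp (E := E) G) 0 :=
    h.contMDiffOn.continuousOn.continuousAt (Metric.isOpen_ball.mem_nhds h00)
  have hζ : ContMDiff 𝓘(ℝ, E) 𝓘(ℝ, E) ∞ fun g => χ g • centredChart E g :=
    χ.contMDiff_smul (by
      have := contMDiffOn_centredChart (E := E) (G := G)
      rwa [extChartAt_source] at this)
  have hlc : ContDiffAt ℝ 1 (fun x : E => lg (chartParam G x)) 0 := by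
    rw [← contMDiffAt_iff_contDiffAt]
    have h1 : ContMDiffAt 𝓘(ℝ, E) 𝓘(ℝ, E) 1 lg (chartParam G (0 : E)) := by
      rw [chartParam_zero]
      exact h.contMDiffOn_log.contMDiffAt (h.isOpen.mem_nhds h1Ω)
    exact h1.comp 0 ((contMDiffAt_chartParam zero_mem_chartDomain).of_le (by norm_num))
  obtain ⟨K, T, hT, hKT⟩ := hlc.exists_lipschitzOnWith
  have hcc : Tendsto (fun p : E => centredChart E (modelExp G p)) (𝓝 0) (𝓝 0) := by
    have h1 : ContinuousAt (centredChart E) (1 : G) :=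
      (contMDiffAt_centredChart (mem_extChartAt_source (I := 𝓘(ℝ, E)) (1 : G))).continuousAt
    have h2 : centredChart E (1 : G) = 0 := by simp [centredChart]
    rw [← h0] at h1
    have h3 := h1.tendsto.comp hc0.tendsto
    rwa [h0, h2] at h3
  have hsrc : ∀ᶠ p in 𝓝 (0 : E), modelExp G p ∈ (extChartAt 𝓘(ℝ, E) (1 : G)).source ∧
      χ (modelExp G p) = 1 := by
    have h1 := hc0.tendsto
    rw [h0] at h1
    have h2 : ∀ᶠ g : G in 𝓝 1, g ∈ (extChartAt 𝓘(ℝ, E) (1 : G)).source :=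
      (isOpen_extChartAt_source (I := 𝓘(ℝ, E)) (1 : G)).mem_nhds (mem_extChartAt_source (1 : G))
    exact h1.eventually (h2.and χ.eventuallyEq_one)
  obtain ⟨r, hr, hball⟩ := Metric.eventually_nhds_iff_ball.1 ((hcc.eventually hT).and hsrc)
  refine ⟨min r ρ, ⟨lt_min hr h.pos, min_le_right _ _⟩, _, hζ, K, K.coe_nonneg,
    fun p hp q hq => ?_⟩
  obtain ⟨hp1, hp2, hp3⟩ := hball p (Metric.ball_subset_ball (min_le_left _ _) hp)
  obtain ⟨hq1, hq2, hq3⟩ := hball q (Metric.ball_subset_ball (min_le_left _ _) hq)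
  have h1 := hKT.dist_le_mul _ hp1 _ hq1
  simp only [chartParam_centredChart hp2, chartParam_centredChart hq2, dist_eq_norm,
    h.log_exp p (Metric.ball_subset_ball (min_le_right _ _) hp),
    h.log_exp q (Metric.ball_subset_ball (min_le_right _ _) hq)] at h1
  rw [hp3, hq3, one_smul, one_smul]
  exact h1

theorem IsExpChart.isControlCurve_log [FiniteDimensional ℝ F] (h : IsExpChart ρ lg Ω)
    (hι : Function.Injective ι) (hN : IsEquivNorm N k k') {C : ℝ → G} {u : ℝ → F} {a b : ℝ} (hab : a ≤ b)
    (hC : IsHorizontalCurve 𝓘(ℝ, E) (leftFrame G ι) C u a b) (hΩ : ∀ t ∈ Icc a b, C t ∈ Ω)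
    (hac : ∀ l : E →L[ℝ] ℝ, AbsolutelyContinuousOnInterval (fun t => l (lg (C t))) a b)
    (hfin : ∫⁻ t in Icc a b, ENNReal.ofReal (N (u t)) ≠ ⊤) :
    IsControlCurve (fun x => (expFrame (modelBracket E G) x).comp ι) (fun t => lg (C t)) u a b ∧
      ∫ t in a..b, N (u t) = (∫⁻ t in Icc a b, ENNReal.ofReal (N (u t))).toReal := by
  have hc : ContinuousOn (fun t => lg (C t)) (Icc a b) :=
    h.contMDiffOn_log.continuousOn.comp hC.continuousOn hΩ
  have hmem : ∀ t ∈ Icc a b, lg (C t) ∈ Metric.ball (0 : E) ρ := fun t ht => h.log_mem _ (hΩ t ht)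
  obtain ⟨π', hπ⟩ := ι.toLinearMap.exists_leftInverse_of_injective (LinearMap.ker_eq_bot.2 hι)
  have hpsi : Continuous fun p => psi (modelBracket E G p) :=
    (contDiff_psi_bracket (modelBracket E G) (n := 0)).continuous
  refine isControlCurve_of_ae_hasDerivAt (B := fun t => π'.toContinuousLinearMap.comp
    (psi (modelBracket E G (lg (C t))))) hab hc hac ?_ ?_ ?_ (fun t ht w => ?_) hN hfin
  · filter_upwards [hC.hasMFDerivAt, ae_restrict_mem measurableSet_Ioo] with t ht htm
    have hm := hΩ t (Ioo_subset_Icc_self htm)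
    have h1 : HasMFDerivAt 𝓘(ℝ, E) 𝓘(ℝ, E) lg (C t) (mfderiv 𝓘(ℝ, E) 𝓘(ℝ, E) lg (C t)) :=
      ((h.contMDiffOn_log.contMDiffAt (h.isOpen.mem_nhds hm)).mdifferentiableAt
        (by simp)).hasMFDerivAt
    have h2 : HasFDerivAt (fun t => lg (C t)) (show ℝ →L[ℝ] E from _) t :=
      (HasMFDerivAt.comp t h1 ht).hasFDerivAt
    refine h2.hasDerivAt.congr_deriv ?_
    refine Eq.trans ?_ (h.mfderiv_log_leftField hm (ι (u t)))
    have key : ∀ v : E, (1 : ℝ) • v = v := one_smul ℝ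
    exact congrArg (mfderiv 𝓘(ℝ, E) 𝓘(ℝ, E) lg (C t)) (key _)
  · have h1 : ContinuousOn (expFrame (modelBracket E G)) (Metric.ball 0 ρ) := fun p hp => by
      obtain ⟨A', hA', -⟩ := hasFDerivAt_expFrame (h.isUnit_psi p hp)
      exact hA'.continuousAt.continuousWithinAt
    exact (h1.comp hc hmem).clm_comp continuousOn_const
  · exact continuousOn_const.clm_comp (hpsi.comp_continuousOn hc)
  · simp only [ContinuousLinearMap.comp_apply]
    rw [psi_expFrame (h.isUnit_psi _ (hmem t ht))]
    exact LinearMap.congr_fun hπ w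

theorem modelBracket_anti (x y : E) : modelBracket E G x y = -modelBracket E G y x := by
  rw [modelBracket, normedBracket_apply, normedBracket_apply, ← lie_skew, map_neg]

theorem modelBracket_jacobi (x y z : E) : modelBracket E G x (modelBracket E G y z) =
    modelBracket E G (modelBracket E G x y) z + modelBracket E G y (modelBracket E G x z) := by
  simp only [modelBracket, normedBracket_apply, LinearEquiv.symm_apply_apply, ← map_add]
  rw [leibniz_lie]

theorem IsExpChart.exists_boundedLip (h : IsExpChart ρ lg Ω) {r : ℝ} (hr : r < ρ) :
    ∃ K, BoundedLip (expFrame (modelBracket E G)) r K := by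
  obtain ⟨s₀, hs₀, K, hK, H⟩ := exists_frameOn_expFrame (br := fun _ => modelBracket E G)
    contDiff_const (fun _ => modelBracket_anti) (fun _ => modelBracket_jacobi) r
    (fun x hx => h.isUnit_psi x (by simpa using hx.trans_lt hr))
  obtain ⟨⟨A', hA'⟩, -⟩ := H 0 ⟨le_rfl, hs₀.le⟩
  exact ⟨K, hA'.toBoundedLip⟩

variable [T2Space G]

/-- A continuity argument. As long as the curve stays in the image of the closed ball, its logarithm
is a control curve and moves by at most a constant times the length, so it stays in the open ball.
-/
theorem IsExpChart.exists_lift [FiniteDimensional ℝ F] (h : IsExpChart ρ lg Ω)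
    (hι : Function.Injective ι) (hN : IsEquivNorm N k k') : ∃ r ∈ Ioo 0 ρ, ∃ K, 0 ≤ K ∧
      ∀ (C : ℝ → G) (u : ℝ → F) (a b : ℝ), a ≤ b →
      IsHorizontalCurve 𝓘(ℝ, E) (leftFrame G ι) C u a b → ∀ p : E, C a = modelExp G p →
      ∫⁻ t in Icc a b, ENNReal.ofReal (N (u t)) ≠ ⊤ →
      ‖p‖ + K * (∫⁻ t in Icc a b, ENNReal.ofReal (N (u t))).toReal < r →
      IsControlCurve (fun x => (expFrame (modelBracket E G) x).comp ι) (fun t => lg (C t)) u a b ∧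
      ∫ t in a..b, N (u t) = (∫⁻ t in Icc a b, ENNReal.ofReal (N (u t))).toReal ∧
      lg (C a) = p ∧ ∀ t ∈ Icc a b, C t ∈ Ω ∧
        ‖lg (C t) - p‖ ≤ K * (∫⁻ t in Icc a b, ENNReal.ofReal (N (u t))).toReal := by
  obtain ⟨ρ', hρ', ζ, hζ, M, hM, hb⟩ := h.exists_smooth_bound modelExp_zero
  obtain ⟨hρ0, hρρ⟩ := hρ'
  set r := ρ' / 2 with hr
  have hrρ : r < ρ := by linarith
  obtain ⟨K', hK'⟩ := h.exists_boundedLip hrρ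
  have hbl := hK'.comp_right ι
  set K₁ := K' * ‖ι‖
  have hK₁ : 0 ≤ K₁ := hbl.nonneg
  have hk := hN.pos
  refine ⟨r, ⟨by positivity, hrρ⟩, K₁ / k, by positivity, fun C u a b hab hC p hCa hfin hp => ?_⟩
  set ℓ := (∫⁻ t in Icc a b, ENNReal.ofReal (N (u t))).toReal with hℓ
  have hℓ0 : 0 ≤ ℓ := ENNReal.toReal_nonneg
  have hsub : Metric.closedBall (0 : E) r ⊆ Metric.ball 0 ρ := Metric.closedBall_subset_ball hrρ
  have hsub' : Metric.closedBall (0 : E) r ⊆ Metric.ball 0 ρ' :=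
    Metric.closedBall_subset_ball (by linarith)
  have hpr : ‖p‖ < r := by
    have : 0 ≤ K₁ / k * ℓ := by positivity
    linarith
  have hpm : p ∈ Metric.ball (0 : E) ρ := by simpa using hpr.trans hrρ
  have hlp : lg (C a) = p := by rw [hCa, h.log_exp p hpm]
  have step : ∀ t ∈ Icc a b, (∀ s ∈ Icc a t, C s ∈ modelExp G '' Metric.closedBall (0 : E) r) →
      IsControlCurve (fun x => (expFrame (modelBracket E G) x).comp ι) (fun t => lg (C t)) u a t ∧
      ∫ t in a..t, N (u t) = (∫⁻ s in Icc a t, ENNReal.ofReal (N (u s))).toReal ∧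
      ∀ s ∈ Icc a t, C s ∈ Ω ∧ ‖lg (C s) - p‖ ≤ K₁ / k * ℓ := by
    intro t ht hs
    have hΩ : ∀ s ∈ Icc a t, C s ∈ Ω := fun s hst => by
      obtain ⟨q, hq, hqs⟩ := hs s hst
      rw [← hqs]; exact h.exp_mem q (hsub hq)
    have hle : ∫⁻ s in Icc a t, ENNReal.ofReal (N (u s)) ≤
        ∫⁻ s in Icc a b, ENNReal.ofReal (N (u s)) :=
      lintegral_mono_set (Icc_subset_Icc_right ht.2)
    have hCt := hC.mono ht
    obtain ⟨h1, h2⟩ := h.isControlCurve_log hι hN ht.1 hCt hΩ (fun l => by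
      refine AbsolutelyContinuousOnInterval.of_norm_le (f := fun s => ζ (C s)) (K := ‖l‖ * M)
        (by positivity) (fun l' => hCt.absolutelyContinuous (fun g => l' (ζ g))
          (l'.contMDiff.comp hζ)) fun s hst s' hst' => ?_
      rw [uIcc_of_le ht.1] at hst hst'
      obtain ⟨q, hq, hqs⟩ := hs s hst
      obtain ⟨q', hq', hqs'⟩ := hs s' hst'
      rw [← map_sub, mul_assoc]
      refine (l.le_opNorm _).trans (mul_le_mul_of_nonneg_left ?_ (norm_nonneg _))
      rw [← hqs, ← hqs', h.log_exp q (hsub hq), h.log_exp q' (hsub hq')]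
      exact hb q (hsub' hq) q' (hsub' hq')) (ne_top_of_le_ne_top hfin hle)
    refine ⟨h1, h2, ?_⟩
    have hu : ∫ s in a..t, ‖u s‖ ≤ k⁻¹ * ℓ := by
      have hNi : IntervalIntegrable (fun s => N (u s)) volume a t := by
        refine (h1.intervalIntegrable.norm.const_mul k').mono_fun
          (hN.continuous.comp_aestronglyMeasurable h1.intervalIntegrable.def'.aestronglyMeasurable)
          (Eventually.of_forall fun s => ?_)
        refine (Real.norm_of_nonneg (hN.nonneg _)).le.trans ?_
        exact (hN.norm_le _).trans (le_abs_self _)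
      calc ∫ s in a..t, ‖u s‖ ≤ ∫ s in a..t, k⁻¹ * N (u s) := by
            refine intervalIntegral.integral_mono_on ht.1 h1.intervalIntegrable.norm
              (hNi.const_mul _) fun s _ => ?_
            rw [← div_eq_inv_mul, le_div_iff₀ hk, mul_comm]
            exact hN.le_norm _
        _ = k⁻¹ * ∫ s in a..t, N (u s) := intervalIntegral.integral_const_mul _ _
        _ ≤ k⁻¹ * ℓ := by
            rw [h2]
            gcongr
            exact ENNReal.toReal_mono hfin hle
    have hKu : K₁ * ∫ s in a..t, ‖u s‖ ≤ K₁ / k * ℓ := by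
      rw [div_eq_mul_inv, mul_assoc K₁]
      exact mul_le_mul_of_nonneg_left hu hK₁
    have h3 := h1.norm_sub_le hbl ht.1 (by rw [hlp]; linarith)
    intro s hst
    refine ⟨hΩ s hst, ?_⟩
    have := h3 s hst
    rw [hlp] at this
    exact this.trans hKu
  have hO : IsOpen (Ω ∩ lg ⁻¹' Metric.ball 0 r) :=
    h.contMDiffOn_log.continuousOn.isOpen_inter_preimage h.isOpen Metric.isOpen_ball
  have hOK : Ω ∩ lg ⁻¹' Metric.ball 0 r ⊆ modelExp G '' Metric.closedBall (0 : E) r := fun g hg =>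
    ⟨lg g, Metric.ball_subset_closedBall hg.2, h.exp_log g hg.1⟩
  -- Compact, hence closed since `G` is Hausdorff. So the curve still lies in this image at the
  -- first exit time itself, where the bound of `step` gives the contradiction.
  have hKc : IsClosed (modelExp G '' Metric.closedBall (0 : E) r) :=
    ((isCompact_closedBall _ _).image_of_continuousOn (h.contMDiffOn.continuousOn.mono hsub)).isClosed
  have hall : ∀ t ∈ Icc a b, C t ∈ Ω ∩ lg ⁻¹' Metric.ball 0 r := by
    by_contra! hcon
    set Z := Icc a b ∩ C ⁻¹' (Ω ∩ lg ⁻¹' Metric.ball 0 r)ᶜ with hZ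
    have hZc : IsCompact Z := isCompact_Icc.of_isClosed_subset
      (hC.continuousOn.preimage_isClosed_of_isClosed isClosed_Icc hO.isClosed_compl)
      inter_subset_left
    have hZn : Z.Nonempty := by obtain ⟨t, ht, ht'⟩ := hcon; exact ⟨t, ht, ht'⟩
    have ht₁ := hZc.sInf_mem hZn
    set t₁ := sInf Z
    have hlt : ∀ s ∈ Ico a t₁, C s ∈ Ω ∩ lg ⁻¹' Metric.ball 0 r := fun s hs => by
      by_contra hns
      exact absurd (csInf_le hZc.bddBelow (show s ∈ Z from
        ⟨⟨hs.1, hs.2.le.trans ht₁.1.2⟩, hns⟩)) (not_le.2 hs.2)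
    have ha : a < t₁ := by
      refine lt_of_le_of_ne ht₁.1.1 fun hat => ht₁.2 ?_
      rw [← hat]
      refine ⟨hCa ▸ h.exp_mem p hpm, ?_⟩
      rw [mem_preimage, hlp]
      simpa using hpr
    have hcl : Icc a t₁ ⊆ Icc a b ∩ C ⁻¹' (modelExp G '' Metric.closedBall (0 : E) r) := by
      rw [← closure_Ico ha.ne]
      refine closure_minimal (fun s hs => ⟨⟨hs.1, hs.2.le.trans ht₁.1.2⟩, hOK (hlt s hs)⟩)
        (hC.continuousOn.preimage_isClosed_of_isClosed isClosed_Icc hKc)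
    obtain ⟨-, -, h3⟩ := step t₁ ht₁.1 fun s hs => (hcl hs).2
    obtain ⟨h4, h5⟩ := h3 t₁ ⟨ha.le, le_rfl⟩
    refine ht₁.2 ⟨h4, ?_⟩
    rw [mem_preimage, mem_ball_zero_iff]
    have := norm_le_norm_add_norm_sub' (lg (C t₁)) p
    linarith
  obtain ⟨h1, h2, h3⟩ := step b ⟨hab, le_rfl⟩ fun s hs => hOK (hall s hs)
  exact ⟨h1, h2, hlp, h3⟩

end Lift

/-! ### The rescaled Carnot–Carathéodory distances as a frame family -/

section Dilation

variable {V : Type*} [NormedAddCommGroup V] [NormedSpace ℝ V] [CompleteSpace V]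
  {F : Type*} [NormedAddCommGroup F] [NormedSpace ℝ F]

/-- The dilation intertwines the two adjoint maps, hence their images under `psi`, hence the
inverses. If one of these is not invertible neither is the other, and both frames are `0` by
convention. -/
theorem FilteredBracket.dilation_expFrame {n : ℕ} {b : V →L[ℝ] V →L[ℝ] V} {P : ℕ → V →L[ℝ] V}
    (h : FilteredBracket n b P) (s : ℝ) {t : ℝ} (ht : t ≠ 0) (p v : V) :
    dilation n P t (expFrame (bracketFamily n b P (s * t)) p v) =
      expFrame (bracketFamily n b P s) (dilation n P t p) (dilation n P t v) := by
  set T := dilation n P t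
  set S := dilation n P t⁻¹
  set M := psi (bracketFamily n b P (s * t) p)
  set M' := psi (bracketFamily n b P s (T p))
  have hTM : ∀ x, T (M x) = M' (T x) := fun x =>
    psi_intertwine (ContinuousLinearMap.ext fun y => h.dilation_bracketFamily s t p y) x
  let τ : (V →L[ℝ] V)ˣ := ⟨T, S, ContinuousLinearMap.ext (h.dilation_dilation_inv ht),
    ContinuousLinearMap.ext (h.dilation_inv_dilation ht)⟩
  have hMM : (τ : V →L[ℝ] V) * M * (τ⁻¹ : (V →L[ℝ] V)ˣ) = M' := ContinuousLinearMap.ext fun x => by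
    refine (hTM (S x)).trans ?_
    rw [h.dilation_dilation_inv ht]
  by_cases hM : IsUnit M
  · have hM' : IsUnit M' := by rwa [← hMM, Units.isUnit_mul_units, Units.isUnit_units_mul]
    rw [← psi_expFrame (br := bracketFamily n b P (s * t)) (p := p) hM v, hTM]
    rw [expFrame_psi (br := bracketFamily n b P s) (p := T p) hM', psi_expFrame hM]
  · have hM' : ¬ IsUnit M' := by rwa [← hMM, Units.isUnit_mul_units, Units.isUnit_units_mul]
    rw [expFrame, expFrame, Ring.inverse_non_unit _ hM, Ring.inverse_non_unit _ hM']
    simp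

theorem IsControlCurve.map {A A' : V → F →L[ℝ] V} {c : ℝ → V} {u : ℝ → F} {a b : ℝ} (hab : a ≤ b)
    (hc : IsControlCurve A c u a b) (hA : ContinuousOn (fun t => A (c t)) (Icc a b)) (T : V →L[ℝ] V)
    (k : ℝ) (hT : ∀ t ∈ Icc a b, ∀ w, T (A (c t) w) = A' (T (c t)) (k • w)) :
    IsControlCurve A' (fun t => T (c t)) (fun t => k • u t) a b where
  continuousOn := T.continuous.comp_continuousOn hc.continuousOn
  intervalIntegrable := hc.intervalIntegrable.smul k
  eq_integral t ht := by
    have h1 : IntervalIntegrable (fun t => A (c t) (u t)) volume a t :=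
      intervalIntegrable_clm_apply ht.1 (hA.mono (Icc_subset_Icc_right ht.2))
        (hc.intervalIntegrable.mono_set (by
          rw [uIcc_of_le ht.1, uIcc_of_le hab]; exact Icc_subset_Icc_right ht.2))
    rw [hc.eq_integral t ht, map_add, ← T.intervalIntegral_comp_comm h1]
    congr 1
    refine intervalIntegral.integral_congr fun s hs => ?_
    rw [uIcc_of_le ht.1] at hs
    exact hT s ⟨hs.1, hs.2.trans ht.2⟩ _

theorem IsEquivNorm.integral_norm_le {N : F → ℝ} {k k' : ℝ} (hN : IsEquivNorm N k k')
    {u : ℝ → F} {a b : ℝ} (hab : a ≤ b) (hu : IntervalIntegrable u volume a b) :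
    k * ∫ s in a..b, ‖u s‖ ≤ ∫ s in a..b, N (u s) := by
  have hNi : IntervalIntegrable (fun s => N (u s)) volume a b := by
    refine (hu.norm.const_mul k').mono_fun
      (hN.continuous.comp_aestronglyMeasurable hu.def'.aestronglyMeasurable)
      (Eventually.of_forall fun s => ?_)
    refine (Real.norm_of_nonneg (hN.nonneg _)).le.trans ?_
    exact (hN.norm_le _).trans (le_abs_self _)
  rw [← intervalIntegral.integral_const_mul]
  exact intervalIntegral.integral_mono_on hab (hu.norm.const_mul _) hNi fun s _ => hN.le_norm _

end Dilation

/-! ### The rescaled distances and their control curves. -/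

section Scaled

variable {E : Type*} [NormedAddCommGroup E] [NormedSpace ℝ E]
  {G : Type*} [TopologicalSpace G] [ChartedSpace E G] [Group G]
  {F : Type*} [NormedAddCommGroup F] [NormedSpace ℝ F]

variable {n : ℕ} {P : ℕ → E →L[ℝ] E} {ι : F →L[ℝ] E} {N : F → ℝ} {k k' : ℝ}

variable (G) in
/-- The Carnot–Carathéodory distance of the left-invariant horizontal frame. -/
noncomputable def leftDist (ι : F →L[ℝ] E) (N : F → ℝ) (g h : G) : ℝ≥0∞ :=
  ccEDist 𝓘(ℝ, E) (leftFrame G ι) N g h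

/-- The Carnot–Carathéodory distance of the frame of `br` in exponential coordinates. -/
noncomputable def frameDist (br : E →L[ℝ] E →L[ℝ] E) (ι : F →L[ℝ] E) (N : F → ℝ) (p q : E) : ℝ≥0∞ :=
  ccEDist 𝓘(ℝ, E) (fun (p : E) (u : F) => (show TangentSpace 𝓘(ℝ, E) p from expFrame br p (ι u))) N p q

theorem leftField_neg (g : G) (v : E) : leftField G g (-v) = -leftField G g v :=
  map_neg (mfderiv 𝓘(ℝ, E) 𝓘(ℝ, E) (fun x => g * x) 1) v

theorem leftDist_comm (hN : IsEquivNorm N k k') (g h : G) : leftDist G ι N g h = leftDist G ι N h g :=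
  ccEDist_comm (fun p v => by rw [leftFrame, map_neg, leftField_neg]; rfl)
    (fun v => by simpa using hN.smul (-1) v) g h

theorem leftDist_triangle (g h i : G) : leftDist G ι N g i ≤ leftDist G ι N g h + leftDist G ι N h i :=
  ccEDist_triangle g h i

theorem frameDist_comm (hN : IsEquivNorm N k k') (br : E →L[ℝ] E →L[ℝ] E) (p q : E) :
    frameDist br ι N p q = frameDist br ι N q p :=
  ccEDist_comm (fun p v => by rw [map_neg, map_neg]; rfl) (fun v => by simpa using hN.smul (-1) v) p q

theorem lintegral_eq_ofReal_integral (hN : IsEquivNorm N k k') {u : ℝ → F} (hu : Continuous u)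
    {a b : ℝ} (hab : a ≤ b) : ∫⁻ t in Icc a b, ENNReal.ofReal (N (u t)) =
      ENNReal.ofReal (∫ t in a..b, N (u t)) := by
  rw [intervalIntegral.integral_of_le hab, ← integral_Icc_eq_integral_Ioc,
    ofReal_integral_eq_lintegral_ofReal]
  · exact (hN.continuous.comp hu).continuousOn.integrableOn_Icc
  · exact Eventually.of_forall fun t => hN.nonneg _

variable [LieGroup 𝓘(ℝ, E) ∞ G]

theorem IsHorizontalCurve.mul_left {C : ℝ → G} {u : ℝ → F} {a b : ℝ}
    (h : IsHorizontalCurve 𝓘(ℝ, E) (leftFrame G ι) C u a b) (g : G) :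
    IsHorizontalCurve 𝓘(ℝ, E) (leftFrame G ι) (fun t => g * C t) u a b where
  continuousOn := (contMDiff_mul_left (I := 𝓘(ℝ, E)) (n := ∞) (a := g)).continuous.comp_continuousOn
    h.continuousOn
  absolutelyContinuous f hf := h.absolutelyContinuous (fun x => f (g * x))
    (hf.comp (contMDiff_mul_left (I := 𝓘(ℝ, E)) (n := ∞) (a := g)))
  hasMFDerivAt := by
    filter_upwards [h.hasMFDerivAt] with t ht
    have h2 : HasMFDerivAt 𝓘(ℝ, E) 𝓘(ℝ, E) (fun x => g * x) (C t) _ :=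
      (((contMDiff_mul_left (I := 𝓘(ℝ, E)) (n := ∞) (a := g)).contMDiffAt).mdifferentiableAt
        (by simp)).hasMFDerivAt
    refine (HasMFDerivAt.comp t h2 ht).congr_mfderiv (ContinuousLinearMap.ext fun r => ?_)
    exact (map_smul (mfderiv 𝓘(ℝ, E) 𝓘(ℝ, E) (fun x => g * x) (C t)) (show ℝ from r) _).trans
      (congrArg (fun v : E => (show ℝ from r) • v)
        (mfderiv_mul_left_mulInvariantVectorField _ g (C t)))

theorem leftDist_mul_left (g x y : G) : leftDist G ι N (g * x) (g * y) = leftDist G ι N x y := by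
  have key : ∀ g x y : G, leftDist G ι N (g * x) (g * y) ≤ leftDist G ι N x y := fun g x y => by
    refine le_of_forall_gt fun l hl => ?_
    obtain ⟨c, u, a, b, hab, h, rfl, rfl, hlt⟩ := ccEDist_lt_iff.1 hl
    exact ccEDist_lt_iff.2 ⟨_, u, a, b, hab, h.mul_left g, rfl, rfl, hlt⟩
  refine le_antisymm (key g x y) ?_
  have := key g⁻¹ (g * x) (g * y)
  rwa [inv_mul_cancel_left, inv_mul_cancel_left] at this

variable [FiniteDimensional ℝ E] [CompleteSpace E]

/-- A norm on the image of `ι`, which is the summand of degree one of a filtration of the Lie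
algebra of `G`. -/
structure HorizontalNorm (G : Type*) [TopologicalSpace G] [ChartedSpace E G] [Group G]
    [LieGroup 𝓘(ℝ, E) ∞ G] (n : ℕ) (P : ℕ → E →L[ℝ] E) (ι : F →L[ℝ] E) (N : F → ℝ)
    (k k' : ℝ) : Prop where
  bracket : FilteredBracket n (modelBracket E G) P
  injective : Function.Injective ι
  proj_ι : ∀ u, P 1 (ι u) = ι u
  exists_ι : ∀ x, ∃ u, P 1 x = ι u
  norm : IsEquivNorm N k k'

open Classical in
variable (G) in
/-- The distance `s⁻¹ d(exp (δₛ p), exp (δₛ q))` for `s ≠ 0`, and the limit distance for `s = 0`. -/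
noncomputable def scaledDist (n : ℕ) (P : ℕ → E →L[ℝ] E) (ι : F →L[ℝ] E) (N : F → ℝ) (s : ℝ)
    (p q : E) : ℝ≥0∞ :=
  if s = 0 then frameDist (bracketFamily n (modelBracket E G) P 0) ι N p q
  else ENNReal.ofReal s⁻¹ *
    leftDist G ι N (modelExp G (dilation n P s p)) (modelExp G (dilation n P s q))

theorem HorizontalNorm.dilation_ι (h : HorizontalNorm G n P ι N k k') (s : ℝ) (u : F) :
    dilation n P s (ι u) = ι (s • u) := by
  rw [h.bracket.dilation_of_degree_one s (h.proj_ι u), map_smul]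

theorem HorizontalNorm.dilation_frame (h : HorizontalNorm G n P ι N k k') (s : ℝ) {t : ℝ}
    (ht : t ≠ 0) (p : E) (u : F) :
    dilation n P t (expFrame (bracketFamily n (modelBracket E G) P (s * t)) p (ι u)) =
      expFrame (bracketFamily n (modelBracket E G) P s) (dilation n P t p) (ι (t • u)) := by
  rw [h.bracket.dilation_expFrame s ht, h.dilation_ι]

theorem HorizontalNorm.continuous_expFrame_zero (h : HorizontalNorm G n P ι N k k') :
    Continuous (expFrame (bracketFamily n (modelBracket E G) P 0)) :=
  continuous_iff_continuousAt.2 fun p => by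
    obtain ⟨A', hA', -⟩ := hasFDerivAt_expFrame (h.bracket.isUnit_psi_zero p)
    exact hA'.continuousAt

theorem IsExpChart.continuousOn_expFrame {ρ : ℝ} {lg : G → E} {Ω : Set G} (hX : IsExpChart ρ lg Ω) :
    ContinuousOn (expFrame (modelBracket E G)) (Metric.ball 0 ρ) := fun p hp => by
  obtain ⟨A', hA', -⟩ := hasFDerivAt_expFrame (hX.isUnit_psi p hp)
  exact hA'.continuousAt.continuousWithinAt

/-- For `s > 0` the dilation turns a curve of the rescaled frame into a curve of the original one
with control `s • u`, which the exponential map carries to `G`. The factor `s` in the length cancels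
the `s⁻¹` of the rescaled distance. -/
theorem HorizontalNorm.arc_le (h : HorizontalNorm G n P ι N k k') {ρ : ℝ} {lg : G → E} {Ω : Set G}
    (hX : IsExpChart ρ lg Ω) {s : ℝ} (hs : 0 ≤ s) {c : ℝ → E} {u : ℝ → F} {a b : ℝ} (hab : a ≤ b)
    (hu : Continuous u) (hc : ∀ t ∈ Icc a b, HasDerivWithinAt c
      (expFrame (bracketFamily n (modelBracket E G) P s) (c t) (ι (u t))) (Icc a b) t)
    (hcρ : ∀ t ∈ Icc a b, dilation n P s (c t) ∈ Metric.ball (0 : E) ρ) :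
    scaledDist G n P ι N s (c a) (c b) ≤ ENNReal.ofReal (∫ t in a..b, N (u t)) := by
  have hcc : ContinuousOn c (Icc a b) := fun t ht => (hc t ht).continuousWithinAt
  rcases hs.eq_or_lt with rfl | hs
  · rw [scaledDist, if_pos rfl, ← lintegral_eq_ofReal_integral h.norm hu hab]
    have h1 := IsHorizontalCurve.of_hasDerivWithinAt (I := 𝓘(ℝ, E)) (M := E) (Q := id) (F := F)
      (X := fun (p : E) (u : F) => (show TangentSpace 𝓘(ℝ, E) p from
        expFrame (bracketFamily n (modelBracket E G) P 0) p (ι u))) (u := u)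
      isOpen_univ contMDiffOn_id hab hc
      ((h.continuous_expFrame_zero.comp_continuousOn hcc).clm_apply
        (ι.continuous.comp hu).continuousOn) (fun t _ => mem_univ _) (fun t _ => by
          rw [mfderiv_id]; rfl)
    exact ccEDist_le hab h1
  · have hne := hs.ne'
    rw [scaledDist, if_neg hne]
    have hd : ∀ t ∈ Icc a b, HasDerivWithinAt (fun t => dilation n P s (c t))
        (expFrame (modelBracket E G) (dilation n P s (c t)) (ι (s • u t))) (Icc a b) t := by
      intro t ht
      have h1 := (dilation n P s).hasFDerivAt.comp_hasDerivWithinAt t (hc t ht)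
      have h2 := h.dilation_frame 1 hne (c t) (u t)
      rw [one_mul, h.bracket.bracketFamily_one] at h2
      rwa [h2] at h1
    have hdc : ContinuousOn (fun t => dilation n P s (c t)) (Icc a b) := fun t ht =>
      (hd t ht).continuousWithinAt
    have h1 := IsHorizontalCurve.of_hasDerivWithinAt (I := 𝓘(ℝ, E)) (F := F)
      (X := leftFrame G ι) (u := fun t => s • u t) Metric.isOpen_ball hX.contMDiffOn hab hd
      ((hX.continuousOn_expFrame.comp hdc hcρ).clm_apply
        (ι.continuous.comp (hu.const_smul s)).continuousOn) hcρ
      (fun t ht => hX.mfderiv_exp_expFrame (hcρ t ht) _)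
    have h2 := ccEDist_le (N := N) hab h1
    have hsu : Continuous fun t => s • u t := hu.const_smul s
    rw [lintegral_eq_ofReal_integral h.norm hsu hab] at h2
    simp only [h.norm.smul, abs_of_pos hs, intervalIntegral.integral_const_mul] at h2
    refine (mul_le_mul_right h2 _).trans (le_of_eq ?_)
    rw [← ENNReal.ofReal_mul (by positivity), inv_mul_cancel_left₀ hne]

theorem HorizontalNorm.exists_controlCurve_zero (h : HorizontalNorm G n P ι N k k') {p q : E} {l : ℝ}
    (hl : scaledDist G n P ι N 0 p q < ENNReal.ofReal l) :
    ∃ (c : ℝ → E) (u : ℝ → F) (a b : ℝ), a ≤ b ∧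
      IsControlCurve (fun x => (expFrame (bracketFamily n (modelBracket E G) P 0) x).comp ι) c u a b ∧
      c a = p ∧ c b = q ∧ ∫ t in a..b, N (u t) < l ∧ ContinuousOn
        (fun t => (expFrame (bracketFamily n (modelBracket E G) P 0) (c t)).comp ι) (Icc a b) := by
  rw [scaledDist, if_pos rfl] at hl
  obtain ⟨c, u, a, b, hab, hc, hca, hcb, hlt⟩ := ccEDist_lt_iff.1 hl
  obtain ⟨π', hπ⟩ := ι.toLinearMap.exists_leftInverse_of_injective (LinearMap.ker_eq_bot.2 h.injective)
  have hcont : ContinuousOn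
      (fun t => (expFrame (bracketFamily n (modelBracket E G) P 0) (c t)).comp ι) (Icc a b) :=
    (h.continuous_expFrame_zero.comp_continuousOn hc.continuousOn).clm_comp continuousOn_const
  obtain ⟨h1, h2⟩ := isControlCurve_of_ae_hasDerivAt (u := u)
    (A := fun x => (expFrame (bracketFamily n (modelBracket E G) P 0) x).comp ι)
    (B := fun t => π'.toContinuousLinearMap.comp
    (psi (bracketFamily n (modelBracket E G) P 0 (c t)))) hab hc.continuousOn
    (fun l => hc.absolutelyContinuous l l.contMDiff) (by
      filter_upwards [hc.hasMFDerivAt] with t ht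
      have h2 : HasFDerivAt c (show ℝ →L[ℝ] E from _) t := ht.hasFDerivAt
      refine h2.hasDerivAt.congr_deriv ?_
      have key : ∀ v : E, (1 : ℝ) • v = v := one_smul ℝ
      exact key _) hcont
    (continuousOn_const.clm_comp ((contDiff_psi_bracket (bracketFamily n (modelBracket E G) P 0)
      (n := 0)).continuous.comp_continuousOn hc.continuousOn)) (fun t _ w => by
      simp only [ContinuousLinearMap.comp_apply]
      rw [psi_expFrame (h.bracket.isUnit_psi_zero _)]
      exact LinearMap.congr_fun hπ w) h.norm (ne_top_of_lt hlt)
  refine ⟨c, u, a, b, hab, h1, hca, hcb, ?_, hcont⟩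
  rw [h2]
  exact (ENNReal.lt_ofReal_iff_toReal_lt (ne_top_of_lt hlt)).1 hlt

theorem HorizontalNorm.exists_dilation_mem (h : HorizontalNorm G n P ι N k k') {ρ : ℝ} (hρ : 0 < ρ)
    (R : ℝ) : ∃ s₀ > 0, ∀ s ∈ Icc 0 s₀, ∀ x, ‖x‖ ≤ R → dilation n P s x ∈ Metric.ball (0 : E) ρ := by
  obtain ⟨M, hM, hMd⟩ := h.bracket.norm_dilation_le
  set s₀ := min 1 (ρ / (2 * (M * |R| + 1))) with hs₀
  refine ⟨s₀, by positivity, fun s hs x hx => ?_⟩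
  rw [mem_ball_zero_iff]
  refine (hMd s ⟨hs.1, hs.2.trans (min_le_left _ _)⟩ _).trans_lt ?_
  have h1 := hs.2.trans (min_le_right _ _)
  rw [le_div_iff₀ (by positivity)] at h1
  have h2 : M * s * ‖x‖ ≤ s * (M * |R|) := by
    rw [mul_comm M, mul_assoc]
    have := hx.trans (le_abs_self R)
    exact mul_le_mul_of_nonneg_left (by gcongr) hs.1
  nlinarith [mul_nonneg hs.1 (show 0 ≤ M * |R| by positivity), hs.1]

/-- Frame bounds on a large ball would grow with the ball, so the scaling is used instead. The
dilation by `T⁻¹` maps the curve to one of the frame with parameter `s * T` and divides the controls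
by `T`. For `T` large, starting point and length fit into the unit ball, whose frame bound is fixed
beforehand. -/
theorem HorizontalNorm.exists_curve_bound (h : HorizontalNorm G n P ι N k k') (R L : ℝ)
    (hR : 0 ≤ R) (hL : 0 ≤ L) : ∃ R', ∃ s₀ > 0, ∀ s ∈ Icc 0 s₀,
    ∀ (c : ℝ → E) (u : ℝ → F) (a b : ℝ), a ≤ b →
      IsControlCurve (fun x => (expFrame (bracketFamily n (modelBracket E G) P s) x).comp ι) c u a b →
      ‖c a‖ ≤ R → ∫ t in a..b, N (u t) ≤ L → ContinuousOn
        (fun t => (expFrame (bracketFamily n (modelBracket E G) P s) (c t)).comp ι) (Icc a b) →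
      ∀ t ∈ Icc a b, ‖c t‖ ≤ R' := by
  obtain ⟨s₂, hs₂, K, hK, hfr⟩ := exists_frameOn_expFrame contDiff_bracketFamily
    h.bracket.bracketFamily_anti h.bracket.bracketFamily_jacobi 1
    (fun x _ => h.bracket.isUnit_psi_zero x)
  obtain ⟨M, hM, hMd⟩ := h.bracket.norm_dilation_le
  have hk := h.norm.pos
  set Z := M * R + K * ‖ι‖ * (L / k) with hZ
  have hZ0 : 0 ≤ Z := by positivity
  set T := 1 + Z with hT
  have hT0 : 0 < T := by positivity
  have hTne := hT0.ne'
  refine ⟨‖dilation n P T‖, s₂ / T, by positivity,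
    fun s hs c u a b hab hc hca hul hcA t ht => ?_⟩
  have hsT : s * T ∈ Icc 0 s₂ := ⟨mul_nonneg hs.1 hT0.le,
    (le_div_iff₀ hT0).1 hs.2⟩
  obtain ⟨⟨A', hA'⟩, -⟩ := hfr (s * T) hsT
  have hmap := hc.map hab hcA (A' := fun x =>
    (expFrame (bracketFamily n (modelBracket E G) P (s * T)) x).comp ι) (dilation n P T⁻¹) T⁻¹
    fun t _ w => by
      have e := h.dilation_frame (s * T) (inv_ne_zero hTne) (c t) w
      rwa [mul_inv_cancel_right₀ hTne] at e
  have hTi : T⁻¹ ∈ Icc (0 : ℝ) 1 := ⟨by positivity, inv_le_one_of_one_le₀ (by linarith)⟩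
  have e1 : ‖dilation n P T⁻¹ (c a)‖ ≤ T⁻¹ * (M * R) := by
    refine (hMd _ hTi _).trans ?_
    rw [mul_comm M, mul_assoc]
    gcongr
  have e2 : K * ‖ι‖ * ∫ t in a..b, ‖T⁻¹ • u t‖ ≤ T⁻¹ * (K * ‖ι‖ * (L / k)) := by
    have h1 := h.norm.integral_norm_le hab hc.intervalIntegrable
    have h2 : ∫ t in a..b, ‖u t‖ ≤ L / k := by
      rw [le_div_iff₀ hk, mul_comm]
      linarith
    simp only [norm_smul, intervalIntegral.integral_const_mul, Real.norm_of_nonneg hTi.1]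
    calc K * ‖ι‖ * (T⁻¹ * ∫ t in a..b, ‖u t‖) = T⁻¹ * (K * ‖ι‖ * ∫ t in a..b, ‖u t‖) := by ring
      _ ≤ _ := by gcongr
  have e3 : T⁻¹ * (M * R) + T⁻¹ * (K * ‖ι‖ * (L / k)) < 1 := by
    rw [← mul_add, inv_mul_lt_iff₀ hT0]
    linarith
  have h3 := hmap.norm_sub_le (hA'.toBoundedLip.comp_right ι) hab (by linarith) t ht
  have h4 : ‖dilation n P T⁻¹ (c t)‖ ≤ 1 := by
    have := norm_le_norm_add_norm_sub' (dilation n P T⁻¹ (c t)) (dilation n P T⁻¹ (c a))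
    linarith
  rw [← h.bracket.dilation_dilation_inv hTne (c t)]
  exact ((dilation n P T).le_opNorm _).trans (mul_le_of_le_one_right (norm_nonneg _) h4)

variable [T2Space G] [FiniteDimensional ℝ F]

/-- A curve in `G` of length below `s * l` is short enough to lift to the exponential chart when `s`
is small. Dilating the lift by `s⁻¹` gives a curve of the rescaled frame of length below `l`. -/
theorem HorizontalNorm.exists_controlCurve (h : HorizontalNorm G n P ι N k k') {ρ : ℝ} {lg : G → E}
    {Ω : Set G} (hX : IsExpChart ρ lg Ω) (R L : ℝ) (hR : 0 ≤ R) (hL : 0 ≤ L) :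
    ∃ s₀ > 0, ∀ s ∈ Ioc 0 s₀, ∀ p, ‖p‖ ≤ R → ∀ g, ∀ l ≤ L,
    leftDist G ι N (modelExp G (dilation n P s p)) g < ENNReal.ofReal (s * l) →
    ∃ (c : ℝ → E) (u : ℝ → F) (a b : ℝ), a ≤ b ∧
      IsControlCurve (fun x => (expFrame (bracketFamily n (modelBracket E G) P s) x).comp ι) c u a b ∧
      c a = p ∧ dilation n P s (c b) ∈ Metric.ball (0 : E) ρ ∧ modelExp G (dilation n P s (c b)) = g ∧
      ∫ t in a..b, N (u t) < l ∧ ContinuousOn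
        (fun t => (expFrame (bracketFamily n (modelBracket E G) P s) (c t)).comp ι) (Icc a b) := by
  obtain ⟨r, ⟨hr, hrρ⟩, K, hK, H⟩ := hX.exists_lift h.injective h.norm
  obtain ⟨M, hM, hMd⟩ := h.bracket.norm_dilation_le
  set s₀ := min 1 (r / (2 * (M * R + K * L + 1))) with hs₀
  have hs₀0 : 0 < s₀ := by positivity
  refine ⟨s₀, hs₀0, fun s hs p hp g l hl hlt' => ?_⟩
  have hs0 := hs.1
  have hne := hs0.ne'
  have hs1 : s ∈ Icc (0 : ℝ) 1 := ⟨hs.1.le, hs.2.trans (min_le_left _ _)⟩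
  have hsr : s * (M * R + K * L) < r := by
    have h1 := hs.2.trans (min_le_right _ _)
    rw [le_div_iff₀ (by positivity)] at h1
    nlinarith [mul_nonneg hs.1.le (show 0 ≤ M * R + K * L by positivity)]
  have hδ : ∀ x : E, ‖x‖ ≤ R → ‖dilation n P s x‖ ≤ s * (M * R) := fun x hx => by
    refine (hMd s hs1 x).trans ?_
    rw [mul_comm M s, mul_assoc]
    gcongr
  have hKL : 0 ≤ s * (K * L) := by positivity
  obtain ⟨C, u, a, b, hab, hC, hCa, hCb, hCl⟩ := ccEDist_lt_iff.1 hlt'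
  have hfin := ne_top_of_lt hCl
  have hreal := (ENNReal.lt_ofReal_iff_toReal_lt hfin).1 hCl
  obtain ⟨h1, h2, h3, h4⟩ := H C u a b hab hC _ hCa hfin (by
    have e1 := hδ p hp
    have e2 : K * (∫⁻ t in Icc a b, ENNReal.ofReal (N (u t))).toReal ≤ s * (K * L) := by
      calc _ ≤ K * (s * L) := by
            gcongr
            exact hreal.le.trans (by gcongr)
        _ = s * (K * L) := by ring
    nlinarith)
  have hcA : ContinuousOn (fun t => (expFrame (modelBracket E G) (lg (C t))).comp ι) (Icc a b) :=
    (hX.continuousOn_expFrame.comp h1.continuousOn fun t ht => hX.log_mem _ (h4 t ht).1).clm_comp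
      continuousOn_const
  have hdf : ∀ x : E, ∀ w, dilation n P s⁻¹ (((expFrame (modelBracket E G) x).comp ι) w) =
      ((expFrame (bracketFamily n (modelBracket E G) P s) (dilation n P s⁻¹ x)).comp ι) (s⁻¹ • w) := by
    intro x w
    have e := h.dilation_frame s (inv_ne_zero hne) x w
    rwa [mul_inv_cancel₀ hne, h.bracket.bracketFamily_one] at e
  refine ⟨fun t => dilation n P s⁻¹ (lg (C t)), fun t => s⁻¹ • u t, a, b, hab,
    h1.map hab hcA (dilation n P s⁻¹) s⁻¹ fun t _ w => hdf _ w, ?_, ?_, ?_, ?_, ?_⟩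
  · simp only [h3]
    exact h.bracket.dilation_inv_dilation hne p
  · simp only [h.bracket.dilation_dilation_inv hne]
    exact hX.log_mem _ (h4 b ⟨hab, le_rfl⟩).1
  · simp only [h.bracket.dilation_dilation_inv hne]
    rw [hX.exp_log _ (h4 b ⟨hab, le_rfl⟩).1, hCb]
  · simp only [h.norm.smul, intervalIntegral.integral_const_mul, abs_of_pos (inv_pos.2 hs0)]
    rw [h2, inv_mul_lt_iff₀ hs0]
    exact hreal
  · refine (((ContinuousLinearMap.compL ℝ F E E (dilation n P s⁻¹)).continuous.comp_continuousOn
      hcA).const_smul s).congr fun t _ => ContinuousLinearMap.ext fun w => ?_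
    have e := hdf (lg (C t)) (s • w)
    rw [inv_smul_smul₀ hne] at e
    rw [← e, map_smul, map_smul]
    rfl


theorem HorizontalNorm.frameFamily (h : HorizontalNorm G n P ι N k k') {ρ : ℝ} {lg : G → E}
    {Ω : Set G} (hX : IsExpChart ρ lg Ω) :
    FrameFamily ι N (bracketFamily n (modelBracket E G) P)
      (fun s => expFrame (bracketFamily n (modelBracket E G) P s)) (scaledDist G n P ι N) where
  frame R := by
    obtain ⟨s₀, hs₀, K, hK, H⟩ := exists_frameOn_expFrame contDiff_bracketFamily
      h.bracket.bracketFamily_anti h.bracket.bracketFamily_jacobi R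
      (fun x _ => h.bracket.isUnit_psi_zero x)
    refine ⟨s₀, hs₀, K, hK, fun s hs => ⟨(H s hs).1, fun x hx => ?_, (H s hs).2.2⟩⟩
    obtain ⟨hu, hn⟩ := (H s hs).2.1 x hx
    obtain ⟨e, he, he'⟩ := exists_continuousLinearEquiv_expFrame hu
    exact ⟨e, he, he' ▸ hn⟩
  continuous_bracket := (contDiff_bracketFamily (m := 0)).continuous.continuousAt
  word ε hε := h.bracket.exists_basis_conjWord h.proj_ι h.exists_ι hε
  triangle s _ p q r := by
    simp only [scaledDist]
    split_ifs
    · exact ccEDist_triangle _ _ _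
    · rw [← mul_add]
      exact mul_le_mul_right (leftDist_triangle _ _ _) _
  arc_le R := by
    obtain ⟨s₀, hs₀, H⟩ := h.exists_dilation_mem hX.pos R
    exact ⟨s₀, hs₀, fun s hs c u a b hab hu hc hcR => h.arc_le hX hs.1 hab hu hc
      fun t ht => H s hs _ (hcR t ht)⟩
  lift R L := by
    obtain ⟨R', s₁, hs₁, H₁⟩ := h.exists_curve_bound |R| |L| (abs_nonneg _) (abs_nonneg _)
    obtain ⟨s₂, hs₂, H₂⟩ := h.exists_controlCurve hX |R| |L| (abs_nonneg _) (abs_nonneg _)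
    obtain ⟨s₃, hs₃, H₃⟩ := h.exists_dilation_mem hX.pos R
    refine ⟨R', min s₁ (min s₂ s₃), by positivity, fun s hs p q hp hq l hl hlt => ?_⟩
    have hsmall := hs.2
    rw [le_min_iff, le_min_iff] at hsmall
    obtain ⟨c, u, a, b, hab, hc, hca, hcb, hul, hcA⟩ : ∃ (c : ℝ → E) (u : ℝ → F) (a b : ℝ), a ≤ b ∧
        IsControlCurve (fun x => (expFrame (bracketFamily n (modelBracket E G) P s) x).comp ι)
        c u a b ∧ c a = p ∧ c b = q ∧ ∫ t in a..b, N (u t) < l ∧ ContinuousOn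
        (fun t => (expFrame (bracketFamily n (modelBracket E G) P s) (c t)).comp ι) (Icc a b) := by
      rcases hs.1.eq_or_lt with rfl | hs0
      · exact h.exists_controlCurve_zero hlt
      have hne := hs0.ne'
      rw [scaledDist, if_neg hne] at hlt
      have h2 := ENNReal.mul_lt_mul_right (show ENNReal.ofReal s ≠ 0 by simpa using hs0)
        ENNReal.ofReal_ne_top hlt
      rw [← mul_assoc, ← ENNReal.ofReal_mul hs.1, mul_inv_cancel₀ hne, ENNReal.ofReal_one,
        one_mul, ← ENNReal.ofReal_mul hs.1] at h2
      obtain ⟨c, u, a, b, hab, hc, hca, hm, hcb, hul, hcA⟩ := H₂ s ⟨hs0, hsmall.2.1⟩ p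
        (hp.trans (le_abs_self _)) _ l (hl.trans (le_abs_self _)) h2
      refine ⟨c, u, a, b, hab, hc, hca, ?_, hul, hcA⟩
      -- Both dilated points lie in the exponential chart, where taking logarithms identifies the
      -- end point of the lift with `q`.
      have h3 := congrArg lg hcb
      rw [hX.log_exp _ hm, hX.log_exp _ (H₃ s ⟨hs.1, hsmall.2.2⟩ q hq)] at h3
      rw [← h.bracket.dilation_inv_dilation hne (c b), h3, h.bracket.dilation_inv_dilation hne]
    exact ⟨c, u, a, b, hab, hc, hca, hcb, H₁ s ⟨hs.1, hsmall.1⟩ c u a b hab hc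
      (hca ▸ hp.trans (le_abs_self _)) (hul.le.trans (hl.trans (le_abs_self _))) hcA, hul⟩

end Scaled

/-! ### Metric geometry of the rescaled distances -/

section Metric

variable {V : Type*} [NormedAddCommGroup V] [NormedSpace ℝ V]
  {F : Type*} [NormedAddCommGroup F] [NormedSpace ℝ F]
  {ι : F →L[ℝ] V} {N : F → ℝ} {br : ℝ → V →L[ℝ] V →L[ℝ] V}
  {A : ℝ → V → V →L[ℝ] V} {d : ℝ → V → V → ℝ≥0∞} {k k' : ℝ}

/-- Points at distance `0` are joined by control curves of arbitrarily small length `l`, and such a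
curve moves by at most a constant times `l`. -/
theorem FrameFamily.eq_of_dist_eq_zero (h : FrameFamily ι N br A d) (hN : IsEquivNorm N k k') (R : ℝ) :
    ∃ s₀ > 0, ∀ s ∈ Icc 0 s₀, ∀ p q, ‖p‖ ≤ R → ‖q‖ ≤ R → d s p q = 0 → p = q := by
  obtain ⟨s₁, hs₁, K, hK, hfr⟩ := h.frame (R + 1)
  obtain ⟨R', s₂, hs₂, hlift⟩ := h.lift R 1
  have hk := hN.pos
  refine ⟨min s₁ s₂, by positivity, fun s hs p q hp hq hd => ?_⟩
  obtain ⟨⟨A', hA'⟩, -⟩ := hfr s ⟨hs.1, hs.2.trans (min_le_left _ _)⟩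
  set Q := K * ‖ι‖ / k + 1 with hQ
  have hQ0 : 0 < Q := by positivity
  have key : ∀ l > 0, l ≤ 1 → Q * l ≤ 1 / 2 → ‖q - p‖ ≤ Q * l := fun l hl hl1 hQl => by
    obtain ⟨c, u, a, b, hab, hc, rfl, rfl, -, hul⟩ := hlift s
      ⟨hs.1, hs.2.trans (min_le_right _ _)⟩ p q hp hq l hl1 (by rw [hd]; simpa using hl)
    have h1 := hN.integral_norm_le hab hc.intervalIntegrable
    have h2 : K * ‖ι‖ * ∫ t in a..b, ‖u t‖ ≤ Q * l := by
      have : ∫ t in a..b, ‖u t‖ ≤ l / k := by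
        rw [le_div_iff₀ hk]; linarith
      calc K * ‖ι‖ * ∫ t in a..b, ‖u t‖ ≤ K * ‖ι‖ * (l / k) := by gcongr
        _ = (K * ‖ι‖ / k) * l := by ring
        _ ≤ Q * l := by gcongr; linarith
    exact (hc.norm_sub_le (hA'.toBoundedLip.comp_right ι) hab (by linarith) b ⟨hab, le_rfl⟩).trans h2
  by_contra hne
  have hpos : 0 < ‖q - p‖ := norm_pos_iff.2 (sub_ne_zero.2 (Ne.symm hne))
  set l := min 1 (min (1 / (2 * Q)) (‖q - p‖ / (2 * Q))) with hl
  have hl0 : 0 < l := by positivity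
  have e1 : l ≤ 1 / (2 * Q) := (min_le_right _ _).trans (min_le_left _ _)
  have e2 : l ≤ ‖q - p‖ / (2 * Q) := (min_le_right _ _).trans (min_le_right _ _)
  rw [le_div_iff₀ (by positivity)] at e1 e2
  have := key l hl0 (min_le_left _ _) (by linarith)
  linarith

end Metric

/-! ### Metric properties of both spaces and pointed Gromov–Hausdorff convergence. -/

section Convergence

variable {E : Type*} [NormedAddCommGroup E] [NormedSpace ℝ E] [FiniteDimensional ℝ E]
  [CompleteSpace E]
  {G : Type*} [TopologicalSpace G] [ChartedSpace E G] [Group G] [LieGroup 𝓘(ℝ, E) ∞ G]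
  {F : Type*} [NormedAddCommGroup F] [NormedSpace ℝ F] {n : ℕ} {P : ℕ → E →L[ℝ] E}
  {ι : F →L[ℝ] E} {N : F → ℝ} {k k' : ℝ} {ρ : ℝ} {lg : G → E} {Ω : Set G}

theorem HorizontalNorm.scaledDist_zero_dilation_le (h : HorizontalNorm G n P ι N k k') {t : ℝ}
    (ht : 0 < t) (p q : E) : scaledDist G n P ι N 0 (dilation n P t p) (dilation n P t q) ≤
      ENNReal.ofReal t * scaledDist G n P ι N 0 p q := by
  have ht0 : ENNReal.ofReal t ≠ 0 := by simpa using ht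
  rw [scaledDist, scaledDist, if_pos rfl, if_pos rfl, mul_comm]
  rw [← ENNReal.div_le_iff ht0 ENNReal.ofReal_ne_top]
  refine le_of_forall_gt fun l hl => ?_
  obtain ⟨c, u, a, b, hab, hc, rfl, rfl, hlt⟩ := ccEDist_lt_iff.1 hl
  rw [ENNReal.div_lt_iff (Or.inl ht0) (Or.inl ENNReal.ofReal_ne_top)]
  have hc' : IsHorizontalCurve 𝓘(ℝ, E) (fun (p : E) (u : F) => (show TangentSpace 𝓘(ℝ, E) p from
      expFrame (bracketFamily n (modelBracket E G) P 0) p (ι u)))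
      (fun s => dilation n P t (c s)) (fun s => t • u s) a b := by
    refine ⟨(dilation n P t).continuous.comp_continuousOn hc.continuousOn, fun f hf =>
      hc.absolutelyContinuous (fun x => f (dilation n P t x))
        (hf.comp (dilation n P t).contMDiff), ?_⟩
    filter_upwards [hc.hasMFDerivAt] with s hs
    have h2 : HasFDerivAt c (show ℝ →L[ℝ] E from _) s := hs.hasFDerivAt
    have h3 := ((dilation n P t).hasFDerivAt.comp s h2).hasMFDerivAt
    refine h3.congr_mfderiv (ContinuousLinearMap.ext fun r => ?_)
    have e := h.dilation_frame 0 ht.ne' (c s) (u s)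
    rw [zero_mul] at e
    exact ((dilation n P t).map_smul (show ℝ from r) _).trans
      (congrArg (fun v : E => (show ℝ from r) • v) e)
  refine (ccEDist_le hab hc').trans_lt ?_
  have e : ∀ s, ENNReal.ofReal (N (t • u s)) = ENNReal.ofReal t * ENNReal.ofReal (N (u s)) :=
    fun s => by rw [h.norm.smul, abs_of_pos ht, ENNReal.ofReal_mul ht.le]
  simp only [e]
  rw [lintegral_const_mul' _ _ ENNReal.ofReal_ne_top, mul_comm]
  exact ENNReal.mul_lt_mul_left ht0 ENNReal.ofReal_ne_top hlt

theorem HorizontalNorm.exists_bound_of_scaledDist_zero (h : HorizontalNorm G n P ι N k k') {r : ℝ}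
    (hr : 0 ≤ r) : ∃ R, ∀ z, scaledDist G n P ι N 0 0 z < ENNReal.ofReal r → ‖z‖ ≤ R := by
  obtain ⟨R', s₁, hs₁, H₁⟩ := h.exists_curve_bound 0 r le_rfl hr
  refine ⟨R', fun z hz => ?_⟩
  obtain ⟨c, u, a, b, hab, hc, hca, rfl, hul, hcA⟩ := h.exists_controlCurve_zero hz
  exact H₁ 0 ⟨le_rfl, hs₁.le⟩ c u a b hab hc (by simp [hca]) hul.le hcA b ⟨hab, le_rfl⟩

variable [FiniteDimensional ℝ F] [T2Space G]

theorem HorizontalNorm.exists_bound_of_leftDist (h : HorizontalNorm G n P ι N k k')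
    (hX : IsExpChart ρ lg Ω) {r : ℝ} (hr : 0 ≤ r) : ∃ R, ∃ s₀ > 0, ∀ s ∈ Ioc 0 s₀, ∀ g,
      leftDist G ι N 1 g < ENNReal.ofReal (s * r) →
      ∃ q, ‖q‖ ≤ R ∧ dilation n P s q ∈ Metric.ball (0 : E) ρ ∧ modelExp G (dilation n P s q) = g := by
  obtain ⟨R', s₁, hs₁, H₁⟩ := h.exists_curve_bound 0 r le_rfl hr
  obtain ⟨s₂, hs₂, H₂⟩ := h.exists_controlCurve hX 0 r le_rfl hr
  refine ⟨R', min s₁ s₂, by positivity, fun s hs g hg => ?_⟩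
  obtain ⟨c, u, a, b, hab, hc, hca, hm, hcb, hul, hcA⟩ := H₂ s
    ⟨hs.1, hs.2.trans (min_le_right _ _)⟩ 0 (by simp) g r le_rfl
    (by rwa [map_zero, modelExp_zero])
  exact ⟨c b, H₁ s ⟨hs.1.le, hs.2.trans (min_le_left _ _)⟩ c u a b hab hc (by simp [hca]) hul.le hcA
    b ⟨hab, le_rfl⟩, hm, hcb⟩

theorem HorizontalNorm.isDistance_scaledDist_zero (h : HorizontalNorm G n P ι N k k')
    (hX : IsExpChart ρ lg Ω) : IsDistance (scaledDist G n P ι N 0) where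
  ne_top x y := by
    obtain ⟨L, s₀, hs₀, H⟩ := (h.frameFamily hX).exists_bound h.norm (max ‖x‖ ‖y‖ + 1) (by positivity)
    refine ne_top_of_le_ne_top ENNReal.ofReal_ne_top (H 0 ⟨le_rfl, hs₀.le⟩ x y ?_ ?_)
    · linarith [le_max_left ‖x‖ ‖y‖]
    · linarith [le_max_right ‖x‖ ‖y‖]
  eq_zero_iff x y := by
    obtain ⟨s₀, hs₀, H⟩ := (h.frameFamily hX).eq_of_dist_eq_zero h.norm (max ‖x‖ ‖y‖)
    refine ⟨H 0 ⟨le_rfl, hs₀.le⟩ x y (le_max_left _ _) (le_max_right _ _), ?_⟩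
    rintro rfl
    obtain ⟨s₁, hs₁, H₁⟩ := (h.frameFamily hX).arcBound ‖x‖
    exact (H₁ 0 ⟨le_rfl, hs₁.le⟩).dist_self h.norm.map_zero le_rfl
  symm x y := by
    rw [scaledDist, scaledDist, if_pos rfl, if_pos rfl, frameDist_comm h.norm]
  triangle x y z := (h.frameFamily hX).triangle 0 le_rfl x y z

/-- The bound for a single small `s₀` gives finiteness near `1`, and left translation gives it near
every point. The points at finite distance from `x` thus form a clopen set. -/
theorem HorizontalNorm.leftDist_ne_top [ConnectedSpace G] (h : HorizontalNorm G n P ι N k k')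
    (hX : IsExpChart ρ lg Ω) (x y : G) : leftDist G ι N x y ≠ ⊤ := by
  have hnear : ∀ᶠ g in 𝓝 (1 : G), leftDist G ι N 1 g ≠ ⊤ := by
    obtain ⟨L, s₀, hs₀, H⟩ := (h.frameFamily hX).exists_bound h.norm 1 one_pos
    have h0 : (0 : E) ∈ Metric.ball (0 : E) ρ := Metric.mem_ball_self hX.pos
    have h1Ω : (1 : G) ∈ Ω := modelExp_zero (E := E) (G := G) ▸ hX.exp_mem 0 h0
    have hl1 : lg 1 = 0 := by
      have := hX.log_exp 0 h0
      rwa [modelExp_zero] at this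
    have hcont : ContinuousAt (fun g => dilation n P s₀⁻¹ (lg g)) 1 :=
      (dilation n P s₀⁻¹).continuous.continuousAt.comp
        (hX.contMDiffOn_log.continuousOn.continuousAt (hX.isOpen.mem_nhds h1Ω))
    have hev : ∀ᶠ g in 𝓝 (1 : G), ‖dilation n P s₀⁻¹ (lg g)‖ < 1 :=
      hcont.norm.eventually_lt continuousAt_const (by simp [hl1])
    filter_upwards [hev, hX.isOpen.mem_nhds h1Ω] with g hg hgΩ htop
    have h2 := H s₀ ⟨hs₀.le, le_rfl⟩ 0 (dilation n P s₀⁻¹ (lg g)) (by simp) hg.le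
    rw [scaledDist, if_neg hs₀.ne', h.bracket.dilation_dilation_inv hs₀.ne', hX.exp_log g hgΩ,
      map_zero, modelExp_zero, htop, ENNReal.mul_top (by simpa using hs₀)] at h2
    exact absurd h2 (by simp)
  have hnear' : ∀ g : G, ∀ᶠ x in 𝓝 g, leftDist G ι N g x ≠ ⊤ := fun g => by
    have hc : Tendsto (fun x => g⁻¹ * x) (𝓝 g) (𝓝 1) := by
      have := (contMDiff_mul_left (I := 𝓘(ℝ, E)) (n := ∞) (a := g⁻¹)).continuous.tendsto g
      rwa [inv_mul_cancel] at this
    filter_upwards [hc.eventually hnear] with x hx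
    rwa [← leftDist_mul_left g, mul_one, mul_inv_cancel_left] at hx
  have hclopen : IsClopen {y : G | leftDist G ι N x y ≠ ⊤} := by
    refine ⟨⟨isOpen_iff_mem_nhds.2 fun y hy => ?_⟩, isOpen_iff_mem_nhds.2 fun y hy => ?_⟩
    · filter_upwards [hnear' y] with z hz hxz
      refine hy (ne_top_of_le_ne_top (ENNReal.add_ne_top.2 ⟨hxz, hz⟩) ?_)
      exact (leftDist_triangle x z y).trans (le_of_eq (by rw [leftDist_comm h.norm z y]))
    · filter_upwards [hnear' y] with z hz
      exact ne_top_of_le_ne_top (ENNReal.add_ne_top.2 ⟨hy, hz⟩) (leftDist_triangle x y z)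
  have hx : x ∈ {y : G | leftDist G ι N x y ≠ ⊤} := (hnear' x).self_of_nhds
  have := hclopen.eq_univ ⟨x, hx⟩
  exact this.ge (mem_univ y)

theorem HorizontalNorm.isDistance_leftDist [ConnectedSpace G] (h : HorizontalNorm G n P ι N k k')
    (hX : IsExpChart ρ lg Ω) : IsDistance (leftDist G ι N) where
  ne_top := h.leftDist_ne_top hX
  eq_zero_iff x y := by
    -- A point at distance `0` from `1` lies in every small ball, hence in the exponential chart,
    -- where a rescaled distance separates it from `1`.
    have key : ∀ g, leftDist G ι N 1 g = 0 ↔ g = 1 := fun g => by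
      obtain ⟨R, s₁, hs₁, H⟩ := h.exists_bound_of_leftDist hX zero_le_one
      obtain ⟨s₀, hs₀, H₀⟩ := (h.frameFamily hX).eq_of_dist_eq_zero h.norm (max R 0)
      obtain ⟨s₂, hs₂, H₂⟩ := (h.frameFamily hX).arcBound 0
      constructor
      · intro h0
        set s := min s₁ s₀ with hs
        have hs0 : 0 < s := lt_min hs₁ hs₀
        obtain ⟨q, hq, -, rfl⟩ := H s ⟨hs0, min_le_left _ _⟩ g (by rw [h0]; simpa using hs0)
        have := H₀ s ⟨hs0.le, min_le_right _ _⟩ 0 q (by simp) (hq.trans (le_max_left _ _)) (by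
          rw [scaledDist, if_neg hs0.ne', map_zero, modelExp_zero, h0, mul_zero])
        rw [← this, map_zero, modelExp_zero]
      · rintro rfl
        have := (H₂ s₂ ⟨hs₂.le, le_rfl⟩).dist_self h.norm.map_zero (p := 0) (by simp)
        rw [scaledDist, if_neg hs₂.ne', map_zero, modelExp_zero] at this
        have h2 : ENNReal.ofReal s₂⁻¹ ≠ 0 := by simpa using hs₂
        exact (mul_eq_zero.1 this).resolve_left h2
    rw [← leftDist_mul_left x⁻¹, inv_mul_cancel, key, inv_mul_eq_one]
  symm := leftDist_comm h.norm
  triangle := leftDist_triangle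

/-- The map is `f g = δ_{1/s} (log g)`. Rescaled balls have bounded image, where the distances `d_s`
and `d_0` are uniformly close. The points which approximate the limit ball are taken within `κ` of
`0`, so that they also lie in a prescribed neighbourhood. -/
theorem HorizontalNorm.exists_approximation (h : HorizontalNorm G n P ι N k k')
    (hX : IsExpChart ρ lg Ω) {r ε κ : ℝ} (hr : 0 < r) (hε : 0 < ε) (hκ : 0 < κ) :
    ∃ s₀ > 0, ∀ s ∈ Ioc 0 s₀, ∃ f : G → E, f 1 = 0 ∧
      (∀ x y, ENNReal.ofReal s⁻¹ * leftDist G ι N 1 x < ENNReal.ofReal r →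
        ENNReal.ofReal s⁻¹ * leftDist G ι N 1 y < ENNReal.ofReal r →
        scaledDist G n P ι N 0 (f x) (f y) ≤
          ENNReal.ofReal s⁻¹ * leftDist G ι N x y + ENNReal.ofReal (ε / 2) ∧
        ENNReal.ofReal s⁻¹ * leftDist G ι N x y ≤
          scaledDist G n P ι N 0 (f x) (f y) + ENNReal.ofReal (ε / 2)) ∧
      ∀ z, scaledDist G n P ι N 0 0 z < ENNReal.ofReal r → ∃ p : E, ‖p‖ < κ ∧
        ENNReal.ofReal s⁻¹ * leftDist G ι N 1 (modelExp G p) < ENNReal.ofReal r ∧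
        scaledDist G n P ι N 0 (f (modelExp G p)) z < ENNReal.ofReal ε := by
  have hfam := h.frameFamily hX
  obtain ⟨R₁, s₁, hs₁, H₁⟩ := h.exists_bound_of_leftDist hX hr.le
  obtain ⟨R₂, H₂⟩ := h.exists_bound_of_scaledDist_zero hr.le
  obtain ⟨δ, hδ, s', hs', heq⟩ := hfam.equicontinuous h.norm (|R₂| + 1) (by positivity)
    (show 0 < ε / 2 by positivity)
  -- A point `z` of the open limit ball may be too close to its boundary, so it is first shrunk to
  -- `δ_t z` with `t < 1` near `1`. This point is within `ε` of `z`, and its limit distance from `0`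
  -- is at most `t * r`, which leaves room for the error `(1 - t) * r / 2`.
  obtain ⟨t, ht1, ht0, htδ⟩ : ∃ t : ℝ, t < 1 ∧ 0 < t ∧
      ‖dilation n P 1 - dilation n P t‖ * |R₂| < min δ 1 := by
    have hc : ContinuousAt (fun t => ‖dilation n P 1 - dilation n P t‖ * |R₂|) 1 :=
      ((continuous_const.sub continuous_dilation).norm.mul continuous_const).continuousAt
    have h1 : ∀ᶠ t in 𝓝 (1 : ℝ), ‖dilation n P 1 - dilation n P t‖ * |R₂| < min δ 1 :=
      hc.eventually_lt continuousAt_const (by simp [hδ])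
    have h2 : ∀ᶠ t in 𝓝[<] (1 : ℝ), t < 1 := eventually_mem_nhdsWithin
    obtain ⟨t, ht⟩ := (h2.and (((lt_mem_nhds one_pos).and h1).filter_mono nhdsWithin_le_nhds)).exists
    exact ⟨t, ht.1, ht.2⟩
  have ht1' : 0 < (1 - t) * r := mul_pos (by linarith) hr
  set R := |R₁| + |R₂| + 1 with hR
  have hR0 : 0 < R := by positivity
  obtain ⟨s₂, hs₂, hadd⟩ := hfam.dist_le_add h.norm R hR0
    (show 0 < min (ε / 2) ((1 - t) * r / 2) by positivity)
  obtain ⟨s₃, hs₃, hmem⟩ := h.exists_dilation_mem (lt_min hX.pos hκ) R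
  refine ⟨min s₁ (min s₂ s₃), by positivity, fun s hs => ?_⟩
  have hs0 := hs.1
  have hne := hs0.ne'
  have hsmall := hs.2
  rw [le_min_iff, le_min_iff] at hsmall
  have hsI : s ∈ Icc 0 s₂ := ⟨hs0.le, hsmall.2.1⟩
  have h0I : (0 : ℝ) ∈ Icc 0 s₂ := ⟨le_rfl, hs₂.le⟩
  let f : G → E := fun g => dilation n P s⁻¹ (lg g)
  have hf : ∀ q, dilation n P s q ∈ Metric.ball (0 : E) ρ → f (modelExp G (dilation n P s q)) = q :=
    fun q hq => by
      simp only [f]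
      rw [hX.log_exp _ hq, h.bracket.dilation_inv_dilation hne]
  have hball : ∀ g, ENNReal.ofReal s⁻¹ * leftDist G ι N 1 g < ENNReal.ofReal r →
      ‖f g‖ ≤ R ∧ modelExp G (dilation n P s (f g)) = g := fun g hg => by
    have h2 := ENNReal.mul_lt_mul_right (show ENNReal.ofReal s ≠ 0 by simpa using hs0)
      ENNReal.ofReal_ne_top hg
    rw [← mul_assoc, ← ENNReal.ofReal_mul hs0.le, mul_inv_cancel₀ hne, ENNReal.ofReal_one,
      one_mul, ← ENNReal.ofReal_mul hs0.le] at h2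
    obtain ⟨q, hq, hqm, hqg⟩ := H₁ s ⟨hs0, hsmall.1⟩ g h2
    have : f g = q := by rw [← hqg, hf q hqm]
    rw [this]
    refine ⟨?_, hqg⟩
    linarith [le_abs_self R₁, abs_nonneg R₂]
  have hscaled : ∀ p q, scaledDist G n P ι N s p q = ENNReal.ofReal s⁻¹ *
      leftDist G ι N (modelExp G (dilation n P s p)) (modelExp G (dilation n P s q)) := fun p q => by
    rw [scaledDist, if_neg hne]
  have hle : ENNReal.ofReal (min (ε / 2) ((1 - t) * r / 2)) ≤ ENNReal.ofReal (ε / 2) :=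
    ENNReal.ofReal_le_ofReal (min_le_left _ _)
  refine ⟨f, ?_, fun x y hx hy => ?_, fun z hz => ?_⟩
  · have := hf 0 (by rw [map_zero]; exact Metric.mem_ball_self hX.pos)
    rwa [map_zero, modelExp_zero] at this
  · obtain ⟨hxR, hx'⟩ := hball x hx
    obtain ⟨hyR, hy'⟩ := hball y hy
    have e := hscaled (f x) (f y)
    rw [hx', hy'] at e
    rw [← e]
    exact ⟨(hadd s hsI 0 h0I _ _ hxR hyR).trans (by gcongr),
      (hadd 0 h0I s hsI _ _ hxR hyR).trans (by gcongr)⟩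
  · have hzR := (H₂ z hz).trans (le_abs_self _)
    set z' := dilation n P t z with hz'
    have hzz : ‖z - z'‖ ≤ min δ 1 := by
      have e : z - z' = (dilation n P 1 - dilation n P t) z := by
        rw [sub_apply, h.bracket.dilation_one]
      rw [e]
      refine (ContinuousLinearMap.le_opNorm _ _).trans (le_trans ?_ htδ.le)
      gcongr
    have hz'R : ‖z'‖ ≤ |R₂| + 1 := by
      have h1 := norm_sub_norm_le z' z
      rw [norm_sub_rev] at h1
      linarith [hzz.trans (min_le_right _ _)]
    have hz'R' : ‖z'‖ ≤ R := by linarith [abs_nonneg R₁]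
    have hm := hmem s ⟨hs0.le, hsmall.2.2⟩ z' hz'R'
    refine ⟨dilation n P s z', ?_, ?_, ?_⟩
    · have := Metric.ball_subset_ball (min_le_right _ _) hm
      simpa using this
    · have e := hscaled 0 z'
      rw [map_zero, modelExp_zero] at e
      rw [← e]
      have h1 := h.scaledDist_zero_dilation_le ht0 0 z
      rw [map_zero] at h1
      have h2 : ENNReal.ofReal t * scaledDist G n P ι N 0 0 z ≤ ENNReal.ofReal (t * r) := by
        rw [ENNReal.ofReal_mul ht0.le]
        gcongr
      calc scaledDist G n P ι N s 0 z' ≤ scaledDist G n P ι N 0 0 z' +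
            ENNReal.ofReal (min (ε / 2) ((1 - t) * r / 2)) :=
            hadd 0 h0I s hsI _ _ (by simpa using hR0.le) hz'R'
        _ ≤ ENNReal.ofReal (t * r) + ENNReal.ofReal ((1 - t) * r / 2) :=
            add_le_add (h1.trans h2) (ENNReal.ofReal_le_ofReal (min_le_right _ _))
        _ < ENNReal.ofReal r := by
            rw [← ENNReal.ofReal_add (by positivity) (by positivity)]
            exact (ENNReal.ofReal_lt_ofReal_iff hr).2 (by linarith)
    · rw [hf z' (Metric.ball_subset_ball (min_le_left _ _) hm)]
      refine (heq 0 ⟨le_rfl, hs'.le⟩ z' z hz'R (hzz.trans (min_le_left _ _))).trans_lt ?_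
      exact (ENNReal.ofReal_lt_ofReal_iff hε).2 (by linarith)

theorem HorizontalNorm.tendstoPointedGH (h : HorizontalNorm G n P ι N k k') (hX : IsExpChart ρ lg Ω)
    (x : G) : TendstoPointedGH (atTop : Filter ℝ) (fun _ => x)
      (fun lam p q => ENNReal.ofReal lam * leftDist G ι N p q) (0 : E) (scaledDist G n P ι N 0) := by
  intro r hr ε hε
  obtain ⟨s₀, hs₀, H⟩ := h.exists_approximation hX hr hε one_pos
  filter_upwards [eventually_ge_atTop s₀⁻¹] with lam hlam
  have hl0 : 0 < lam := (inv_pos.2 hs₀).trans_le hlam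
  obtain ⟨f, hf1, hf2, hf3⟩ := H lam⁻¹ ⟨inv_pos.2 hl0, inv_le_of_inv_le₀ hs₀ hlam⟩
  rw [inv_inv] at hf2 hf3
  have hxd : ∀ p, leftDist G ι N 1 (x⁻¹ * p) = leftDist G ι N x p := fun p => by
    rw [← leftDist_mul_left x, mul_one, mul_inv_cancel_left]
  refine ⟨fun p => f (x⁻¹ * p), by simp [hf1], ⟨ε / 2, by linarith, fun p q hp hq => ?_⟩,
    fun z hz => ?_⟩
  · have := hf2 (x⁻¹ * p) (x⁻¹ * q) (by rwa [hxd]) (by rwa [hxd])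
    rwa [leftDist_mul_left] at this
  · obtain ⟨p, -, hp, hpz⟩ := hf3 z hz
    refine ⟨x * modelExp G p, ?_, by simpa using hpz⟩
    rwa [← hxd, inv_mul_cancel_left]

theorem HorizontalNorm.tendstoPointedGH_modelExp (h : HorizontalNorm G n P ι N k k')
    (hX : IsExpChart ρ lg Ω) {U : Set E} (hU : U ∈ 𝓝 0) :
    TendstoPointedGH (atTop : Filter ℝ) (fun _ => (⟨0, mem_of_mem_nhds hU⟩ : U))
      (fun lam p q => ENNReal.ofReal lam * leftDist G ι N (modelExp G p.1) (modelExp G q.1))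
      (0 : E) (scaledDist G n P ι N 0) := by
  intro r hr ε hε
  obtain ⟨κ, hκ, hκU⟩ := Metric.mem_nhds_iff.1 hU
  obtain ⟨s₀, hs₀, H⟩ := h.exists_approximation hX hr hε hκ
  filter_upwards [eventually_ge_atTop s₀⁻¹] with lam hlam
  have hl0 : 0 < lam := (inv_pos.2 hs₀).trans_le hlam
  obtain ⟨f, hf1, hf2, hf3⟩ := H lam⁻¹ ⟨inv_pos.2 hl0, inv_le_of_inv_le₀ hs₀ hlam⟩
  rw [inv_inv] at hf2 hf3
  simp only [modelExp_zero]
  refine ⟨fun p => f (modelExp G p.1), by simp [hf1, modelExp_zero],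
    ⟨ε / 2, by linarith, fun p q hp hq => hf2 _ _ hp hq⟩, fun z hz => ?_⟩
  obtain ⟨p, hpκ, hp, hpz⟩ := hf3 z hz
  exact ⟨⟨p, hκU (by simpa using hpκ)⟩, hp, hpz⟩

end Convergence

/-! ### The horizontal norm of an inner product -/

/-- Cauchy–Schwarz, from the discriminant, gives the triangle inequality. The comparison constants
are the extreme values of the form norm on the compact unit sphere. -/
theorem exists_isEquivNorm_formNorm {F : Type*} [NormedAddCommGroup F] [NormedSpace ℝ F]
    [FiniteDimensional ℝ F] (B : LinearMap.BilinForm ℝ F) (hBsymm : ∀ u v, B u v = B v u)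
    (hBpos : ∀ u, u ≠ 0 → 0 < B u u) : ∃ k k', IsEquivNorm (formNorm B) k k' := by
  have hnn : ∀ u, 0 ≤ B u u := fun u => by
    rcases eq_or_ne u 0 with rfl | hu
    · simp
    · exact (hBpos u hu).le
  have hsmul : ∀ (c : ℝ) u, formNorm B (c • u) = |c| * formNorm B u := fun c u => by
    have : B (c • u) (c • u) = c * c * B u u := by simp; ring
    rw [formNorm, formNorm, this, Real.sqrt_mul (mul_self_nonneg c), Real.sqrt_mul_self_eq_abs]
  have hcs : ∀ u v, B u v ≤ formNorm B u * formNorm B v := fun u v => by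
    rw [formNorm, formNorm, ← Real.sqrt_mul (hnn u)]
    refine Real.le_sqrt_of_sq_le ?_
    have h : ∀ t : ℝ, 0 ≤ B u u * (t * t) + 2 * B u v * t + B v v := fun t => by
      have := hnn (t • u + v)
      simp only [map_add, map_smul, LinearMap.add_apply, LinearMap.smul_apply, smul_eq_mul] at this
      rw [hBsymm v u] at this
      linarith
    have := discrim_le_zero h
    rw [discrim] at this
    nlinarith
  have hadd : ∀ u v, formNorm B (u + v) ≤ formNorm B u + formNorm B v := fun u v => by
    refine Real.sqrt_le_iff.2 ⟨add_nonneg (Real.sqrt_nonneg _) (Real.sqrt_nonneg _), ?_⟩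
    have h1 : formNorm B u ^ 2 = B u u := Real.sq_sqrt (hnn u)
    have h2 : formNorm B v ^ 2 = B v v := Real.sq_sqrt (hnn v)
    have h3 := hcs u v
    simp only [map_add, LinearMap.add_apply]
    rw [hBsymm v u]
    nlinarith
  have hcont : Continuous (formNorm B) := by
    let B' : F →L[ℝ] F →L[ℝ] ℝ :=
      LinearMap.toContinuousLinearMap (LinearMap.toContinuousLinearMap.toLinearMap ∘ₗ B)
    have : Continuous fun u => B' u u := by fun_prop
    exact this.sqrt
  have hhom : ∀ u, u ≠ 0 → formNorm B u = ‖u‖ * formNorm B (‖u‖⁻¹ • u) := fun u hu => by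
    rw [hsmul, abs_of_nonneg (by positivity), mul_inv_cancel_left₀ (norm_ne_zero_iff.2 hu)]
  have hsph : ∀ u : F, u ≠ 0 → ‖u‖⁻¹ • u ∈ Metric.sphere (0 : F) 1 := fun u hu => by
    rw [mem_sphere_zero_iff_norm, norm_smul, norm_inv, norm_norm,
      inv_mul_cancel₀ (norm_ne_zero_iff.2 hu)]
  have h00 : formNorm B 0 = 0 := by simp [formNorm]
  -- The sphere is empty exactly for the zero space, where any constants serve.
  rcases (Metric.sphere (0 : F) 1).eq_empty_or_nonempty with hem | hne
  · have h0 : ∀ u : F, u = 0 := fun u => by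
      by_contra hu
      exact (hem ▸ hsph u hu : _ ∈ (∅ : Set F))
    exact ⟨1, 1, one_pos, fun u => by simp [h0 u, h00], fun u => by simp [h0 u, h00], hsmul, hadd⟩
  · obtain ⟨x, hx, hxmin⟩ := (isCompact_sphere (0 : F) 1).exists_isMinOn hne hcont.continuousOn
    obtain ⟨y, hy, hymax⟩ := (isCompact_sphere (0 : F) 1).exists_isMaxOn hne hcont.continuousOn
    refine ⟨formNorm B x, formNorm B y, Real.sqrt_pos.2 (hBpos x ?_), fun u => ?_, fun u => ?_,
      hsmul, hadd⟩
    · rintro rfl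
      simp at hx
    · rcases eq_or_ne u 0 with rfl | hu
      · simp [h00]
      · rw [hhom u hu, mul_comm]
        exact mul_le_mul_of_nonneg_left (hxmin (hsph u hu)) (norm_nonneg u)
    · rcases eq_or_ne u 0 with rfl | hu
      · simp [h00]
      · rw [hhom u hu, mul_comm (formNorm B y)]
        exact mul_le_mul_of_nonneg_left (hymax (hsph u hu)) (norm_nonneg u)

theorem ccEDist_eq_of_equiv {E : Type*} [NormedAddCommGroup E] [NormedSpace ℝ E] {H : Type*}
    [TopologicalSpace H] {I : ModelWithCorners ℝ E H} {M : Type*} [TopologicalSpace M]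
    [ChartedSpace H M] {F F' : Type*} (e : F' ≃ F) {X : ∀ p : M, F → TangentSpace I p} {N : F → ℝ}
    {X' : ∀ p : M, F' → TangentSpace I p} {N' : F' → ℝ} (hX : ∀ p u, X p (e u) = X' p u)
    (hN : ∀ u, N (e u) = N' u) (p q : M) : ccEDist I X N p q = ccEDist I X' N' p q := by
  obtain rfl : (fun p u => X p (e u)) = X' := funext fun p => funext (hX p)
  obtain rfl : (fun u => N (e u)) = N' := funext hN
  refine le_antisymm (le_of_forall_gt fun l hl => ?_) (le_of_forall_gt fun l hl => ?_)
  · obtain ⟨c, u, a, b, hab, h, hp, hq, hlt⟩ := ccEDist_lt_iff.1 hl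
    exact ccEDist_lt_iff.2 ⟨c, fun t => e (u t), a, b, hab, ⟨h.1, h.2, h.3⟩, hp, hq, hlt⟩
  · obtain ⟨c, u, a, b, hab, h, hp, hq, hlt⟩ := ccEDist_lt_iff.1 hl
    refine ccEDist_lt_iff.2 ⟨c, fun t => e.symm (u t), a, b, hab, ⟨h.1, h.2, ?_⟩, hp, hq, ?_⟩
    · simpa only [Equiv.apply_symm_apply] using h.3
    · simpa only [Equiv.apply_symm_apply] using hlt

/-! ### Transfer from the model space to the distances of the theorem. -/

section Model

variable {E : Type*} [NormedAddCommGroup E] [NormedSpace ℝ E]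
  {G : Type*} [TopologicalSpace G] [ChartedSpace E G] [Group G]
  {D : Submodule ℝ (GroupLieAlgebra 𝓘(ℝ, E) G)}

/-- The identification of `D` with a subspace of the model space. -/
noncomputable def modelSubmoduleEquiv (D : Submodule ℝ (GroupLieAlgebra 𝓘(ℝ, E) G)) :
    (D.map (lieAlgebraEquivModel E G).toLinearEquiv.toLinearMap : Submodule ℝ E) ≃ₗ[ℝ] D :=
  ((lieAlgebraEquivModel E G).toLinearEquiv.submoduleMap D).symm

theorem modelSubmoduleEquiv_apply
    (u : (D.map (lieAlgebraEquivModel E G).toLinearEquiv.toLinearMap : Submodule ℝ E)) :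
    ((modelSubmoduleEquiv D u : D) : GroupLieAlgebra 𝓘(ℝ, E) G) =
      (lieAlgebraEquivModel E G).symm u.1 := by
  obtain ⟨v, rfl⟩ := ((lieAlgebraEquivModel E G).toLinearEquiv.submoduleMap D).surjective u
  rw [modelSubmoduleEquiv, LinearEquiv.symm_apply_apply]
  rfl

theorem distG_eq (B : LinearMap.BilinForm ℝ D) :
    (distG D B : G → G → ℝ≥0∞) = leftDist G
      (D.map (lieAlgebraEquivModel E G).toLinearEquiv.toLinearMap : Submodule ℝ E).subtypeL
      (formNorm (B.compl₁₂ (modelSubmoduleEquiv D).toLinearMap (modelSubmoduleEquiv D).toLinearMap)) := by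
  funext x y
  refine ccEDist_eq_of_equiv (modelSubmoduleEquiv D).toEquiv (fun g u => ?_) (fun u => rfl) x y
  exact congrArg (fun v => mulInvariantVectorField v g) (modelSubmoduleEquiv_apply u)

variable [LieGroup 𝓘(ℝ, E) ∞ G] [CompleteSpace E] [FiniteDimensional ℝ E]

/-- The frame of the left translations of the nilpotent group is the limit frame at `s = 0`, because
the adjoint maps of the nilpotent bracket are nilpotent of order at most the dimension. -/
theorem fderiv_bchMul_modelNilBracket (𝒲 : AdaptedGrading D) (p : E) :
    fderiv ℝ (bchMul (modelNilBracket 𝒲) p) 0 =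
      expFrame (bracketFamily (finrank ℝ (GroupLieAlgebra 𝓘(ℝ, E) G)) (modelBracket E G)
        (𝒲.normedProj (lieAlgebraEquivModel E G).toLinearEquiv) 0) p := by
  have : FiniteDimensional ℝ (GroupLieAlgebra 𝓘(ℝ, E) G) := inferInstanceAs (FiniteDimensional ℝ E)
  have hb := 𝒲.filteredBracket (lieAlgebraEquivModel E G).toLinearEquiv
  exact (hasFDerivAt_bchMul (hb.bracketFamily_zero_pow p) fun x y =>
    (𝒲.bracketFamily_zero (lieAlgebraEquivModel E G).toLinearEquiv x y).symm).fderiv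

theorem distN_eq (𝒲 : AdaptedGrading D) (B : LinearMap.BilinForm ℝ D)
    (x y : GroupLieAlgebra 𝓘(ℝ, E) G) :
    distN 𝒲 B x y = scaledDist G (finrank ℝ (GroupLieAlgebra 𝓘(ℝ, E) G))
      (𝒲.normedProj (lieAlgebraEquivModel E G).toLinearEquiv)
      (D.map (lieAlgebraEquivModel E G).toLinearEquiv.toLinearMap : Submodule ℝ E).subtypeL
      (formNorm (B.compl₁₂ (modelSubmoduleEquiv D).toLinearMap (modelSubmoduleEquiv D).toLinearMap)) 0
      (lieAlgebraEquivModel E G x) (lieAlgebraEquivModel E G y) := by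
  rw [scaledDist, if_pos rfl]
  refine ccEDist_eq_of_equiv (modelSubmoduleEquiv D).toEquiv (fun p u => ?_) (fun u => rfl) _ _
  rw [fderiv_bchMul_modelNilBracket]
  exact congrArg _ (congrArg (lieAlgebraEquivModel E G) (modelSubmoduleEquiv_apply u))

theorem AdaptedGrading.exists_horizontalNorm (𝒲 : AdaptedGrading D)
    (B : LinearMap.BilinForm ℝ D) (hBsymm : ∀ u v, B u v = B v u) (hBpos : ∀ u, u ≠ 0 → 0 < B u u) :
    ∃ k k', HorizontalNorm G (finrank ℝ (GroupLieAlgebra 𝓘(ℝ, E) G))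
      (𝒲.normedProj (lieAlgebraEquivModel E G).toLinearEquiv)
      (D.map (lieAlgebraEquivModel E G).toLinearEquiv.toLinearMap : Submodule ℝ E).subtypeL
      (formNorm (B.compl₁₂ (modelSubmoduleEquiv D).toLinearMap (modelSubmoduleEquiv D).toLinearMap))
      k k' := by
  have : FiniteDimensional ℝ (GroupLieAlgebra 𝓘(ℝ, E) G) := inferInstanceAs (FiniteDimensional ℝ E)
  obtain ⟨k, k', hN⟩ := exists_isEquivNorm_formNorm
    (B.compl₁₂ (modelSubmoduleEquiv D).toLinearMap (modelSubmoduleEquiv D).toLinearMap)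
    (fun u v => hBsymm _ _) (fun u hu => hBpos _ (by simpa using hu))
  refine ⟨k, k', 𝒲.filteredBracket (lieAlgebraEquivModel E G).toLinearEquiv,
    Subtype.val_injective, ?_, fun x => ?_, hN⟩
  · rintro ⟨_, v, hv, rfl⟩
    have hv1 : v ∈ 𝒲.W 1 := by rwa [𝒲.W_one]
    exact (𝒲.normedProj_apply _ _ _).trans
      (congrArg (lieAlgebraEquivModel E G) ((𝒲.proj_of_mem hv1).trans (if_pos rfl)))
  · have h1 := 𝒲.proj_mem 1 ((lieAlgebraEquivModel E G).symm x)
    rw [𝒲.W_one] at h1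
    exact ⟨⟨_, mem_image_of_mem _ h1⟩, rfl⟩

end Model

theorem mainTheorem2
    {E : Type*} [NormedAddCommGroup E] [NormedSpace ℝ E] [FiniteDimensional ℝ E] [CompleteSpace E]
    {G : Type*} [TopologicalSpace G] [ChartedSpace E G] [Group G] [LieGroup 𝓘(ℝ, E) ∞ G]
    [T2Space G] [ConnectedSpace G]
    (D : Submodule ℝ (GroupLieAlgebra 𝓘(ℝ, E) G)) (hD : IsBracketGenerating D)
    (B : LinearMap.BilinForm ℝ D) (hBsymm : ∀ u v, B u v = B v u) (hBpos : ∀ u, u ≠ 0 → 0 < B u u)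
    (𝒲 : AdaptedGrading D) :
    IsDistance (distG D B) ∧ IsDistance (distN 𝒲 B) ∧
    (∀ x : G, TendstoPointedGH (atTop : Filter ℝ) (fun _ => x)
      (fun lam p q => ENNReal.ofReal lam * distG D B p q)
      (0 : GroupLieAlgebra 𝓘(ℝ, E) G) (distN 𝒲 B)) ∧
    (∃ U ∈ 𝓝 (0 : GroupLieAlgebra 𝓘(ℝ, E) G),
      InjOn (lieExp : GroupLieAlgebra 𝓘(ℝ, E) G → G) U) ∧
    ∀ (U : Set (GroupLieAlgebra 𝓘(ℝ, E) G)) (hU : U ∈ 𝓝 0),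
      InjOn (lieExp : GroupLieAlgebra 𝓘(ℝ, E) G → G) U →
      TendstoPointedGH (atTop : Filter ℝ) (fun _ => (⟨0, mem_of_mem_nhds hU⟩ : U))
        (fun lam X Y => ENNReal.ofReal lam * distG D B (lieExp X.1) (lieExp Y.1))
        (0 : GroupLieAlgebra 𝓘(ℝ, E) G) (distN 𝒲 B) := by
  obtain ⟨k, k', h⟩ := 𝒲.exists_horizontalNorm B hBsymm hBpos
  obtain ⟨ρ, lg, Ω, hX⟩ := exists_isExpChart (E := E) G
  have hN : distN 𝒲 B = fun x y => scaledDist G _ _ _ _ 0 (lieAlgebraEquivModel E G x)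
    (lieAlgebraEquivModel E G y) := funext fun x => funext fun y => distN_eq 𝒲 B x y
  have hinj : ∃ U ∈ 𝓝 (0 : E), InjOn (modelExp (E := E) G) U :=
    ⟨Metric.ball 0 ρ, Metric.ball_mem_nhds _ hX.pos, fun p hp q hq hpq =>
      (hX.log_exp p hp).symm.trans ((congrArg lg hpq).trans (hX.log_exp q hq))⟩
  rw [distG_eq, hN]
  exact ⟨h.isDistance_leftDist hX, h.isDistance_scaledDist_zero hX, h.tendstoPointedGH hX,
    hinj,
    fun U hU _ => h.tendstoPointedGH_modelExp hX hU⟩
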